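/- For a lattice $L\subset\mathbb R^n$ with dual lattice $L^*=\{y\in\mathbb R^n:\langle x,y\rangle\in\mathbb Z\ \text{for all } x\in L\}$ and $\varepsilon>0$, the smoothing parameter $\eta_\varepsilon(L)$ is the smallest $s>0$ such that $\sum_{w\in L^*\setminus\{0\}}e^{-\pi s^2\|w\|^2}\le\varepsilon$. For functions $\gamma,\varepsilon_Y,\varepsilon_N$ of the dimension $n\ge 1$, an instance of the promise problem $\gamma\text{-}\mathrm{GapSPP}_{\varepsilon_Y,\varepsilon_N}$ is a basis $B\in\mathbb Q^{n\times n}$, written in binary, of a full-rank lattice $L=L(B)\subset\mathbb R^n$. It is a YES instance if $\eta_{\varepsilon_Y(n)}(L)\le 1$ and a NO instance if $\eta_{\varepsilon_N(n)}(L)>\gamma(n)$. A promise problem is in $\mathrm{AM}$ if it has a two-message public-coin proof system: Arthur sends polynomially many uniform random bits, Merlin (computationally unbounded) answers with a string of polynomial length, and Arthur decides in deterministic time polynomial in the length of the instance; some answer leads to acceptance with probability at least $2/3$ over the coins on every YES instance, and with probability at most $1/3$ on every NO instance. It is in $\mathrm{coAM}$ if the problem with YES and NO instances exchanged is in $\mathrm{AM}$.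 A positive function $\varepsilon$ is called efficiently approximable if, given $n\ge1$ and $k$, an integer within distance $1$ of $k\ln\varepsilon(n)$ can be computed in time polynomial in $n+k$ (that is, $\varepsilon(n)$ can be approximated up to a factor $e^{\pm1/k}$). **Theorem.** Let $\alpha,\varepsilon_Y,\varepsilon_N$ be real-valued functions of $n\ge 1$ with $\varepsilon_Y(n)>0$ such that, for some polynomials $p,q$ that are positive on $n \geq 1$ and for all $n\ge1$, $$\alpha(n)\ \ge\ \frac1{p(n)}\qquad\text{and}\qquad \varepsilon_N(n)\ \ge\ \Bigl(1+\frac1{q(n)}\Bigr)\varepsilon_Y(n),$$ and such that at least one of $\varepsilon_Y,\varepsilon_N$ is efficiently approximable. Then $(1+\alpha)\text{-}\mathrm{GapSPP}_{\varepsilon_Y,\varepsilon_N}\in\mathrm{coAM}$. -/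

import Mathlib

open scoped ENNReal

namespace LatticeAM

/-! ## Lattices, Gaussian mass and the smoothing parameter -/

noncomputable section

/-- The Gaussian mass `ρ_s(A) = ∑_{v ∈ A} exp (-π ‖v‖² / s²)` of a set `A`, as an unconditional sum
in `[0, ∞]`. -/
def gaussianMass {n : ℕ} (s : ℝ) (A : Set (EuclideanSpace ℝ (Fin n))) : ℝ≥0∞ :=
  ∑' v : A, ENNReal.ofReal (Real.exp (-Real.pi * ‖(v : EuclideanSpace ℝ (Fin n))‖ ^ 2 / s ^ 2))

/-- The dual lattice `L* = {y | ⟪y, x⟫ ∈ ℤ for all x ∈ L}`. -/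
def dualLattice {n : ℕ} (L : Submodule ℤ (EuclideanSpace ℝ (Fin n))) :
    Submodule ℤ (EuclideanSpace ℝ (Fin n)) :=
  LinearMap.BilinForm.dualSubmodule (innerₗ (EuclideanSpace ℝ (Fin n))) L

/-- The smoothing parameter `η_ε(L)`: the smallest `s > 0` with `ρ_{1/s}(L* \ {0}) ≤ ε`. -/
def smoothingParameter {n : ℕ} (ε : ℝ) (L : Submodule ℤ (EuclideanSpace ℝ (Fin n))) : ℝ :=
  sInf {s : ℝ | 0 < s ∧
    gaussianMass (1 / s) ((dualLattice L : Set (EuclideanSpace ℝ (Fin n))) \ {0})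
      ≤ ENNReal.ofReal ε}

/-- The lattice `L(B)`: all integer combinations of the columns of the rational matrix `B`. -/
def latticeOf {n : ℕ} (B : Matrix (Fin n) (Fin n) ℚ) :
    Submodule ℤ (EuclideanSpace ℝ (Fin n)) :=
  Submodule.span ℤ (Set.range fun j : Fin n => WithLp.toLp 2 fun i : Fin n => ((B i j : ℚ) : ℝ))

end

/-! ## Binary encoding of instances -/

/-- Self-delimiting binary code of a natural number: each binary digit `b` is written `1b`, and the
code ends in `0`. -/
def encodeNat (k : ℕ) : List Bool :=
  (Nat.bits k).flatMap (fun b => [true, b]) ++ [false]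

/-- A sign bit followed by the absolute value. -/
def encodeInt (z : ℤ) : List Bool :=
  decide (z < 0) :: encodeNat z.natAbs

/-- Numerator and denominator in lowest terms. -/
def encodeRat (q : ℚ) : List Bool :=
  encodeInt q.num ++ encodeNat q.den

/-- The dimension followed by the entries, row by row. -/
def encodeMatrix {n : ℕ} (B : Matrix (Fin n) (Fin n) ℚ) : List Bool :=
  encodeNat n ++ (List.ofFn fun i => (List.ofFn fun j => encodeRat (B i j)).flatten).flatten

/-! ## A machine model with logarithmic (bit) cost -/

/-- The contents of the registers; each register holds a natural number of arbitrary size. -/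
abbrev Store := ℕ → ℕ

inductive ArithOp where
  | add | sub | mul | div

/-- Truncated subtraction, and integer division rounding down (with `a / 0 = 0`). -/
def ArithOp.eval : ArithOp → ℕ → ℕ → ℕ
  | .add, a, b => a + b
  | .sub, a, b => a - b
  | .mul, a, b => a * b
  | .div, a, b => a / b

/-- Structured programs for a register machine; `x`, `y`, `z` are names of registers. A program
mentions only finitely many registers. -/
inductive Cmd where
  | skip : Cmd
  /-- `x := k` -/
  | const (x k : ℕ) : Cmd
  /-- `x := y ∘ z` -/
  | arith (o : ArithOp) (x y z : ℕ) : Cmd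
  | seq (c d : Cmd) : Cmd
  /-- if `x ≠ 0` then `c` else `d` -/
  | ite (x : ℕ) (c d : Cmd) : Cmd
  /-- while `x ≠ 0` do `c` -/
  | loop (x : ℕ) (c : Cmd) : Cmd

/-- `Runs c σ t τ`: started in the store `σ`, the program `c` halts in the store `τ` after time `t`.
Time is bit cost: `Nat.size` is the binary length, a test or a constant costs the length of the
number plus one, and an arithmetic operation costs the product of the lengths of its operands (each
plus one), as the schoolbook algorithms do. -/
inductive Runs : Cmd → Store → ℕ → Store → Prop where
  | skip (σ : Store) : Runs .skip σ 1 σ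
  | const (x k : ℕ) (σ : Store) :
      Runs (.const x k) σ (Nat.size k + 1) (Function.update σ x k)
  | arith (o : ArithOp) (x y z : ℕ) (σ : Store) :
      Runs (.arith o x y z) σ ((Nat.size (σ y) + 1) * (Nat.size (σ z) + 1))
        (Function.update σ x (o.eval (σ y) (σ z)))
  | seq {c d : Cmd} {σ τ υ : Store} {s t : ℕ} :
      Runs c σ s τ → Runs d τ t υ → Runs (.seq c d) σ (s + t) υ
  | ite_true {x : ℕ} {c d : Cmd} {σ τ : Store} {t : ℕ} :
      σ x ≠ 0 → Runs c σ t τ → Runs (.ite x c d) σ (Nat.size (σ x) + 1 + t) τ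
  | ite_false {x : ℕ} {c d : Cmd} {σ τ : Store} {t : ℕ} :
      σ x = 0 → Runs d σ t τ → Runs (.ite x c d) σ (Nat.size (σ x) + 1 + t) τ
  | loop_done {x : ℕ} {c : Cmd} {σ : Store} :
      σ x = 0 → Runs (.loop x c) σ (Nat.size (σ x) + 1) σ
  | loop_step {x : ℕ} {c : Cmd} {σ τ υ : Store} {s t : ℕ} :
      σ x ≠ 0 → Runs c σ s τ → Runs (.loop x c) τ t υ →
      Runs (.loop x c) σ (Nat.size (σ x) + 1 + s + t) υ

/-- The initial store: the arguments are in the first registers, all others hold `0`. -/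
def initStore (args : List ℕ) : Store := fun i => args.getD i 0

/-- A bit string as one number: its bits, the first one least significant, below a leading `1`. -/
def codeBits : List Bool → ℕ
  | [] => 1
  | b :: l => 2 * codeBits l + b.toNat

/-! ## Promise problems, `AM` and `coAM` -/

/-- A promise problem over bit strings, given by its YES and its NO instances. -/
structure PromiseProblem where
  yes : Set (List Bool)
  no : Set (List Bool)

/-- The complement: YES and NO instances exchange their roles. -/
def PromiseProblem.compl (P : PromiseProblem) : PromiseProblem := ⟨P.no, P.yes⟩

/-- The verifier `V` accepts input `x` with coins `r` and prover message `m`: it halts with a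
nonzero number in register `0`. Strings of coins and messages of length `ℓ` are identified with
the numbers below `2 ^ ℓ`. -/
def Accepts (V : Cmd) (x : List Bool) (r m : ℕ) : Prop :=
  ∃ t τ, Runs V (initStore [codeBits x, r, m]) t τ ∧ τ 0 ≠ 0

open Classical in
/-- The probability, over `ℓ` uniform public coins `r`, that some message `m` of length `ℓ` makes
the verifier accept: the success probability of an optimal prover, who answers after seeing `r`. -/
noncomputable def acceptProb (V : Cmd) (ℓ : ℕ) (x : List Bool) : ℝ :=
  (((Finset.range (2 ^ ℓ)).filter fun r => ∃ m < 2 ^ ℓ, Accepts V x r m).card : ℝ) / 2 ^ ℓ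

/-- The class `AM` of promise problems with a two-message public-coin proof system: Arthur sends
polynomially many uniform coins, Merlin answers with a message of polynomial length, and Arthur
decides in deterministic polynomial time; completeness `2/3` and soundness error `1/3`. -/
def InAM (P : PromiseProblem) : Prop :=
  ∃ (V : Cmd) (ℓ q : Polynomial ℕ),
    (∀ (x : List Bool) (r m : ℕ), r < 2 ^ ℓ.eval x.length → m < 2 ^ ℓ.eval x.length →
      ∃ t τ, Runs V (initStore [codeBits x, r, m]) t τ ∧ t ≤ q.eval x.length) ∧
    (∀ x ∈ P.yes, 2 / 3 ≤ acceptProb V (ℓ.eval x.length) x) ∧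
    (∀ x ∈ P.no, acceptProb V (ℓ.eval x.length) x ≤ 1 / 3)

/-- `coAM`: the complement is in `AM`. -/
def InCoAM (P : PromiseProblem) : Prop := InAM P.compl

/-! ## The problem `γ-GapSPP_{εY, εN}` -/

/-- An instance is (the encoding of) a basis of an `n`-dimensional lattice `L`, `n ≥ 1`. It is a YES
instance if `η_{εY(n)}(L) ≤ 1` and a NO instance if `η_{εN(n)}(L) > γ(n)`. -/
def gapSPP (γ εY εN : ℕ → ℝ) : PromiseProblem where
  yes := {x | ∃ (n : ℕ) (B : Matrix (Fin n) (Fin n) ℚ), 0 < n ∧ B.det ≠ 0 ∧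
    x = encodeMatrix B ∧ smoothingParameter (εY n) (latticeOf B) ≤ 1}
  no := {x | ∃ (n : ℕ) (B : Matrix (Fin n) (Fin n) ℚ), 0 < n ∧ B.det ≠ 0 ∧
    x = encodeMatrix B ∧ γ n < smoothingParameter (εN n) (latticeOf B)}

/-- A positive function `ε` is efficiently approximable if some program, given `n ≥ 1` and `k`,
computes in time polynomial in `n + k` an integer (a difference of two naturals) within `1` of
`k * log (ε n)`; so `log (ε n)` is found up to `1 / k`, and `ε n` up to a factor `exp (± 1 / k)`. -/
def EfficientlyApproximable (ε : ℕ → ℝ) : Prop :=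
  ∃ (c : Cmd) (q : Polynomial ℕ), ∀ n k : ℕ, 0 < n →
    ∃ t τ, Runs c (initStore [n, k]) t τ ∧ t ≤ q.eval (n + k) ∧
      |((τ 0 : ℝ) - (τ 1 : ℝ)) - k * Real.log (ε n)| ≤ 1

end LatticeAM

namespace LatticeAM

/-! ## The machine model: determinism, growth of the registers, relocation -/

/-! Membership in coAM requires a proof that `η_{εN}(L) > 1 + α`, that is, that the dual lattice
carries large Gaussian mass. Mass is a weighted count, so the Goldwasser–Sipser protocol for lower
bounds on set sizes applies once the mass has become the cardinality of a set with easily checked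
membership.

Let `l` be the length of the instance and `a = (l + 1) ^ c`. Choose `T` with `εY ≤ exp (-T)` and
`exp (-T + 1/(2a)) ≤ εN`, where `D T` is known up to `1` for `D = 32 a`. A nonzero dual vector `w`,
with `y` an upper approximation of `π ‖w‖²`, is given about `(M D + D T - D y)₊ ^ M` copies, an
integer close to `(M D) ^ M * exp (T - y)`.

If `η_{εY}(L) ≤ 1`, then `1 + x ≤ exp x` and the overestimate of `π` make all errors one-sided for
every vector at once, and at most `(M D) ^ M * exp (1/D)` copies exist (`card_points_le`). If
`η_{εN}(L) > 1 + α`, the mass with exponent `π (1 + 1/a)² ‖w‖²` exceeds `exp (-T + 1/(2a))`. One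
factor `1 + 1/a` pays for `π`. The other leaves a spare `exp (-y/a)`, which absorbs the second order
error of the power. This needs `T` to be polynomially bounded, which `sum_exp_dichotomy` arranges:
otherwise some vector has `y ≤ T - 2`, and its weight alone suffices by Bernoulli's inequality. So
at least `(M D) ^ M * exp (1/(4a))` copies exist (`le_card_points`).

Passing to `16 a`-tuples turns these two estimates into sizes at most `K / 3` and at least `4 K` for
`K = threshold c l`. The coins describe an affine hash modulo a power of two, and Merlin has to
exhibit a tuple hashed into a window of proportion about `1 / K`. A union bound (`hash_upper`) and a
second moment bound (`hash_lower`) give the probabilities `1/3` and `2/3`.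

Besides the tuple, Merlin sends the decoded instance and a scaled inverse matrix. The encoding is
injective and the inverse can be checked, so these hints cannot be forged (`exists_good_iff`). That
the checks take polynomial time on the machine follows from closure properties of the predicate
`PT`. -/

theorem Runs.det {c : Cmd} {σ τ τ' : Store} {t t' : ℕ} (h : Runs c σ t τ) (h' : Runs c σ t' τ') :
    t = t' ∧ τ = τ' := by
  induction h generalizing t' τ' with
  | skip σ => cases h'; exact ⟨rfl, rfl⟩
  | const x k σ => cases h'; exact ⟨rfl, rfl⟩
  | arith o x y z σ => cases h'; exact ⟨rfl, rfl⟩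
  | seq _ _ ih₁ ih₂ =>
    cases h' with
    | seq a b =>
      obtain ⟨rfl, rfl⟩ := ih₁ a
      obtain ⟨rfl, rfl⟩ := ih₂ b
      exact ⟨rfl, rfl⟩
  | ite_true hx _ ih =>
    cases h' with
    | ite_true _ a => obtain ⟨rfl, rfl⟩ := ih a; exact ⟨rfl, rfl⟩
    | ite_false hx' _ => exact absurd hx' hx
  | ite_false hx _ ih =>
    cases h' with
    | ite_true hx' _ => exact absurd hx hx'
    | ite_false _ a => obtain ⟨rfl, rfl⟩ := ih a; exact ⟨rfl, rfl⟩
  | loop_done hx =>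
    cases h' with
    | loop_done _ => exact ⟨rfl, rfl⟩
    | loop_step hx' _ _ => exact absurd hx hx'
  | loop_step hx _ _ ih₁ ih₂ =>
    cases h' with
    | loop_done hx' => exact absurd hx' hx
    | loop_step _ a b =>
      obtain ⟨rfl, rfl⟩ := ih₁ a
      obtain ⟨rfl, rfl⟩ := ih₂ b
      exact ⟨rfl, rfl⟩

theorem size_add_le (a b : ℕ) : Nat.size (a + b) ≤ max (Nat.size a) (Nat.size b) + 1 := by
  rw [Nat.size_le, pow_succ]
  have h₁ := (Nat.lt_size_self a).trans_le
    (Nat.pow_le_pow_right two_pos (le_max_left (Nat.size a) (Nat.size b)))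
  have h₂ := (Nat.lt_size_self b).trans_le
    (Nat.pow_le_pow_right two_pos (le_max_right (Nat.size a) (Nat.size b)))
  omega

theorem size_mul_le (a b : ℕ) : Nat.size (a * b) ≤ Nat.size a + Nat.size b := by
  rw [Nat.size_le, pow_add]
  exact Nat.mul_lt_mul'' (Nat.lt_size_self a) (Nat.lt_size_self b)

theorem size_le_self (a : ℕ) : Nat.size a ≤ a := by
  rw [Nat.size_le]; exact Nat.lt_two_pow_self

theorem ArithOp.size_eval_le (o : ArithOp) (a b : ℕ) :
    Nat.size (o.eval a b) ≤ Nat.size a + Nat.size b + 1 := by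
  cases o with
  | add => exact (size_add_le a b).trans (by omega)
  | sub => exact (Nat.size_le_size (Nat.sub_le a b)).trans (by omega)
  | mul => exact (size_mul_le a b).trans (by omega)
  | div => exact (Nat.size_le_size (Nat.div_le_self a b)).trans (by omega)

/-- Registers grow by at most one bit per unit of time. -/
theorem Runs.size_le {c : Cmd} {σ τ : Store} {t : ℕ} (h : Runs c σ t τ) :
    ∀ B : ℕ, (∀ i, Nat.size (σ i) ≤ B) → ∀ i, Nat.size (τ i) ≤ B + t := by
  induction h with
  | skip σ => intro B hB i; exact (hB i).trans (by omega)
  | const x k σ =>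
    intro B hB i
    by_cases hi : i = x
    · subst hi; simp; omega
    · simpa [Function.update_of_ne hi] using (hB i).trans (by omega)
  | arith o x y z σ =>
    intro B hB i
    by_cases hi : i = x
    · subst hi
      have h₁ := o.size_eval_le (σ y) (σ z)
      have h₂ := hB y
      simp only [Function.update_self]
      nlinarith [Nat.zero_le (Nat.size (σ y) * Nat.size (σ z))]
    · simpa [Function.update_of_ne hi] using (hB i).trans (by omega)
  | seq _ _ ih₁ ih₂ => intro B hB i; have := ih₂ _ (ih₁ B hB) i; omega
  | ite_true hx _ ih => intro B hB i; have := ih _ hB i; omega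
  | ite_false hx _ ih => intro B hB i; have := ih _ hB i; omega
  | loop_done hx => intro B hB i; have := hB i; omega
  | loop_step hx _ _ ih₁ ih₂ => intro B hB i; have := ih₂ _ (ih₁ B hB) i; omega

/-- Rename every register `i` to `s + i`. -/
def Cmd.shift (s : ℕ) : Cmd → Cmd
  | .skip => .skip
  | .const x k => .const (s + x) k
  | .arith o x y z => .arith o (s + x) (s + y) (s + z)
  | .seq c d => .seq (c.shift s) (d.shift s)
  | .ite x c d => .ite (s + x) (c.shift s) (d.shift s)
  | .loop x c => .loop (s + x) (c.shift s)

/-- A number above all registers that a program mentions. -/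
def Cmd.width : Cmd → ℕ
  | .skip => 0
  | .const x _ => x + 1
  | .arith _ x y z => x + y + z + 1
  | .seq c d => c.width + d.width
  | .ite x c d => x + 1 + c.width + d.width
  | .loop x c => x + 1 + c.width

/-- A run reads and writes only registers below the width, so it can be replayed step by step at the
same cost. `B` may exceed the width, so that an output register the program never mentions is also
tracked. -/
theorem Runs.shift {c : Cmd} {σ τ : Store} {t : ℕ} (h : Runs c σ t τ) (s B : ℕ) :
    c.width ≤ B → ∀ σ' : Store, (∀ i < B, σ' (s + i) = σ i) →
      ∃ τ', Runs (c.shift s) σ' t τ' ∧ (∀ i < B, τ' (s + i) = τ i) ∧ ∀ i < s, τ' i = σ' i := by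
  induction h with
  | skip σ => intro _ σ' h; exact ⟨σ', .skip _, h, fun _ _ => rfl⟩
  | const x k σ =>
    intro _ σ' h
    refine ⟨_, .const _ _ _, fun i hi => ?_, fun i hi => ?_⟩
    · by_cases hx : i = x
      · subst hx; simp
      · rw [Function.update_of_ne hx, Function.update_of_ne (by omega), h i hi]
    · rw [Function.update_of_ne (by omega)]
  | arith o x y z σ =>
    intro hw σ' h
    simp only [Cmd.width] at hw
    have hy := h y (by omega)
    have hz := h z (by omega)
    refine ⟨Function.update σ' (s + x) (o.eval (σ y) (σ z)), ?_, fun i hi => ?_, fun i hi => ?_⟩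
    · have := Runs.arith o (s + x) (s + y) (s + z) σ'
      rwa [hy, hz] at this
    · by_cases hx : i = x
      · subst hx; simp
      · rw [Function.update_of_ne hx, Function.update_of_ne (by omega), h i hi]
    · rw [Function.update_of_ne (by omega)]
  | seq _ _ ih₁ ih₂ =>
    intro hw σ' h
    simp only [Cmd.width] at hw
    obtain ⟨τ₁, r₁, e₁, f₁⟩ := ih₁ (by omega) σ' h
    obtain ⟨τ₂, r₂, e₂, f₂⟩ := ih₂ (by omega) τ₁ e₁
    exact ⟨τ₂, .seq r₁ r₂, e₂, fun i hi => (f₂ i hi).trans (f₁ i hi)⟩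
  | @ite_true x c d σ τ t hx _ ih =>
    intro hw σ' h
    simp only [Cmd.width] at hw
    obtain ⟨τ₁, r₁, e₁, f₁⟩ := ih (by omega) σ' h
    have hx' := h x (by omega)
    refine ⟨τ₁, ?_, e₁, f₁⟩
    rw [← hx']; exact .ite_true (by rwa [hx']) r₁
  | @ite_false x c d σ τ t hx _ ih =>
    intro hw σ' h
    simp only [Cmd.width] at hw
    obtain ⟨τ₁, r₁, e₁, f₁⟩ := ih (by omega) σ' h
    have hx' := h x (by omega)
    refine ⟨τ₁, ?_, e₁, f₁⟩
    rw [← hx']; exact .ite_false (by rwa [hx']) r₁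
  | @loop_done x c σ hx =>
    intro hw σ' h
    simp only [Cmd.width] at hw
    have hx' := h x (by omega)
    refine ⟨σ', ?_, h, fun _ _ => rfl⟩
    rw [← hx']; exact .loop_done (by rwa [hx'])
  | @loop_step x c σ τ υ t₁ t₂ hx _ _ ih₁ ih₂ =>
    intro hw σ' h
    have hw' := hw
    simp only [Cmd.width] at hw
    obtain ⟨τ₁, r₁, e₁, f₁⟩ := ih₁ (by omega) σ' h
    obtain ⟨τ₂, r₂, e₂, f₂⟩ := ih₂ hw' τ₁ e₁
    have hx' := h x (by omega)
    refine ⟨τ₂, ?_, e₂, fun i hi => (f₂ i hi).trans (f₁ i hi)⟩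
    rw [← hx']; exact .loop_step (by rwa [hx']) r₁ r₂

/-- Clear the registers `s, …, s + b - 1`. -/
def Cmd.clear (s : ℕ) : ℕ → Cmd
  | 0 => .skip
  | b + 1 => .seq (Cmd.clear s b) (.const (s + b) 0)

theorem Cmd.runs_clear (s b : ℕ) (σ : Store) :
    Runs (Cmd.clear s b) σ (b + 1) (fun i => if s ≤ i ∧ i < s + b then 0 else σ i) := by
  induction b with
  | zero =>
    have : (fun i => if s ≤ i ∧ i < s + 0 then 0 else σ i) = σ := by
      funext i; rw [if_neg (by omega)]
    rw [this]; exact .skip σ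
  | succ b ih =>
    have := Runs.seq ih (Runs.const (s + b) 0 _)
    simp only [Nat.size_zero] at this
    have e : (fun i => if s ≤ i ∧ i < s + (b + 1) then 0 else σ i) =
        Function.update (fun i => if s ≤ i ∧ i < s + b then 0 else σ i) (s + b) 0 := by
      funext i
      by_cases hi : i = s + b
      · subst hi; simp
      · rw [Function.update_of_ne hi]
        congr 1
        apply propext; omega
    rw [e]; exact this

/-! ## Functions computable in polynomial time -/

/-- Inputs of a program: the contents of its argument registers and a measure of their length. -/
class Enc (Ω : Type) where
  enc : Ω → List ℕ
  sz : Ω → ℕ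
  size_le_sz : ∀ ω, ∀ x ∈ enc ω, Nat.size x ≤ sz ω

open Enc

/-- An input together with an index, which is measured in unary. -/
instance instEncProd {Ω : Type} [Enc Ω] : Enc (ℕ × Ω) where
  enc p := p.1 :: enc p.2
  sz p := p.1 + sz p.2
  size_le_sz p x hx := by
    rcases List.mem_cons.1 hx with rfl | hx
    · exact (size_le_self _).trans (by omega)
    · exact (size_le_sz p.2 x hx).trans (by omega)

def PolyBdd {Ω : Type} [Enc Ω] (f : Ω → ℕ) : Prop := ∃ P : Polynomial ℕ, ∀ ω, f ω ≤ P.eval (sz ω)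

theorem eval_mono (P : Polynomial ℕ) {a b : ℕ} (h : a ≤ b) : P.eval a ≤ P.eval b := by
  rw [Polynomial.eval_eq_sum_range, Polynomial.eval_eq_sum_range]
  exact Finset.sum_le_sum fun i _ => Nat.mul_le_mul_left _ (Nat.pow_le_pow_left h i)

section
variable {Ω : Type} [Enc Ω]

namespace PolyBdd

theorem mono {f g : Ω → ℕ} (hg : PolyBdd g) (h : ∀ ω, f ω ≤ g ω) : PolyBdd f :=
  let ⟨P, hP⟩ := hg; ⟨P, fun ω => (h ω).trans (hP ω)⟩

theorem const (k : ℕ) : PolyBdd (fun _ : Ω => k) := ⟨Polynomial.C k, fun _ => by simp⟩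

theorem sz : PolyBdd (fun ω : Ω => sz ω) := ⟨Polynomial.X, fun _ => by simp⟩

theorem add {f g : Ω → ℕ} (hf : PolyBdd f) (hg : PolyBdd g) : PolyBdd fun ω => f ω + g ω :=
  let ⟨P, hP⟩ := hf; let ⟨R, hR⟩ := hg
  ⟨P + R, fun ω => by rw [Polynomial.eval_add]; exact Nat.add_le_add (hP ω) (hR ω)⟩

theorem mul {f g : Ω → ℕ} (hf : PolyBdd f) (hg : PolyBdd g) : PolyBdd fun ω => f ω * g ω :=
  let ⟨P, hP⟩ := hf; let ⟨R, hR⟩ := hg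
  ⟨P * R, fun ω => by rw [Polynomial.eval_mul]; exact Nat.mul_le_mul (hP ω) (hR ω)⟩

theorem polyEval {f : Ω → ℕ} (hf : PolyBdd f) (R : Polynomial ℕ) :
    PolyBdd fun ω => R.eval (f ω) :=
  let ⟨P, hP⟩ := hf
  ⟨R.comp P, fun ω => by rw [Polynomial.eval_comp]; exact eval_mono R (hP ω)⟩

theorem index : PolyBdd (fun p : ℕ × Ω => p.1) :=
  PolyBdd.sz.mono fun p => Nat.le_add_right p.1 _

theorem weaken {f : Ω → ℕ} (hf : PolyBdd f) : PolyBdd (fun p : ℕ × Ω => f p.2) :=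
  let ⟨P, hP⟩ := hf
  ⟨P, fun p => (hP p.2).trans (eval_mono P (Nat.le_add_left _ p.1))⟩

/-- A uniform bound over all indices up to `N`. -/
theorem exists_uniform {g : ℕ × Ω → ℕ} {N : Ω → ℕ} (hg : PolyBdd g) (hN : PolyBdd N) :
    ∃ G : Ω → ℕ, PolyBdd G ∧ ∀ ω, ∀ i ≤ N ω, g (i, ω) ≤ G ω :=
  let ⟨P, hP⟩ := hg
  ⟨fun ω => P.eval (N ω + Enc.sz ω), (hN.add PolyBdd.sz).polyEval P, fun ω i hi =>
    (hP (i, ω)).trans (eval_mono P (Nat.add_le_add_right hi _))⟩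

end PolyBdd

/-- `f` is computable in polynomial time, by a program that finds its arguments in given registers
`ρ`, writes the result to a given register `s`, and leaves the registers below `s` untouched. -/
def PT (f : Ω → ℕ) : Prop :=
  PolyBdd (fun ω => Nat.size (f ω)) ∧
  ∀ (ρ : List ℕ) (s : ℕ), (∀ r ∈ ρ, r < s) → ∃ (c : Cmd) (T : Ω → ℕ), PolyBdd T ∧
    ∀ (ω : Ω) (σ : Store), ρ.map σ = enc ω →
      ∃ t τ, Runs c σ t τ ∧ t ≤ T ω ∧ τ s = f ω ∧ ∀ i < s, τ i = σ i

namespace PT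

theorem congr {f g : Ω → ℕ} (hf : PT f) (h : ∀ ω, g ω = f ω) : PT g := by
  have : g = f := funext h
  rwa [this]

theorem const (k : ℕ) : PT (fun _ : Ω => k) :=
  ⟨.const _, fun _ s _ => ⟨.const s k, fun _ => Nat.size k + 1, .const _, fun _ σ _ =>
    ⟨_, _, .const s k σ, le_rfl, by simp, fun i hi => Function.update_of_ne (by omega) _ _⟩⟩⟩

theorem copy_runs (s r : ℕ) (s' : ℕ) (hs : s' ≠ r) (σ : Store) :
    Runs (.seq (.const s' 0) (.arith .add s r s')) σ (Nat.size (σ r) + 2)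
      (Function.update (Function.update σ s' 0) s (σ r)) := by
  have := Runs.seq (Runs.const s' 0 σ) (Runs.arith .add s r s' (Function.update σ s' 0))
  rw [Function.update_of_ne (by omega : r ≠ s')] at this
  simp only [Function.update_self, Nat.size_zero, ArithOp.eval, Nat.add_zero] at this
  convert this using 1
  ring

/-- Copying an argument. -/
theorem var (i : ℕ) : PT (fun ω : Ω => (enc ω).getD i 0) := by
  have key : ∀ ω : Ω, Nat.size ((enc ω).getD i 0) ≤ sz ω := fun ω => by
    by_cases hi : i < (enc ω).length
    · rw [List.getD_eq_getElem _ _ hi]; exact size_le_sz ω _ (List.getElem_mem hi)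
    · rw [List.getD_eq_default _ _ (by omega)]; simp
  refine ⟨PolyBdd.sz.mono key, fun ρ s hρ => ?_⟩
  by_cases hi : i < ρ.length
  · have hlt : ρ[i] < s := hρ _ (List.getElem_mem hi)
    refine ⟨.seq (.const s 0) (.arith .add s ρ[i] s), fun ω => sz ω + 2,
      PolyBdd.sz.add (.const 2), fun ω σ h => ?_⟩
    have hv : (enc ω).getD i 0 = σ ρ[i] := by
      rw [← h, List.getD_eq_getElem _ _ (by simpa using hi), List.getElem_map]
    refine ⟨_, _, copy_runs s ρ[i] s (by omega) σ, ?_, ?_, fun j hj => ?_⟩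
    · have := key ω; rw [hv] at this; show _ ≤ sz ω + 2; omega
    · rw [Function.update_self, ← hv]
    · rw [Function.update_of_ne (by omega), Function.update_of_ne (by omega)]
  · refine ⟨.const s 0, fun _ => 1, .const 1, fun ω σ h => ?_⟩
    have hv : (enc ω).getD i 0 = 0 := by
      rw [← h, List.getD_eq_default _ _ (by simpa using hi)]
    exact ⟨_, _, .const s 0 σ, by simp, by
      rw [Function.update_self]; exact hv.symm,
      fun j hj => Function.update_of_ne (by omega) _ _⟩

theorem index : PT (fun p : ℕ × Ω => p.1) := (var 0).congr fun _ => rfl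

theorem weaken {f : Ω → ℕ} (hf : PT f) : PT (fun p : ℕ × Ω => f p.2) := by
  refine ⟨hf.1.weaken, fun ρ s hρ => ?_⟩
  cases ρ with
  | nil => exact ⟨.skip, fun _ => 0, .const 0, fun p σ h => by simp [enc] at h⟩
  | cons r ρ =>
    obtain ⟨c, T, hT, hc⟩ := hf.2 ρ s fun r hr => hρ r (List.mem_cons_of_mem _ hr)
    exact ⟨c, _, hT.weaken, fun p σ h => hc p.2 σ (List.cons.inj h).2⟩

theorem map_congr {ρ : List ℕ} {s : ℕ} (hρ : ∀ r ∈ ρ, r < s) {σ τ : Store}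
    (h : ∀ i < s, τ i = σ i) : ρ.map τ = ρ.map σ :=
  List.map_congr_left fun r hr => h r (hρ r hr)

/-- Registers are used as a stack: the second operand is computed into `s + 1`, which leaves the
first one in `s` intact. -/
theorem arith (o : ArithOp) {f g : Ω → ℕ} (hf : PT f) (hg : PT g) :
    PT fun ω => o.eval (f ω) (g ω) := by
  refine ⟨((hf.1.add hg.1).add (.const 1)).mono fun ω => o.size_eval_le _ _, fun ρ s hρ => ?_⟩
  obtain ⟨c, T, hT, hc⟩ := hf.2 ρ s hρ
  obtain ⟨d, U, hU, hd⟩ := hg.2 ρ (s + 1) fun r hr => (hρ r hr).trans (by omega)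
  refine ⟨.seq (.seq c d) (.arith o s s (s + 1)), fun ω => T ω + U ω +
    (Nat.size (f ω) + 1) * (Nat.size (g ω) + 1),
    (hT.add hU).add ((hf.1.add (.const 1)).mul (hg.1.add (.const 1))), fun ω σ h => ?_⟩
  obtain ⟨t₁, τ₁, r₁, b₁, v₁, k₁⟩ := hc ω σ h
  obtain ⟨t₂, τ₂, r₂, b₂, v₂, k₂⟩ := hd ω τ₁ (by rw [map_congr hρ k₁, h])
  have v₁' : τ₂ s = f ω := by rw [k₂ s (by omega), v₁]
  refine ⟨_, _, .seq (.seq r₁ r₂) (.arith o s s (s + 1) τ₂), ?_, ?_, fun i hi => ?_⟩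
  · rw [v₁', v₂]; dsimp only; omega
  · simp [v₁', v₂]
  · rw [Function.update_of_ne (by omega), k₂ i (by omega), k₁ i hi]

theorem add {f g : Ω → ℕ} (hf : PT f) (hg : PT g) : PT fun ω => f ω + g ω := arith .add hf hg
theorem sub {f g : Ω → ℕ} (hf : PT f) (hg : PT g) : PT fun ω => f ω - g ω := arith .sub hf hg
theorem mul {f g : Ω → ℕ} (hf : PT f) (hg : PT g) : PT fun ω => f ω * g ω := arith .mul hf hg
theorem div {f g : Ω → ℕ} (hf : PT f) (hg : PT g) : PT fun ω => f ω / g ω := arith .div hf hg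

theorem mod {f g : Ω → ℕ} (hf : PT f) (hg : PT g) : PT fun ω => f ω % g ω :=
  (hf.sub (hg.mul (hf.div hg))).congr fun ω => by
    have := Nat.div_add_mod (f ω) (g ω); omega

theorem min {f g : Ω → ℕ} (hf : PT f) (hg : PT g) : PT fun ω => min (f ω) (g ω) :=
  (hf.sub (hf.sub hg)).congr fun ω => by omega

/-- `k` updated with the values `f 0, …, f (N - 1)`. -/
def fold (o : ArithOp) (k : ℕ) (f : ℕ → ℕ) : ℕ → ℕ
  | 0 => k
  | N + 1 => o.eval (fold o k f N) (f N)

/-- Polynomially many rounds alone do not give polynomial time, since iterated operations may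
produce very long numbers. Hence the bound `G` on the lengths of all partial results. -/
theorem foldl (o : ArithOp) (k : ℕ) {f : ℕ × Ω → ℕ} {N : Ω → ℕ} (hf : PT f) (hN : PT N)
    (hb : PolyBdd N) {G : Ω → ℕ} (hG : PolyBdd G)
    (hs : ∀ ω, ∀ i ≤ N ω, Nat.size (fold o k (fun j => f (j, ω)) i) ≤ G ω) :
    PT fun ω => fold o k (fun j => f (j, ω)) (N ω) := by
  refine ⟨hG.mono fun ω => hs ω _ le_rfl, fun ρ s hρ => ?_⟩
  obtain ⟨c, T, hT, hc⟩ := hN.2 ρ (s + 1) fun r hr => (hρ r hr).trans (by omega)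
  obtain ⟨d, U, hU, hd⟩ := hf.2 ((s + 2) :: ρ) (s + 3) (by
    intro r hr
    rcases List.mem_cons.1 hr with rfl | hr
    · omega
    · exact (hρ r hr).trans (by omega))
  obtain ⟨U', hU', hUU⟩ := hU.exists_uniform hb
  obtain ⟨F, hF, hFF⟩ := hf.1.exists_uniform hb
  let body : Cmd := .seq d (.seq (.arith o s s (s + 3)) (.seq (.const (s + 3) 1)
    (.seq (.arith .add (s + 2) (s + 2) (s + 3)) (.arith .sub (s + 1) (s + 1) (s + 3)))))
  let cost : Ω → ℕ := fun ω => (N ω + 1) + (U' ω + ((G ω + 1) * (F ω + 1) + (2 +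
    ((N ω + 1) * 2 + (N ω + 1) * 2))))
  have hcost : PolyBdd cost :=
    (hb.add (.const 1)).add (hU'.add (((hG.add (.const 1)).mul (hF.add (.const 1))).add
      ((PolyBdd.const 2).add (((hb.add (.const 1)).mul (.const 2)).add
        ((hb.add (.const 1)).mul (.const 2))))))
  -- Loop invariant with `m` rounds left: register `s + 1` holds `m`, register `s + 2` the current
  -- index `N ω - m`, and register `s` the fold over the indices already treated.
  have loop_runs : ∀ (ω : Ω) (m : ℕ), m ≤ N ω → ∀ σ : Store, ρ.map σ = enc ω → σ (s + 1) = m →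
      σ (s + 2) = N ω - m → σ s = fold o k (fun j => f (j, ω)) (N ω - m) →
      ∃ t τ, Runs (.loop (s + 1) body) σ t τ ∧ t ≤ m * cost ω + 1 ∧
        τ s = fold o k (fun j => f (j, ω)) (N ω) ∧ ∀ i < s, τ i = σ i := by
    intro ω m
    induction m with
    | zero =>
      intro _ σ _ h₁ _ h₃
      refine ⟨_, σ, .loop_done h₁, ?_, by simpa using h₃, fun _ _ => rfl⟩
      simp [h₁]
    | succ m ih =>
      intro hm σ hσ h₁ h₂ h₃
      obtain ⟨t, τ, r, ht, hv, hk⟩ := hd (N ω - (m + 1), ω) σ (by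
        simp only [List.map_cons, hσ, h₂]; rfl)
      have e₁ : τ (s + 1) = m + 1 := by rw [hk _ (by omega), h₁]
      have e₂ : τ (s + 2) = N ω - (m + 1) := by rw [hk _ (by omega), h₂]
      have e₃ : τ s = fold o k (fun j => f (j, ω)) (N ω - (m + 1)) := by rw [hk _ (by omega), h₃]
      have hstep : fold o k (fun j => f (j, ω)) (N ω - m) =
          o.eval (fold o k (fun j => f (j, ω)) (N ω - (m + 1))) (f (N ω - (m + 1), ω)) := by
        rw [show N ω - m = (N ω - (m + 1)) + 1 by omega]; rfl
      let τ₁ := Function.update τ s (o.eval (τ s) (τ (s + 3)))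
      let τ₂ := Function.update τ₁ (s + 3) 1
      let τ₃ := Function.update τ₂ (s + 2) (τ₂ (s + 2) + τ₂ (s + 3))
      let τ₄ := Function.update τ₃ (s + 1) (τ₃ (s + 1) - τ₃ (s + 3))
      have rb : Runs body σ _ τ₄ :=
        .seq r (.seq (.arith o s s (s + 3) τ) (.seq (.const (s + 3) 1 τ₁)
          (.seq (.arith .add (s + 2) (s + 2) (s + 3) τ₂)
            (.arith .sub (s + 1) (s + 1) (s + 3) τ₃))))
      have f₁ : τ₄ (s + 1) = m := by simp [τ₄, τ₃, τ₂, τ₁, e₁]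
      have f₂ : τ₄ (s + 2) = N ω - m := by simp [τ₄, τ₃, τ₂, τ₁, e₂]; omega
      have f₃ : τ₄ s = fold o k (fun j => f (j, ω)) (N ω - m) := by
        simp [τ₄, τ₃, τ₂, τ₁, e₃, hv, hstep]
      have f₄ : ∀ i < s, τ₄ i = σ i := fun i hi => by
        simp only [τ₄, τ₃, τ₂, τ₁]
        rw [Function.update_of_ne (by omega), Function.update_of_ne (by omega),
          Function.update_of_ne (by omega), Function.update_of_ne (by omega), hk i (by omega)]
      obtain ⟨t', τ', r', ht', hv', hk'⟩ := ih (by omega) τ₄ (by rw [map_congr hρ f₄, hσ]) f₁ f₂ f₃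
      refine ⟨_, τ', .loop_step (by omega) rb r', ?_, hv', fun i hi => (hk' i hi).trans (f₄ i hi)⟩
      have g₁ : Nat.size (σ (s + 1)) ≤ N ω := (size_le_self _).trans (by omega)
      have g₂ : t ≤ U' ω := ht.trans (hUU ω _ (by omega))
      have g₃ : Nat.size (τ s) ≤ G ω := by rw [e₃]; exact hs ω _ (by omega)
      have g₄ : Nat.size (τ (s + 3)) ≤ F ω := by rw [hv]; exact hFF ω _ (by omega)
      have g₅ : Nat.size (τ₂ (s + 2)) ≤ N ω := by
        have : τ₂ (s + 2) = τ (s + 2) := by simp [τ₂, τ₁]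
        rw [this, e₂]; exact (size_le_self _).trans (by omega)
      have g₆ : Nat.size (τ₂ (s + 3)) = 1 := by simp [τ₂]
      have g₇ : Nat.size (τ₃ (s + 1)) ≤ N ω := by
        have : τ₃ (s + 1) = τ (s + 1) := by simp [τ₃, τ₂, τ₁]
        rw [this, e₁]; exact (size_le_self _).trans (by omega)
      have g₈ : Nat.size (τ₃ (s + 3)) = 1 := by simp [τ₃, τ₂]
      have g₉ : (Nat.size (τ s) + 1) * (Nat.size (τ (s + 3)) + 1) ≤ (G ω + 1) * (F ω + 1) :=
        Nat.mul_le_mul (by omega) (by omega)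
      have g₀ : Nat.size 1 = 1 := Nat.size_one
      have g : m * cost ω + cost ω = (m + 1) * cost ω := (Nat.succ_mul _ _).symm
      rw [g₆, g₈, g₀, ← g]
      have gc : cost ω = (N ω + 1) + (U' ω + ((G ω + 1) * (F ω + 1) + (2 +
        ((N ω + 1) * 2 + (N ω + 1) * 2)))) := rfl
      omega
  refine ⟨.seq c (.seq (.const s k) (.seq (.const (s + 2) 0) (.loop (s + 1) body))),
    fun ω => T ω + ((Nat.size k + 1) + (1 + (N ω * cost ω + 1))),
    hT.add ((PolyBdd.const _).add ((PolyBdd.const 1).add ((hb.mul hcost).add (.const 1)))),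
    fun ω σ h => ?_⟩
  obtain ⟨t₁, τ₁, r₁, b₁, v₁, k₁⟩ := hc ω σ h
  let τ₂ := Function.update τ₁ s k
  let τ₃ := Function.update τ₂ (s + 2) 0
  have k₃ : ∀ i < s, τ₃ i = σ i := fun i hi => by
    simp only [τ₃, τ₂]
    rw [Function.update_of_ne (by omega), Function.update_of_ne (by omega), k₁ i (by omega)]
  obtain ⟨t', τ', r', ht', hv', hk'⟩ := loop_runs ω (N ω) le_rfl τ₃
    (by rw [map_congr hρ k₃, h]) (by simp [τ₃, τ₂, v₁]) (by simp [τ₃])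
    (by simp [τ₃, τ₂, fold])
  refine ⟨_, τ', .seq r₁ (.seq (.const s k τ₁) (.seq (.const (s + 2) 0 τ₂) r')), ?_, hv',
    fun i hi => (hk' i hi).trans (k₃ i hi)⟩
  simp only [Nat.size_zero]; omega

theorem sum {f : ℕ × Ω → ℕ} {N : Ω → ℕ} (hf : PT f) (hN : PT N) (hb : PolyBdd N) :
    PT fun ω => ∑ i ∈ Finset.range (N ω), f (i, ω) := by
  obtain ⟨F, hF, hFF⟩ := hf.1.exists_uniform hb
  have key : ∀ ω n, fold .add 0 (fun j => f (j, ω)) n = ∑ i ∈ Finset.range n, f (i, ω) := by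
    intro ω n
    induction n with
    | zero => rfl
    | succ n ih => rw [Finset.sum_range_succ, ← ih]; rfl
  refine (foldl .add 0 hf hN hb (hb.add hF) fun ω i hi => ?_).congr fun ω => (key ω _).symm
  rw [key]
  have h₁ : ∑ j ∈ Finset.range i, f (j, ω) ≤ i * 2 ^ F ω := by
    simpa using Finset.sum_le_card_nsmul (Finset.range i) (fun j => f (j, ω)) (2 ^ F ω)
      fun j hj => (Nat.size_le.1 (hFF ω j ((Finset.mem_range.1 hj).le.trans hi))).le
  rw [Nat.size_le, pow_add]
  exact h₁.trans_lt (Nat.mul_lt_mul_of_pos_right (hi.trans_lt Nat.lt_two_pow_self)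
    (Nat.two_pow_pos _))

theorem prod {f : ℕ × Ω → ℕ} {N : Ω → ℕ} (hf : PT f) (hN : PT N) (hb : PolyBdd N) :
    PT fun ω => ∏ i ∈ Finset.range (N ω), f (i, ω) := by
  obtain ⟨F, hF, hFF⟩ := hf.1.exists_uniform hb
  have key : ∀ ω n, fold .mul 1 (fun j => f (j, ω)) n = ∏ i ∈ Finset.range n, f (i, ω) := by
    intro ω n
    induction n with
    | zero => rfl
    | succ n ih => rw [Finset.prod_range_succ, ← ih]; rfl
  refine (foldl .mul 1 hf hN hb ((hb.mul hF).add (.const 1)) fun ω i hi => ?_).congr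
    fun ω => (key ω _).symm
  rw [key]
  have h₁ : ∏ j ∈ Finset.range i, f (j, ω) ≤ (2 ^ F ω) ^ i := by
    simpa using Finset.prod_le_pow_card (Finset.range i) (fun j => f (j, ω)) (2 ^ F ω)
      fun j hj => (Nat.size_le.1 (hFF ω j ((Finset.mem_range.1 hj).le.trans hi))).le
  rw [Nat.size_le]
  refine h₁.trans_lt ?_
  rw [← pow_mul]
  refine Nat.pow_lt_pow_right one_lt_two ?_
  have := Nat.mul_le_mul_left (F ω) hi
  rw [mul_comm (N ω)]; omega

theorem pow {f g : Ω → ℕ} (hf : PT f) (hg : PT g) (hb : PolyBdd g) : PT fun ω => f ω ^ g ω :=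
  (prod hf.weaken hg hb).congr fun ω => by simp

/-- The binary length. -/
theorem size {f : Ω → ℕ} (hf : PT f) : PT fun ω => Nat.size (f ω) := by
  refine ⟨hf.1.mono fun ω => size_le_self _, fun ρ s hρ => ?_⟩
  obtain ⟨c, T, hT, hc⟩ := hf.2 ρ (s + 1) fun r hr => (hρ r hr).trans (by omega)
  let body : Cmd := .seq (.arith .add s s (s + 2)) (.arith .div (s + 1) (s + 1) (s + 3))
  -- Halving removes one binary digit per round. `B` bounds the lengths of both the remaining number
  -- and the counter, so a round costs at most `6 * (B + 1)`.
  have loop_runs : ∀ (B m : ℕ), ∀ σ : Store, Nat.size (σ (s + 1)) = m → m + Nat.size (σ s) ≤ B →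
      σ (s + 2) = 1 → σ (s + 3) = 2 →
      ∃ t τ, Runs (.loop (s + 1) body) σ t τ ∧ t ≤ m * (6 * (B + 1)) + 1 ∧
        τ s = σ s + m ∧ ∀ i < s, τ i = σ i := by
    intro B m
    induction m with
    | zero =>
      intro σ h₁ _ _ _
      exact ⟨_, σ, .loop_done (Nat.size_eq_zero.1 h₁), by simp [h₁], rfl, fun _ _ => rfl⟩
    | succ m ih =>
      intro σ h₁ hB h₂ h₃
      let τ₁ := Function.update σ s (σ s + σ (s + 2))
      let τ₂ := Function.update τ₁ (s + 1) (τ₁ (s + 1) / τ₁ (s + 3))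
      have rb : Runs body σ _ τ₂ := .seq (.arith .add s s (s + 2) σ)
        (.arith .div (s + 1) (s + 1) (s + 3) τ₁)
      have e₁ : τ₁ (s + 1) = σ (s + 1) := by simp [τ₁]
      have e₃ : τ₁ (s + 3) = 2 := by simp [τ₁, h₃]
      have f₀ : τ₂ s = σ s + 1 := by simp [τ₂, τ₁, h₂]
      have f₁ : Nat.size (τ₂ (s + 1)) = m := by
        have : τ₂ (s + 1) = σ (s + 1) / 2 := by simp [τ₂, e₁, e₃]
        rw [this]
        apply le_antisymm
        · rw [Nat.size_le]
          have := Nat.lt_size_self (σ (s + 1))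
          rw [h₁, pow_succ] at this
          omega
        · by_contra hlt
          push Not at hlt
          have h5 : σ (s + 1) < 2 ^ m := by
            obtain ⟨m, rfl⟩ : ∃ k, m = k + 1 := ⟨m - 1, by omega⟩
            have := Nat.size_le.1 (Nat.lt_succ_iff.1 hlt)
            rw [pow_succ]; omega
          have := Nat.size_le.2 h5
          omega
      have hsz : Nat.size (σ s + 1) ≤ Nat.size (σ s) + 1 := by
        by_cases h0 : σ s = 0
        · rw [h0]; simp
        · refine (size_add_le _ _).trans ?_
          rw [Nat.size_one]
          have := Nat.size_pos.2 (Nat.pos_of_ne_zero h0); omega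
      obtain ⟨t', τ', r', ht', hv', hk'⟩ := ih τ₂ f₁ (by rw [f₀]; omega) (by simp [τ₂, τ₁, h₂])
        (by simp [τ₂, τ₁, h₃])
      refine ⟨_, τ', .loop_step (fun h0 => by simp [h0] at h₁) rb r', ?_,
        by rw [hv', f₀]; ring, fun i hi => ?_⟩
      · rw [e₁, e₃, h₁, h₂]
        have : Nat.size 2 = 2 := by decide
        have g : m * (6 * (B + 1)) + 6 * (B + 1) = (m + 1) * (6 * (B + 1)) :=
          (Nat.succ_mul _ _).symm
        rw [this, Nat.size_one, ← g]
        omega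
      · rw [hk' i hi]; simp only [τ₂, τ₁]
        rw [Function.update_of_ne (by omega), Function.update_of_ne (by omega)]
  refine ⟨.seq c (.seq (.const s 0) (.seq (.const (s + 2) 1) (.seq (.const (s + 3) 2)
    (.loop (s + 1) body)))),
    fun ω => T ω + (6 + (Nat.size (f ω) * (6 * (Nat.size (f ω) + 1)) + 1)),
    hT.add ((PolyBdd.const 6).add ((hf.1.mul ((PolyBdd.const 6).mul (hf.1.add (.const 1)))).add
      (.const 1))), fun ω σ h => ?_⟩
  obtain ⟨t₁, τ₁, r₁, b₁, v₁, k₁⟩ := hc ω σ h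
  let τ₂ := Function.update τ₁ s 0
  let τ₃ := Function.update τ₂ (s + 2) 1
  let τ₄ := Function.update τ₃ (s + 3) 2
  obtain ⟨t', τ', r', ht', hv', hk'⟩ := loop_runs (Nat.size (f ω)) (Nat.size (f ω)) τ₄
    (by simp [τ₄, τ₃, τ₂, v₁]) (by simp [τ₄, τ₃, τ₂]) (by simp [τ₄, τ₃]) (by simp [τ₄])
  refine ⟨_, τ', .seq r₁ (.seq (.const s 0 τ₁) (.seq (.const (s + 2) 1 τ₂)
    (.seq (.const (s + 3) 2 τ₃) r'))), ?_, ?_, fun i hi => ?_⟩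
  · have : Nat.size 2 = 2 := by decide
    rw [this, Nat.size_one, Nat.size_zero]; dsimp only; omega
  · rw [hv']; simp [τ₄, τ₃, τ₂]
  · rw [hk' i hi]; simp only [τ₄, τ₃, τ₂]
    rw [Function.update_of_ne (by omega), Function.update_of_ne (by omega),
      Function.update_of_ne (by omega), k₁ i (by omega)]

end PT
end

/-! ### Subroutine calls, integer valued functions, decidable predicates -/

section
variable {Ω : Type} [Enc Ω]

/-- Calling a program whose running time is polynomial in the values of its two arguments. -/
theorem PT.call {c : Cmd} {q : Polynomial ℕ} {O : ℕ → ℕ → ℕ} (j : ℕ)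
    (hc : ∀ n k, 0 < n → ∃ t τ, Runs c (initStore [n, k]) t τ ∧ t ≤ q.eval (n + k) ∧ τ j = O n k)
    {f g : Ω → ℕ} (hf : PT f) (hg : PT g) (bf : PolyBdd f) (bg : PolyBdd g) (pos : ∀ ω, 0 < f ω) :
    PT fun ω => O (f ω) (g ω) := by
  have hq : PolyBdd fun ω => q.eval (f ω + g ω) := (bf.add bg).polyEval q
  -- Only the running time of the callee is bounded, but a run gains at most one bit per unit of
  -- time, so its output is short as well.
  have hsize : ∀ n k, 0 < n → Nat.size (O n k) ≤ (n + k) + q.eval (n + k) := fun n k hn => by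
    obtain ⟨t, τ, r, ht, hv⟩ := hc n k hn
    rw [← hv]
    refine (r.size_le (n + k) (fun i => (size_le_self _).trans ?_) j).trans (by omega)
    match i with
    | 0 => simp [initStore]
    | 1 => simp [initStore]
    | i + 2 => simp [initStore]
  refine ⟨((bf.add bg).add hq).mono fun ω => hsize _ _ (pos ω), fun ρ s hρ => ?_⟩
  obtain ⟨c₁, T₁, hT₁, h₁⟩ := hf.2 ρ s hρ
  obtain ⟨c₂, T₂, hT₂, h₂⟩ := hg.2 ρ (s + 1) fun r hr => (hρ r hr).trans (by omega)
  refine ⟨.seq c₁ (.seq c₂ (.seq (Cmd.clear (s + 2) (c.width + j)) (.seq (c.shift s)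
      (.seq (.const (s + j + 1) 0) (.arith .add s (s + j) (s + j + 1)))))),
    fun ω => T₁ ω + (T₂ ω + ((c.width + j + 1) + (q.eval (f ω + g ω) +
      ((f ω + g ω) + q.eval (f ω + g ω) + 2)))),
    hT₁.add (hT₂.add ((PolyBdd.const _).add (hq.add (((bf.add bg).add hq).add (.const 2))))),
    fun ω σ h => ?_⟩
  obtain ⟨t₁, τ₁, r₁, b₁, v₁, k₁⟩ := h₁ ω σ h
  obtain ⟨t₂, τ₂, r₂, b₂, v₂, k₂⟩ := h₂ ω τ₁ (by rw [PT.map_congr hρ k₁, h])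
  -- The callee expects zeros beyond its two arguments, whereas computing the arguments may have
  -- left other values there.
  have r₃ := Cmd.runs_clear (s + 2) (c.width + j) τ₂
  set τ₃ : Store := fun i => if s + 2 ≤ i ∧ i < s + 2 + (c.width + j) then 0 else τ₂ i with hτ₃
  obtain ⟨t₄, τ₄', r₄', b₄, v₄⟩ := hc (f ω) (g ω) (pos ω)
  obtain ⟨τ₄, r₄, e₄, k₄⟩ := r₄'.shift s (c.width + j + 1) (by omega) τ₃ (fun i hi => by
    match i with
    | 0 => simp [hτ₃, initStore, k₂ s (by omega), v₁]
    | 1 => simp [hτ₃, initStore, v₂]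
    | i + 2 =>
      simp only [hτ₃, initStore]
      rw [if_pos (by omega)]; simp)
  have r₅ := PT.copy_runs s (s + j) (s + j + 1) (by omega) τ₄
  have e₅ : τ₄ (s + j) = O (f ω) (g ω) := by rw [e₄ j (by omega), v₄]
  refine ⟨_, _, .seq r₁ (.seq r₂ (.seq r₃ (.seq r₄ r₅))), ?_, by simp [e₅], fun i hi => ?_⟩
  · have := hsize _ (g ω) (pos ω)
    rw [← e₅] at this
    dsimp only; omega
  · rw [Function.update_of_ne (by omega), Function.update_of_ne (by omega), k₄ i hi]
    simp only [hτ₃]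
    rw [if_neg (by omega), k₂ i (by omega), k₁ i hi]

/-- An integer valued function that is a difference of polynomial time functions. -/
def PTZ (f : Ω → ℤ) : Prop := ∃ p q : Ω → ℕ, PT p ∧ PT q ∧ ∀ ω, f ω = (p ω : ℤ) - q ω

namespace PTZ

theorem ofNat {f : Ω → ℕ} (hf : PT f) : PTZ fun ω => (f ω : ℤ) :=
  ⟨f, _, hf, .const 0, fun _ => by simp⟩

theorem add {f g : Ω → ℤ} : PTZ f → PTZ g → PTZ fun ω => f ω + g ω := by
  rintro ⟨p, q, hp, hq, h⟩ ⟨p', q', hp', hq', h'⟩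
  exact ⟨_, _, hp.add hp', hq.add hq', fun ω => by
    dsimp only; rw [h, h']; push_cast; ring⟩

theorem sub {f g : Ω → ℤ} : PTZ f → PTZ g → PTZ fun ω => f ω - g ω := by
  rintro ⟨p, q, hp, hq, h⟩ ⟨p', q', hp', hq', h'⟩
  exact ⟨_, _, hp.add hq', hq.add hp', fun ω => by
    dsimp only; rw [h, h']; push_cast; ring⟩

theorem mul {f g : Ω → ℤ} : PTZ f → PTZ g → PTZ fun ω => f ω * g ω := by
  rintro ⟨p, q, hp, hq, h⟩ ⟨p', q', hp', hq', h'⟩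
  exact ⟨_, _, (hp.mul hp').add (hq.mul hq'), (hp.mul hq').add (hq.mul hp'),
    fun ω => by
    dsimp only; rw [h, h']; push_cast; ring⟩

theorem sum {f : ℕ × Ω → ℤ} {N : Ω → ℕ} (hN : PT N) (hb : PolyBdd N) :
    PTZ f → PTZ fun ω => ∑ i ∈ Finset.range (N ω), f (i, ω) := by
  rintro ⟨p, q, hp, hq, h⟩
  exact ⟨_, _, hp.sum hN hb, hq.sum hN hb, fun ω => by simp [h]⟩

theorem toNat {f : Ω → ℤ} : PTZ f → PT fun ω => (f ω).toNat := by
  rintro ⟨p, q, hp, hq, h⟩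
  exact (hp.sub hq).congr fun ω => by rw [h]; omega

end PTZ

open Classical in
/-- A predicate that is decidable in polynomial time. -/
def PTP (P : Ω → Prop) : Prop := PT fun ω => if P ω then 1 else 0

namespace PTP

theorem congr {P Q : Ω → Prop} (hP : PTP P) (h : ∀ ω, Q ω ↔ P ω) : PTP Q := by
  have : Q = P := funext fun ω => propext (h ω)
  rwa [this]

theorem and {P Q : Ω → Prop} (hP : PTP P) (hQ : PTP Q) : PTP fun ω => P ω ∧ Q ω :=
  (PT.mul hP hQ).congr fun ω => by by_cases h : P ω <;> by_cases h' : Q ω <;> simp [h, h']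

theorem not {P : Ω → Prop} (hP : PTP P) : PTP fun ω => ¬ P ω :=
  (PT.sub (.const 1) hP).congr fun ω => by by_cases h : P ω <;> simp [h]

theorem le {f g : Ω → ℕ} (hf : PT f) (hg : PT g) : PTP fun ω => f ω ≤ g ω :=
  (PT.sub (.const 1) (hf.sub hg)).congr fun ω => by split_ifs <;> omega

theorem lt {f g : Ω → ℕ} (hf : PT f) (hg : PT g) : PTP fun ω => f ω < g ω :=
  (le hg hf).not.congr fun _ => not_le.symm

theorem eq {f g : Ω → ℕ} (hf : PT f) (hg : PT g) : PTP fun ω => f ω = g ω :=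
  ((le hf hg).and (le hg hf)).congr fun _ => le_antisymm_iff

theorem eqZ {f g : Ω → ℤ} : PTZ f → PTZ g → PTP fun ω => f ω = g ω := by
  rintro ⟨p, q, hp, hq, h⟩ ⟨p', q', hp', hq', h'⟩
  exact (eq (hp.add hq') (hp'.add hq)).congr fun ω => by rw [h, h']; omega

/-- A bounded conjunction is a product of indicators. -/
theorem forall_lt {P : ℕ × Ω → Prop} {N : Ω → ℕ} (hN : PT N) (hb : PolyBdd N) (hP : PTP P) :
    PTP fun ω => ∀ i < N ω, P (i, ω) :=
  (PT.prod hP hN hb).congr fun ω => by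
    by_cases h : ∀ i < N ω, P (i, ω)
    · rw [if_pos h, Finset.prod_eq_one fun i hi => if_pos (h i (Finset.mem_range.1 hi))]
    · rw [if_neg h]
      push Not at h
      obtain ⟨i, hi, h⟩ := h
      exact (Finset.prod_eq_zero (Finset.mem_range.2 hi) (if_neg h)).symm

end PTP
theorem PT.ite {P : Ω → Prop} [DecidablePred P] {f g : Ω → ℕ} (hP : PTP P) (hf : PT f)
    (hg : PT g) : PT fun ω => if P ω then f ω else g ω :=
  ((PT.mul hP hf).add (PT.mul (PTP.not hP) hg)).congr fun ω => by
    by_cases h : P ω <;> simp [h]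
end

/-! ### Verifiers as polynomial time predicates -/

/-- The input of a verifier: instance, coins and message. -/
structure VInput where
  X : ℕ
  r : ℕ
  m : ℕ

instance instEncVInput : Enc VInput where
  enc ω := [ω.X, ω.r, ω.m]
  sz ω := Nat.size ω.X + Nat.size ω.r + Nat.size ω.m
  size_le_sz ω x hx := by
    simp only [List.mem_cons, List.not_mem_nil, or_false] at hx
    rcases hx with rfl | rfl | rfl <;> omega

theorem PT.X : PT VInput.X := (PT.var 0).congr fun _ => rfl
theorem PT.r : PT VInput.r := (PT.var 1).congr fun _ => rfl
theorem PT.m : PT VInput.m := (PT.var 2).congr fun _ => rfl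

theorem size_codeBits (x : List Bool) : Nat.size (codeBits x) = x.length + 1 := by
  induction x with
  | nil => simp [codeBits]
  | cons b l ih =>
    have hpos : codeBits l ≠ 0 := fun h => by rw [h] at ih; simp at ih
    have : codeBits (b :: l) = Nat.bit b (codeBits l) := by
      rw [Nat.bit_val]; rfl
    rw [this, Nat.size_bit (by cases b <;> simp [Nat.bit_val, hpos]), ih]
    rfl

-- By determinism the run that computes the indicator of `Good` is the only one, so acceptance is
-- equivalent to `Good`.
open Classical in
theorem inAM_of_verifier (P : PromiseProblem) (Good : ℕ → ℕ → ℕ → Prop)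
    (hG : PTP fun ω : VInput => Good ω.X ω.r ω.m) (ℓ : Polynomial ℕ)
    (hyes : ∀ x ∈ P.yes, (2 / 3 : ℝ) ≤ (((Finset.range (2 ^ ℓ.eval x.length)).filter fun r =>
      ∃ m < 2 ^ ℓ.eval x.length, Good (codeBits x) r m).card : ℝ) / 2 ^ ℓ.eval x.length)
    (hno : ∀ x ∈ P.no, (((Finset.range (2 ^ ℓ.eval x.length)).filter fun r =>
      ∃ m < 2 ^ ℓ.eval x.length, Good (codeBits x) r m).card : ℝ) / 2 ^ ℓ.eval x.length ≤ 1 / 3) :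
    InAM P := by
  obtain ⟨c, T, hT, hc⟩ := hG.2 [0, 1, 2] 3 (by simp)
  let V : Cmd := .seq c (.seq (.const 4 0) (.arith .add 0 3 4))
  have run : ∀ X r m, ∃ t τ, Runs V (initStore [X, r, m]) t τ ∧ t ≤ T ⟨X, r, m⟩ + 3 ∧
      τ 0 = if Good X r m then 1 else 0 := fun X r m => by
    obtain ⟨t, τ, h, ht, hv, -⟩ := hc ⟨X, r, m⟩ (initStore [X, r, m]) rfl
    refine ⟨_, _, .seq h (PT.copy_runs 0 3 4 (by omega) τ), ?_, ?_⟩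
    · have : Nat.size (τ 3) ≤ 1 := by
        rw [hv]; dsimp only; split_ifs <;> simp
      omega
    · rw [Function.update_self, hv]
  have acc : ∀ x r m, Accepts V x r m ↔ Good (codeBits x) r m := fun x r m => by
    obtain ⟨t, τ, h, -, hv⟩ := run (codeBits x) r m
    constructor
    · rintro ⟨t', τ', h', h0⟩
      obtain ⟨-, rfl⟩ := h.det h'
      by_contra hg
      rw [if_neg hg] at hv
      exact h0 hv
    · exact fun hg => ⟨t, τ, h, by rw [hv, if_pos hg]; exact one_ne_zero⟩
  have accP : ∀ x l, acceptProb V l x = (((Finset.range (2 ^ l)).filter fun r =>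
      ∃ m < 2 ^ l, Good (codeBits x) r m).card : ℝ) / 2 ^ l := fun x l => by
    simp only [acceptProb, acc]
  obtain ⟨R, hR⟩ := hT
  refine ⟨V, ℓ, R.comp (Polynomial.X + 1 + ℓ + ℓ) + 3, fun x r m hr hm => ?_,
    fun x hx => by rw [accP]; exact hyes x hx, fun x hx => by rw [accP]; exact hno x hx⟩
  obtain ⟨t, τ, h, ht, -⟩ := run (codeBits x) r m
  refine ⟨t, τ, h, ht.trans ?_⟩
  have h₁ := Nat.size_le.2 hr
  have h₂ := Nat.size_le.2 hm
  have h₃ : T ⟨codeBits x, r, m⟩ ≤ R.eval (x.length + 1 + ℓ.eval x.length + ℓ.eval x.length) := by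
    refine (hR _).trans (eval_mono R ?_)
    simp only [sz, size_codeBits]; omega
  simpa using h₃
end LatticeAM

namespace LatticeAM

/-! ## The encoding of instances as arithmetic -/

/-- The number that codes `encodeNat k ++ t` when `Y` codes `t`. -/
def natCode (k Y : ℕ) : ℕ :=
  ∑ i ∈ Finset.range (Nat.size k), (1 + 2 * (k / 2 ^ i % 2)) * 4 ^ i + 2 ^ (2 * Nat.size k + 1) * Y

theorem natCode_zero (Y : ℕ) : natCode 0 Y = 2 * Y := by simp [natCode]

theorem size_eq_succ {k : ℕ} (hk : k ≠ 0) : Nat.size k = Nat.size (k / 2) + 1 := by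
  have h := Nat.bit_bodd_div2 k
  have h' : Nat.bit k.bodd k.div2 ≠ 0 := by rwa [h]
  have := Nat.size_bit h'
  rwa [h, Nat.div2_val] at this

theorem natCode_of_ne_zero {k : ℕ} (hk : k ≠ 0) (Y : ℕ) :
    natCode k Y = 1 + 2 * (k % 2) + 4 * natCode (k / 2) Y := by
  rw [natCode, size_eq_succ hk, Finset.sum_range_succ', natCode, mul_add 4, Finset.mul_sum]
  have : ∀ i, (1 + 2 * (k / 2 ^ (i + 1) % 2)) * 4 ^ (i + 1) =
      4 * ((1 + 2 * (k / 2 / 2 ^ i % 2)) * 4 ^ i) := fun i => by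
    rw [Nat.div_div_eq_div_mul, pow_succ' 2, pow_succ]; ring
  simp only [this]
  rw [show 2 * (Nat.size (k / 2) + 1) + 1 = (2 * Nat.size (k / 2) + 1) + 2 by ring, pow_add]
  simp; ring

/-- The code is prefix-free: its lowest bit tells the terminator `0` from a pair `1b`, the next bit
is then the lowest digit of `k`, and induction on `k / 2` peels off the rest. -/
theorem natCode_inj (k : ℕ) : ∀ k' Y Y', natCode k Y = natCode k' Y' → k = k' ∧ Y = Y' := by
  induction k using Nat.strong_induction_on with
  | _ k ih =>
    intro k' Y Y' h
    by_cases hk : k = 0 <;> by_cases hk' : k' = 0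
    · subst hk hk'
      simp only [natCode_zero] at h; omega
    · subst hk; rw [natCode_zero, natCode_of_ne_zero hk'] at h; omega
    · subst hk'; rw [natCode_zero, natCode_of_ne_zero hk] at h; omega
    · rw [natCode_of_ne_zero hk, natCode_of_ne_zero hk'] at h
      have := ih (k / 2) (by omega) (k' / 2) Y Y' (by omega)
      omega

theorem le_natCode_right (k Y : ℕ) : 2 * Y ≤ natCode k Y := by
  refine le_trans ?_ (Nat.le_add_left _ _)
  rw [pow_succ, mul_assoc]
  exact Nat.le_mul_of_pos_left _ (Nat.two_pow_pos _)

theorem le_natCode_left (k : ℕ) {Y : ℕ} (hY : 0 < Y) : k ≤ natCode k Y := by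
  refine le_trans ?_ (Nat.le_add_left _ _)
  have h := Nat.lt_size_self k
  have h' : 2 ^ Nat.size k ≤ 2 ^ (2 * Nat.size k + 1) := Nat.pow_le_pow_right two_pos (by omega)
  exact (h.le.trans h').trans (Nat.le_mul_of_pos_right _ hY)

theorem codeBits_encodeNat (k : ℕ) (t : List Bool) :
    codeBits (encodeNat k ++ t) = natCode k (codeBits t) := by
  induction k using Nat.strong_induction_on with
  | _ k ih =>
    by_cases hk : k = 0
    · subst hk; simp [natCode_zero, encodeNat, codeBits]
    · have e : Nat.bits k = k.bodd :: Nat.bits (k / 2) := by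
        have := Nat.bits_append_bit k.div2 k.bodd (fun h => by
          have := Nat.bit_bodd_div2 k
          rw [h] at this
          cases hb : k.bodd
          · rw [hb] at this; simp at this; omega
          · rfl)
        rwa [Nat.bit_bodd_div2, Nat.div2_val] at this
      have ih' := ih (k / 2) (by omega)
      rw [natCode_of_ne_zero hk, ← ih']
      simp only [encodeNat, e, List.flatMap_cons, List.cons_append, List.nil_append, codeBits]
      have : k.bodd.toNat = k % 2 := (Nat.mod_two_of_bodd k).symm
      rw [this]; simp; ring

theorem codeBits_encodeInt (z : ℤ) (t : List Bool) :
    codeBits (encodeInt z ++ t) =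
      (decide (z < 0)).toNat + 2 * natCode z.natAbs (codeBits t) := by
  simp only [encodeInt, List.cons_append, codeBits, codeBits_encodeNat]; ring

theorem codeBits_encodeRat (q : ℚ) (t : List Bool) : codeBits (encodeRat q ++ t) =
    (decide (q.num < 0)).toNat + 2 * natCode q.num.natAbs (natCode q.den (codeBits t)) := by
  rw [encodeRat, List.append_assoc, codeBits_encodeInt, codeBits_encodeNat]

theorem codeBits_pos (x : List Bool) : 0 < codeBits x := by
  rw [← Nat.size_pos, size_codeBits]; omega

/-- The entries of a matrix, row by row. -/
def rowMajor {n : ℕ} (B : Matrix (Fin n) (Fin n) ℚ) (e : ℕ) : ℚ :=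
  if h : e < n * n then B (Fin.divNat ⟨e, h⟩) (Fin.modNat ⟨e, h⟩) else 0

theorem rowMajor_apply {n : ℕ} (B : Matrix (Fin n) (Fin n) ℚ) (i j : Fin n) :
    rowMajor B (i * n + j) = B i j := by
  have h : (i : ℕ) * n + j < n * n := by
    have := Nat.mul_le_mul_right n (Nat.succ_le_of_lt i.2)
    have h2 := j.2
    rw [Nat.succ_mul] at this
    omega
  rw [rowMajor, dif_pos h]
  have hn : 0 < n := i.pos
  congr 1
  · ext; simp [Fin.divNat, Nat.mul_comm i.1 n, Nat.mul_add_div hn]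
  · ext; simp [Fin.modNat, Nat.mod_eq_of_lt j.2]

/-- The code of the entries from position `e` on. -/
def suffixCode {n : ℕ} (B : Matrix (Fin n) (Fin n) ℚ) (e : ℕ) : ℕ :=
  codeBits ((List.ofFn fun i : Fin (n * n) => encodeRat (rowMajor B i)).drop e).flatten

theorem suffixCode_end {n : ℕ} (B : Matrix (Fin n) (Fin n) ℚ) : suffixCode B (n * n) = 1 := by
  rw [suffixCode, List.drop_of_length_le (by simp)]; rfl

theorem suffixCode_step {n : ℕ} (B : Matrix (Fin n) (Fin n) ℚ) {e : ℕ} (he : e < n * n) :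
    suffixCode B e = (decide ((rowMajor B e).num < 0)).toNat +
      2 * natCode (rowMajor B e).num.natAbs (natCode (rowMajor B e).den (suffixCode B (e + 1))) := by
  rw [suffixCode, List.drop_eq_getElem_cons (by simpa using he), List.flatten_cons,
    List.getElem_ofFn, codeBits_encodeRat]
  rfl

theorem codeBits_encodeMatrix {n : ℕ} (B : Matrix (Fin n) (Fin n) ℚ) :
    codeBits (encodeMatrix B) = natCode n (suffixCode B 0) := by
  rw [encodeMatrix, codeBits_encodeNat]
  congr 1
  rw [suffixCode, List.drop_zero, List.ofFn_mul, List.flatten_flatten, List.map_ofFn]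
  congr 3
  funext i
  simp only [Function.comp]
  congr 2
  funext j
  exact (congrArg encodeRat (rowMajor_apply B i j)).symm

theorem suffixCode_pos {n : ℕ} (B : Matrix (Fin n) (Fin n) ℚ) (e : ℕ) : 0 < suffixCode B e :=
  codeBits_pos _

theorem suffixCode_succ_le {n : ℕ} (B : Matrix (Fin n) (Fin n) ℚ) {e : ℕ} (he : e < n * n) :
    2 * suffixCode B (e + 1) ≤ suffixCode B e := by
  rw [suffixCode_step B he]
  have h₁ := le_natCode_right (rowMajor B e).den (suffixCode B (e + 1))
  have h₂ := le_natCode_right (rowMajor B e).num.natAbs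
    (natCode (rowMajor B e).den (suffixCode B (e + 1)))
  omega

/-- Every entry occupies at least one bit. At `e = n * n` this bounds the number of entries by the
length of the code. -/
theorem two_pow_mul_suffixCode_le {n : ℕ} (B : Matrix (Fin n) (Fin n) ℚ) (e : ℕ) :
    e ≤ n * n → 2 ^ e * suffixCode B e ≤ suffixCode B 0 := by
  induction e with
  | zero => simp
  | succ e ih =>
    intro he
    have := suffixCode_succ_le B (e := e) (by omega)
    refine le_trans ?_ (ih (by omega))
    rw [pow_succ, mul_assoc]
    exact Nat.mul_le_mul_left _ this

theorem codeBits_lt (x : List Bool) : codeBits x < 2 ^ (x.length + 1) := by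
  rw [← size_codeBits]; exact Nat.lt_size_self _

/-! ### Bounds from the length of the code, and unique parsing -/

section bounds
variable {n : ℕ} (B : Matrix (Fin n) (Fin n) ℚ)

theorem suffixCode_lt {e : ℕ} (he : e ≤ n * n) :
    suffixCode B e < 2 ^ ((encodeMatrix B).length + 1) := by
  refine lt_of_le_of_lt ?_ (codeBits_lt _)
  have h₁ := two_pow_mul_suffixCode_le B e he
  have h₂ := le_natCode_right n (suffixCode B 0)
  have h₃ := Nat.le_mul_of_pos_left (suffixCode B e) (Nat.two_pow_pos e)
  rw [codeBits_encodeMatrix]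
  omega

theorem sq_dim_le_length : n * n ≤ (encodeMatrix B).length := by
  have h₁ := two_pow_mul_suffixCode_le B (n * n) le_rfl
  rw [suffixCode_end, mul_one] at h₁
  have h₂ := le_natCode_right n (suffixCode B 0)
  have h₃ := codeBits_lt (encodeMatrix B)
  rw [codeBits_encodeMatrix] at h₃
  have : 2 ^ (n * n) < 2 ^ ((encodeMatrix B).length + 1) := by omega
  have := (Nat.pow_lt_pow_iff_right one_lt_two).1 this
  omega

theorem dim_le_length : n ≤ (encodeMatrix B).length := by
  refine le_trans ?_ (sq_dim_le_length B)
  exact Nat.le_mul_self n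

theorem num_lt {e : ℕ} (he : e < n * n) :
    (rowMajor B e).num.natAbs < 2 ^ ((encodeMatrix B).length + 1) := by
  refine lt_of_le_of_lt ?_ (suffixCode_lt B he.le)
  rw [suffixCode_step B he]
  have h := le_natCode_left (rowMajor B e).num.natAbs
    (Y := natCode (rowMajor B e).den (suffixCode B (e + 1)))
    (by have := le_natCode_right (rowMajor B e).den (suffixCode B (e + 1))
        have := suffixCode_pos B (e + 1); omega)
  omega

theorem den_lt {e : ℕ} (he : e < n * n) :
    (rowMajor B e).den < 2 ^ ((encodeMatrix B).length + 1) := by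
  refine lt_of_le_of_lt ?_ (suffixCode_lt B he.le)
  rw [suffixCode_step B he]
  have h₁ := le_natCode_left (rowMajor B e).den (suffixCode_pos B (e + 1))
  have h₂ := le_natCode_right (rowMajor B e).num.natAbs
    (natCode (rowMajor B e).den (suffixCode B (e + 1)))
  omega

/-- A chain of partial codes that fits the code of `B` consists of the true entries of `B`. -/
theorem parse_unique {n' : ℕ} {A D S Y : ℕ → ℕ} (hS : ∀ e, S e < 2)
    (h₀ : codeBits (encodeMatrix B) = natCode n' (Y 0))
    (hstep : ∀ e < n' * n', Y e = S e + 2 * natCode (A e) (natCode (D e) (Y (e + 1)))) :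
    n' = n ∧ ∀ e < n * n, S e = (decide ((rowMajor B e).num < 0)).toNat ∧
      A e = (rowMajor B e).num.natAbs ∧ D e = (rowMajor B e).den := by
  rw [codeBits_encodeMatrix] at h₀
  obtain ⟨rfl, hY⟩ := natCode_inj _ _ _ _ h₀
  refine ⟨rfl, ?_⟩
  have key : ∀ e < n * n, Y e = suffixCode B e →
      (S e = (decide ((rowMajor B e).num < 0)).toNat ∧
      A e = (rowMajor B e).num.natAbs ∧ D e = (rowMajor B e).den) ∧
      Y (e + 1) = suffixCode B (e + 1) := fun e he h => by
    rw [suffixCode_step B he, hstep e he] at h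
    have h1 := hS e
    have h2 := Bool.toNat_le (decide ((rowMajor B e).num < 0))
    have h3 : S e = (decide ((rowMajor B e).num < 0)).toNat := by omega
    obtain ⟨h4, h5⟩ := natCode_inj _ _ _ _ (show natCode (A e) (natCode (D e) (Y (e + 1))) =
      natCode (rowMajor B e).num.natAbs (natCode (rowMajor B e).den (suffixCode B (e + 1))) by omega)
    obtain ⟨h6, h7⟩ := natCode_inj _ _ _ _ h5
    exact ⟨⟨h3, h4, h6⟩, h7⟩
  have all : ∀ e ≤ n * n, Y e = suffixCode B e := fun e => by
    induction e with
    | zero => exact fun _ => hY.symm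
    | succ e ih => exact fun he => (key e he (ih (by omega))).2
  exact fun e he => (key e he (all e he.le)).1
end bounds

/-! ## The dual lattice in coordinates -/

noncomputable section
section
variable {n : ℕ} (B : Matrix (Fin n) (Fin n) ℚ)

/-- The dual basis, as the columns of a matrix. -/
def dualMatrix : Matrix (Fin n) (Fin n) ℝ := ((B.map fun q => (q : ℝ)).transpose)⁻¹

/-- The dual lattice vector with coordinates `z` in the dual basis. -/
def dualVec (z : Fin n → ℤ) : EuclideanSpace ℝ (Fin n) :=
  WithLp.toLp 2 ((dualMatrix B).mulVec fun k => (z k : ℝ))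

variable {B}

theorem isUnit_det_transpose_cast (hB : B.det ≠ 0) :
    IsUnit ((B.map fun q => (q : ℝ)).transpose).det := by
  rw [Matrix.det_transpose, isUnit_iff_ne_zero]
  have : (B.map fun q => (q : ℝ)).det = ((B.det : ℚ) : ℝ) := by
    have := RingHom.map_det (Rat.castHom ℝ) B
    simpa [RingHom.mapMatrix_apply] using this.symm
  rw [this]; exact_mod_cast hB

theorem sum_mul_dualVec (hB : B.det ≠ 0) (z : Fin n → ℤ) (j : Fin n) :
    ∑ i, (B i j : ℝ) * dualVec B z i = z j := by
  have h := congrFun (Matrix.mulVec_mulVec (fun k => (z k : ℝ))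
    ((B.map fun q => (q : ℝ)).transpose) (dualMatrix B)) j
  rw [dualMatrix, Matrix.mul_nonsing_inv _ (isUnit_det_transpose_cast hB), Matrix.one_mulVec] at h
  rw [← h]; rfl

theorem eq_dualVec (hB : B.det ≠ 0) (y : EuclideanSpace ℝ (Fin n)) (z : Fin n → ℤ)
    (h : ∀ j, ∑ i, (B i j : ℝ) * y i = z j) : dualVec B z = y := by
  have e : (fun k => (z k : ℝ)) = ((B.map fun q => (q : ℝ)).transpose).mulVec y.ofLp := by
    funext j; rw [← h]; rfl
  rw [dualVec, e, Matrix.mulVec_mulVec, dualMatrix,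
    Matrix.nonsing_inv_mul _ (isUnit_det_transpose_cast hB), Matrix.one_mulVec]

theorem dualVec_injective (hB : B.det ≠ 0) : Function.Injective (dualVec B) := fun z z' h => by
  funext j
  have h₁ := sum_mul_dualVec hB z j
  rw [h, sum_mul_dualVec hB z' j] at h₁
  exact_mod_cast h₁.symm

theorem dualVec_zero : dualVec B 0 = 0 := by
  ext i; simp [dualVec, Matrix.mulVec, dotProduct]

theorem dualVec_ne_zero (hB : B.det ≠ 0) {z : Fin n → ℤ} (hz : z ≠ 0) : dualVec B z ≠ 0 :=
  fun h => hz (dualVec_injective hB (h.trans dualVec_zero.symm))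

theorem inner_column (y : EuclideanSpace ℝ (Fin n)) (j : Fin n) :
    inner ℝ y (WithLp.toLp 2 fun i : Fin n => ((B i j : ℚ) : ℝ)) = ∑ i, (B i j : ℝ) * y i := by
  simp [PiLp.inner_apply]

/-- Integrality of the pairing has to be tested only on the columns of `B`, and the pairings with
the columns are exactly the coordinates in the dual basis. -/
theorem mem_dualLattice (hB : B.det ≠ 0) (y : EuclideanSpace ℝ (Fin n)) :
    y ∈ dualLattice (latticeOf B) ↔ ∃ z, dualVec B z = y := by
  rw [dualLattice, LinearMap.BilinForm.mem_dualSubmodule]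
  constructor
  · intro h
    have h' : ∀ j, ∃ a : ℤ, (a : ℝ) = ∑ i, (B i j : ℝ) * y i := fun j => by
      obtain ⟨a, ha⟩ := Submodule.mem_one.1 (h _ (Submodule.subset_span ⟨j, rfl⟩))
      refine ⟨a, ?_⟩
      rw [← inner_column y j]
      simpa using ha
    choose z hz using h'
    exact ⟨z, eq_dualVec hB y z fun j => (hz j).symm⟩
  · rintro ⟨z, rfl⟩ x hx
    induction hx using Submodule.span_induction with
    | mem x hx =>
      obtain ⟨j, rfl⟩ := hx
      refine Submodule.mem_one.2 ⟨z j, ?_⟩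
      have := (inner_column (dualVec B z) j).trans (sum_mul_dualVec hB z j)
      simpa using this.symm
    | zero => rw [map_zero]; exact Submodule.zero_mem _
    | add x y _ _ hx hy => rw [map_add]; exact Submodule.add_mem _ hx hy
    | smul a x _ hx =>
      have : (innerₗ (EuclideanSpace ℝ (Fin n))) (dualVec B z) (a • x) =
          a • (innerₗ (EuclideanSpace ℝ (Fin n))) (dualVec B z) x := map_zsmul _ a x
      rw [this]; exact Submodule.smul_mem _ _ hx

theorem gaussianMass_dual (hB : B.det ≠ 0) (s : ℝ) :
    gaussianMass (1 / s) ((dualLattice (latticeOf B) : Set (EuclideanSpace ℝ (Fin n))) \ {0}) =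
      ∑' z : {z : Fin n → ℤ // z ≠ 0},
        ENNReal.ofReal (Real.exp (-(Real.pi * s ^ 2 * ‖dualVec B z‖ ^ 2))) := by
  let φ : {z : Fin n → ℤ // z ≠ 0} →
      ((dualLattice (latticeOf B) : Set (EuclideanSpace ℝ (Fin n))) \ {0} : Set _) := fun z =>
    ⟨dualVec B z, (mem_dualLattice hB _).2 ⟨z, rfl⟩, dualVec_ne_zero hB z.2⟩
  have hφ : Function.Bijective φ := by
    constructor
    · intro z z' h
      exact Subtype.ext (dualVec_injective hB (Subtype.ext_iff.1 h))
    · rintro ⟨y, hy, hy0⟩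
      obtain ⟨z, rfl⟩ := (mem_dualLattice hB y).1 hy
      refine ⟨⟨z, fun h => hy0 ?_⟩, rfl⟩
      rw [h, dualVec_zero]; rfl
  rw [gaussianMass, ← (Equiv.ofBijective φ hφ).tsum_eq]
  refine tsum_congr fun z => ?_
  congr 2
  simp only [Equiv.ofBijective_apply, φ]
  rw [one_div, inv_pow, div_inv_eq_mul]; ring

/-- An unconditional sum in `[0, ∞]` is the supremum of its finite partial sums. All later estimates
therefore concern finite sets of coordinate vectors. -/
theorem gaussianMass_dual_le (hB : B.det ≠ 0) (s : ℝ) {ε : ℝ} (hε : 0 ≤ ε) :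
    gaussianMass (1 / s) ((dualLattice (latticeOf B) : Set (EuclideanSpace ℝ (Fin n))) \ {0}) ≤
      ENNReal.ofReal ε ↔ ∀ F : Finset (Fin n → ℤ), 0 ∉ F →
        ∑ z ∈ F, Real.exp (-(Real.pi * s ^ 2 * ‖dualVec B z‖ ^ 2)) ≤ ε := by
  rw [gaussianMass_dual hB, ENNReal.tsum_eq_iSup_sum, iSup_le_iff]
  constructor
  · intro h F hF
    have := h (F.subtype fun z => z ≠ 0)
    rw [← ENNReal.ofReal_sum_of_nonneg fun _ _ => (Real.exp_pos _).le,
      ENNReal.ofReal_le_ofReal_iff hε] at this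
    refine le_trans (le_of_eq ?_) this
    rw [Finset.sum_subtype_of_mem (fun z => Real.exp (-(Real.pi * s ^ 2 * ‖dualVec B z‖ ^ 2)))]
    exact fun z hz h0 => hF (h0 ▸ hz)
  · intro h F
    rw [← ENNReal.ofReal_sum_of_nonneg fun _ _ => (Real.exp_pos _).le,
      ENNReal.ofReal_le_ofReal_iff hε]
    refine le_trans (le_of_eq ?_) (h (F.map (Function.Embedding.subtype _)) ?_)
    · rw [Finset.sum_map]; rfl
    · simp

/-! ## Certificates for the dual basis -/

variable (B)

/-- A common denominator of the entries. -/
def commonDen : ℕ := ∏ e ∈ Finset.range (n * n), (rowMajor B e).den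

/-- The entries, multiplied by the common denominator. -/
def scaledEntry (e : ℕ) : ℤ := (rowMajor B e).num * ((commonDen B / (rowMajor B e).den : ℕ) : ℤ)

theorem commonDen_pos : 0 < commonDen B := Finset.prod_pos fun _ _ => Rat.den_pos _

theorem scaledEntry_cast {e : ℕ} (he : e < n * n) :
    (scaledEntry B e : ℚ) = commonDen B * rowMajor B e := by
  obtain ⟨m, hm⟩ : (rowMajor B e).den ∣ commonDen B :=
    Finset.dvd_prod_of_mem (fun e => (rowMajor B e).den) (Finset.mem_range.2 he)
  rw [scaledEntry, hm, Nat.mul_div_cancel_left _ (Rat.den_pos _)]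
  push_cast
  linear_combination (-(m : ℚ)) * Rat.mul_den_eq_num (rowMajor B e)

theorem index_lt (i j : Fin n) : (i : ℕ) * n + j < n * n := by
  have := Nat.mul_le_mul_right n (Nat.succ_le_of_lt i.2)
  have h2 := j.2
  rw [Nat.succ_mul] at this
  omega

theorem scaledEntry_apply (i j : Fin n) :
    (scaledEntry B (i * n + j) : ℝ) = commonDen B * (B i j : ℝ) := by
  have := scaledEntry_cast B (index_lt i j)
  rw [rowMajor_apply] at this
  exact_mod_cast this

/-- `E / d` inverts the transpose of the scaled matrix. -/
def IsDualCert (E : ℕ → ℤ) (d : ℕ) : Prop :=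
  0 < d ∧ ∀ j < n, ∀ k < n, ∑ i ∈ Finset.range n, scaledEntry B (i * n + j) * E (i * n + k) =
    if j = k then (d : ℤ) else 0

/-- The squared norm of `d / Q` times a dual vector. -/
def certNorm (n : ℕ) (E : ℕ → ℤ) (z : ℕ → ℤ) : ℤ :=
  ∑ i ∈ Finset.range n, (∑ k ∈ Finset.range n, E (i * n + k) * z k) ^ 2

variable {B}

theorem IsDualCert.dualVec_apply {E : ℕ → ℤ} {d : ℕ} (h : IsDualCert B E d) (z : Fin n → ℤ)
    (i : Fin n) : dualVec B z i = commonDen B / d * ∑ k : Fin n, (E (i * n + k) : ℝ) * z k := by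
  have hd : (d : ℝ) ≠ 0 := by exact_mod_cast h.1.ne'
  have hW : dualMatrix B = Matrix.of fun i k : Fin n => (commonDen B : ℝ) / d * E (i * n + k) := by
    refine Matrix.inv_eq_right_inv ?_
    ext j k
    have := h.2 j j.2 k k.2
    rw [Finset.sum_range] at this
    simp only [Matrix.mul_apply, Matrix.transpose_apply, Matrix.map_apply, Matrix.of_apply]
    have e : ∀ i : Fin n, (B i j : ℝ) * (commonDen B / d * E (i * n + k)) =
        ((scaledEntry B (i * n + j) * E (i * n + k) : ℤ) : ℝ) / d := fun i => by
      push_cast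
      rw [scaledEntry_apply]; ring
    rw [Finset.sum_congr rfl fun i _ => e i, ← Finset.sum_div, ← Int.cast_sum, this]
    by_cases hjk : j = k
    · subst hjk; simp [hd]
    · rw [if_neg (fun h => hjk (Fin.ext h)), Matrix.one_apply_ne hjk]; simp
  rw [dualVec, hW, Finset.mul_sum]
  simp only [Matrix.mulVec, dotProduct, Matrix.of_apply]
  exact Finset.sum_congr rfl fun k _ => by ring

theorem IsDualCert.norm_sq {E : ℕ → ℤ} {d : ℕ} (h : IsDualCert B E d) (z : ℕ → ℤ) :
    ‖dualVec B fun k : Fin n => z k‖ ^ 2 =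
      (commonDen B : ℝ) ^ 2 * certNorm n E z / (d : ℝ) ^ 2 := by
  rw [EuclideanSpace.norm_sq_eq, certNorm, Finset.sum_range]
  push_cast
  rw [Finset.mul_sum, Finset.sum_div]
  refine Finset.sum_congr rfl fun i _ => ?_
  rw [h.dualVec_apply, Real.norm_eq_abs, sq_abs, Finset.sum_range]
  ring

/-! ### An upper bound for the Gaussian mass of the dual lattice -/

theorem sum_exp_neg_abs_le {c : ℝ} (hc : 0 < c) (S : Finset ℤ) :
    ∑ v ∈ S, Real.exp (-(c * |(v : ℝ)|)) ≤ 2 * (1 + 1 / c) := by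
  obtain ⟨R, hR⟩ : ∃ R : ℕ, ∀ v ∈ S, v.natAbs < R :=
    ⟨S.sup Int.natAbs + 1, fun v hv => Nat.lt_succ_of_le (Finset.le_sup (f := Int.natAbs) hv)⟩
  let g : ℤ → ℝ := fun v => Real.exp (-(c * |(v : ℝ)|))
  have hg : ∀ v, 0 ≤ g v := fun v => (Real.exp_pos _).le
  let A : Finset ℤ := (Finset.range R).image fun k : ℕ => (k : ℤ)
  let A' : Finset ℤ := (Finset.range R).image fun k : ℕ => -(k : ℤ)
  have hsub : S ⊆ A ∪ A' := fun v hv => by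
    have := hR v hv
    simp only [A, A', Finset.mem_union, Finset.mem_image, Finset.mem_range]
    rcases Int.natAbs_eq v with h | h
    · exact Or.inl ⟨v.natAbs, this, h.symm⟩
    · exact Or.inr ⟨v.natAbs, this, h.symm⟩
  have hgeo : ∑ k ∈ Finset.range R, Real.exp (-c) ^ k ≤ 1 + 1 / c := by
    have hlt : Real.exp (-c) < 1 := by rw [Real.exp_lt_one_iff]; linarith
    have h1 : 1 + c ≤ Real.exp c := by linarith [Real.add_one_le_exp c]
    have h2 : ∑ k ∈ Finset.range R, Real.exp (-c) ^ k ≤ (1 - Real.exp (-c))⁻¹ := by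
      rw [← tsum_geometric_of_lt_one (Real.exp_pos _).le hlt]
      exact (summable_geometric_of_lt_one (Real.exp_pos _).le hlt).sum_le_tsum _
        fun _ _ => pow_nonneg (Real.exp_pos _).le _
    refine h2.trans ?_
    rw [inv_le_comm₀ (by linarith) (by positivity), Real.exp_neg]
    have h3 : (Real.exp c)⁻¹ ≤ (1 + c)⁻¹ := inv_anti₀ (by linarith) h1
    have h4 : (1 + 1 / c)⁻¹ = 1 - (1 + c)⁻¹ := by field_simp; ring
    linarith
  have hA : ∑ v ∈ A, g v ≤ 1 + 1 / c := by
    rw [Finset.sum_image fun a _ b _ h => by exact_mod_cast h]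
    refine le_trans (le_of_eq (Finset.sum_congr rfl fun k _ => ?_)) hgeo
    rw [← Real.exp_nat_mul]; simp [g]; ring
  have hA' : ∑ v ∈ A', g v ≤ 1 + 1 / c := by
    rw [Finset.sum_image fun a _ b _ h => by simpa using h]
    refine le_trans (le_of_eq (Finset.sum_congr rfl fun k _ => ?_)) hgeo
    rw [← Real.exp_nat_mul]; simp [g]; ring
  calc ∑ v ∈ S, g v ≤ ∑ v ∈ A ∪ A', g v := Finset.sum_le_sum_of_subset_of_nonneg hsub fun v _ _ => hg v
    _ ≤ ∑ v ∈ A ∪ A', g v + ∑ v ∈ A ∩ A', g v :=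
        le_add_of_nonneg_right (Finset.sum_nonneg fun v _ => hg v)
    _ = ∑ v ∈ A, g v + ∑ v ∈ A', g v := Finset.sum_union_inter
    _ ≤ 2 * (1 + 1 / c) := by linarith

/-- The integer vector `d` times a dual vector. -/
def certVec (B : Matrix (Fin n) (Fin n) ℚ) (E : ℕ → ℤ) (z : Fin n → ℤ) (i : Fin n) : ℤ :=
  commonDen B * ∑ k : Fin n, E (i * n + k) * z k

theorem IsDualCert.certVec_cast {E : ℕ → ℤ} {d : ℕ} (h : IsDualCert B E d) (z : Fin n → ℤ)
    (i : Fin n) : (certVec B E z i : ℝ) = d * dualVec B z i := by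
  have hd : (d : ℝ) ≠ 0 := by exact_mod_cast h.1.ne'
  rw [h.dualVec_apply, certVec]
  push_cast
  field_simp

/-- `d` times a dual vector is integral, and `|v| ≤ v ^ 2` for integers. This allows a Gaussian
weight to be dominated by a product of one-dimensional geometric weights. -/
theorem IsDualCert.sum_abs_le {E : ℕ → ℤ} {d : ℕ} (h : IsDualCert B E d) (z : Fin n → ℤ) :
    ∑ i, |(certVec B E z i : ℝ)| ≤ (d : ℝ) ^ 2 * ‖dualVec B z‖ ^ 2 := by
  rw [EuclideanSpace.norm_sq_eq, Finset.mul_sum]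
  refine Finset.sum_le_sum fun i _ => ?_
  rw [Real.norm_eq_abs, ← abs_of_nonneg (Nat.cast_nonneg' d : (0 : ℝ) ≤ d), ← mul_pow, ← abs_mul,
    ← h.certVec_cast]
  have : |certVec B E z i| ≤ |certVec B E z i| ^ 2 := by
    rcases eq_or_ne (certVec B E z i) 0 with h0 | h0
    · simp [h0]
    · have := Int.one_le_abs h0; nlinarith
  exact_mod_cast this

theorem IsDualCert.certVec_injective (hB : B.det ≠ 0) {E : ℕ → ℤ} {d : ℕ} (h : IsDualCert B E d) :
    Function.Injective (certVec B E) := fun z z' hz => by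
  have hd : (d : ℝ) ≠ 0 := by exact_mod_cast h.1.ne'
  refine dualVec_injective hB ?_
  ext i
  have h₁ := h.certVec_cast z i
  rw [hz, h.certVec_cast z' i] at h₁
  exact (mul_left_cancel₀ hd h₁).symm

theorem IsDualCert.one_le (hB : B.det ≠ 0) {E : ℕ → ℤ} {d : ℕ} (h : IsDualCert B E d)
    {z : Fin n → ℤ} (hz : z ≠ 0) : 1 ≤ (d : ℝ) ^ 2 * ‖dualVec B z‖ ^ 2 := by
  refine le_trans ?_ (h.sum_abs_le z)
  have hne : certVec B E z ≠ 0 := fun h0 => hz (h.certVec_injective hB (h0.trans (by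
    funext i; simp [certVec])))
  obtain ⟨i, hi⟩ := Function.ne_iff.1 hne
  have h₁ : (1 : ℝ) ≤ |(certVec B E z i : ℝ)| := by
    have := Int.one_le_abs hi; exact_mod_cast this
  exact h₁.trans (Finset.single_le_sum (f := fun i => |(certVec B E z i : ℝ)|)
    (fun _ _ => abs_nonneg _) (Finset.mem_univ i))

/-- A crude bound on the Gaussian mass of the dual lattice. -/
theorem IsDualCert.sum_exp_le (hB : B.det ≠ 0) {E : ℕ → ℤ} {d : ℕ} (h : IsDualCert B E d)
    {κ : ℝ} (hκ : 0 < κ) (F : Finset (Fin n → ℤ)) :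
    ∑ z ∈ F, Real.exp (-(κ * ‖dualVec B z‖ ^ 2)) ≤ (2 * (1 + (d : ℝ) ^ 2 / κ)) ^ n := by
  classical
  have hd : (0 : ℝ) < d := by exact_mod_cast h.1
  set c : ℝ := κ / (d : ℝ) ^ 2 with hc
  have hc0 : 0 < c := by positivity
  have h1c : 1 / c = (d : ℝ) ^ 2 / κ := by rw [hc, one_div_div]
  let T : Finset ℤ := Finset.univ.biUnion fun i : Fin n => F.image fun z => certVec B E z i
  have step : ∀ z ∈ F, Real.exp (-(κ * ‖dualVec B z‖ ^ 2)) ≤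
      ∏ i, Real.exp (-(c * |(certVec B E z i : ℝ)|)) := fun z _ => by
    rw [← Real.exp_sum, Real.exp_le_exp, Finset.sum_neg_distrib, neg_le_neg_iff, ← Finset.mul_sum]
    calc c * ∑ i, |(certVec B E z i : ℝ)| ≤ c * ((d : ℝ) ^ 2 * ‖dualVec B z‖ ^ 2) :=
          mul_le_mul_of_nonneg_left (h.sum_abs_le z) hc0.le
      _ = κ * ‖dualVec B z‖ ^ 2 := by rw [hc]; field_simp
  refine (Finset.sum_le_sum step).trans ?_
  have hinj := h.certVec_injective hB
  rw [← Finset.sum_image (g := certVec B E)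
    (f := fun v => ∏ i, Real.exp (-(c * |(v i : ℝ)|))) fun a _ b _ hab => hinj hab]
  have hsub : F.image (certVec B E) ⊆ Fintype.piFinset fun _ : Fin n => T := fun v hv => by
    obtain ⟨z, hz, rfl⟩ := Finset.mem_image.1 hv
    refine Fintype.mem_piFinset.2 fun i => Finset.mem_biUnion.2 ⟨i, Finset.mem_univ i, ?_⟩
    exact Finset.mem_image.2 ⟨z, hz, rfl⟩
  refine (Finset.sum_le_sum_of_subset_of_nonneg hsub fun _ _ _ =>
    Finset.prod_nonneg fun _ _ => (Real.exp_pos _).le).trans ?_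
  rw [← Finset.prod_univ_sum (fun _ : Fin n => T) fun _ v => Real.exp (-(c * |(v : ℝ)|))]
  rw [Finset.prod_const, Finset.card_univ, Fintype.card_fin]
  refine pow_le_pow_left₀ (Finset.sum_nonneg fun _ _ => (Real.exp_pos _).le) ?_ n
  rw [← h1c]
  exact sum_exp_neg_abs_le hc0 T
end
end

/-! ### Sizes of certificates and coordinates -/

noncomputable section
section
variable {n : ℕ} {B : Matrix (Fin n) (Fin n) ℚ}

theorem commonDen_le (B : Matrix (Fin n) (Fin n) ℚ) {b : ℕ}
    (h : ∀ e < n * n, (rowMajor B e).den ≤ b) : commonDen B ≤ b ^ (n * n) := by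
  rw [commonDen]
  simpa using Finset.prod_le_pow_card (Finset.range (n * n)) (fun e => (rowMajor B e).den) b
    fun e he => h e (Finset.mem_range.1 he)

/-- Every nonsingular matrix has a dual certificate, whose size is polynomial. -/
theorem exists_dualCert (hB : B.det ≠ 0) {b : ℕ} (hb : ∀ e < n * n, (scaledEntry B e).natAbs ≤ b)
    (hb1 : 1 ≤ b) : ∃ (E : ℕ → ℤ) (d : ℕ), IsDualCert B E d ∧ d ≤ n.factorial * b ^ n ∧
      ∀ e, (E e).natAbs ≤ n.factorial * b ^ n := by
  classical
  let C : Matrix (Fin n) (Fin n) ℤ := Matrix.of fun i j => scaledEntry B (i * n + j)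
  have hdet : C.det ≠ 0 := by
    have e : C.map (fun a => (a : ℚ)) = (commonDen B : ℚ) • B := by
      ext i j
      simp only [C, Matrix.map_apply, Matrix.of_apply, Matrix.smul_apply, smul_eq_mul]
      rw [scaledEntry_cast B (index_lt i j), rowMajor_apply]
    have h1 : ((C.det : ℤ) : ℚ) = (C.map fun a => (a : ℚ)).det := by
      have := RingHom.map_det (Int.castRingHom ℚ) C
      simpa [RingHom.mapMatrix_apply] using this
    rw [e, Matrix.det_smul] at h1
    intro h0
    rw [h0] at h1
    have : (commonDen B : ℚ) ≠ 0 := by exact_mod_cast (commonDen_pos B).ne'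
    exact mul_ne_zero (pow_ne_zero _ this) hB (by simpa using h1.symm)
  have entries : ∀ i j, (C i j).natAbs ≤ b := fun i j => hb _ (index_lt i j)
  have detb : ∀ A : Matrix (Fin n) (Fin n) ℤ, (∀ i j, (A i j).natAbs ≤ b) →
      A.det.natAbs ≤ n.factorial * b ^ n := fun A hA => by
    have := Matrix.det_le (A := A) (abv := AbsoluteValue.abs) (x := (b : ℤ)) fun i j => by
      rw [AbsoluteValue.abs_apply]
      rw [Int.abs_eq_natAbs]
      exact_mod_cast hA i j
    rw [AbsoluteValue.abs_apply, Fintype.card_fin, nsmul_eq_mul] at this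
    have h2 : ((A.det.natAbs : ℕ) : ℤ) ≤ ((n.factorial * b ^ n : ℕ) : ℤ) := by
      rw [Int.natCast_natAbs]; push_cast; exact this
    exact_mod_cast h2
  -- The transposed adjugate, with the sign of the determinant so that the denominator becomes `|det
  -- C| > 0`. Its entries are determinants too, and Leibniz' formula bounds everything by `n! * b ^
  -- n`.
  let E : ℕ → ℤ := fun e => if h : e < n * n then
    C.det.sign * C.adjugate (Fin.modNat ⟨e, h⟩) (Fin.divNat ⟨e, h⟩) else 0
  have hE : ∀ i k : Fin n, E (i * n + k) = C.det.sign * C.adjugate k i := fun i k => by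
    have hn : 0 < n := i.pos
    simp only [E]
    rw [dif_pos (index_lt i k)]
    congr 2
    · ext; simp [Fin.modNat, Nat.mod_eq_of_lt k.2]
    · ext; simp [Fin.divNat, Nat.mul_comm i.1 n, Nat.mul_add_div hn]
  refine ⟨E, C.det.natAbs, ⟨Int.natAbs_pos.2 hdet, fun j hj k hk => ?_⟩, detb C entries, fun e => ?_⟩
  · rw [Finset.sum_range]
    have h1 : ∀ i : Fin n, scaledEntry B (i * n + j) * E (i * n + k) =
        C.det.sign * (C.adjugate ⟨k, hk⟩ i * C i ⟨j, hj⟩) := fun i => by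
      have := hE i ⟨k, hk⟩
      simp only at this
      rw [this]; simp only [C, Matrix.of_apply]; ring
    rw [Finset.sum_congr rfl fun i _ => h1 i, ← Finset.mul_sum, ← Matrix.mul_apply,
      Matrix.adjugate_mul, Matrix.smul_apply, Matrix.one_apply]
    by_cases hjk : j = k
    · subst hjk
      simp
    · rw [if_neg hjk, if_neg (fun h => hjk (Fin.mk.inj_iff.1 h).symm)]; simp
  · simp only [E]
    split_ifs with h
    · rw [Int.natAbs_mul, Int.natAbs_sign_of_ne_zero hdet, one_mul, Matrix.adjugate_apply]
      refine detb _ fun i j => ?_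
      rw [Matrix.updateRow_apply]
      split_ifs
      · rw [Pi.single_apply]; split_ifs <;> simp; exact hb1
      · exact entries i j
    · simp

/-- The coordinates are the pairings with the columns of `B`, so short dual vectors have few-digit
coordinates. -/
theorem abs_coord_le (hB : B.det ≠ 0) {b : ℝ} (hb : ∀ i j, |(B i j : ℝ)| ≤ b)
    (z : Fin n → ℤ) (j : Fin n) : |(z j : ℝ)| ≤ n * (b * ‖dualVec B z‖) := by
  rw [← sum_mul_dualVec hB z j]
  refine (Finset.abs_sum_le_sum_abs _ _).trans ?_
  have : ∀ i ∈ (Finset.univ : Finset (Fin n)), |(B i j : ℝ) * dualVec B z i| ≤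
      b * ‖dualVec B z‖ := fun i _ => by
    rw [abs_mul]
    exact mul_le_mul (hb i j) (PiLp.norm_apply_le (dualVec B z) i) (abs_nonneg _)
      ((abs_nonneg _).trans (hb i j))
  simpa using Finset.sum_le_card_nsmul _ _ _ this

/-- The dual lattice contains a nonzero vector that is not too long. -/
theorem exists_dualVec_norm_le (hB : B.det ≠ 0) (hn : 0 < n) :
    ∃ z : Fin n → ℤ, z ≠ 0 ∧ ‖dualVec B z‖ = commonDen B := by
  let i₀ : Fin n := ⟨0, hn⟩
  -- The common denominator times a unit vector pairs integrally with every column.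
  let y : EuclideanSpace ℝ (Fin n) := EuclideanSpace.single i₀ (commonDen B : ℝ)
  have hy : ‖y‖ = commonDen B := by simp [y]
  let z : Fin n → ℤ := fun j => scaledEntry B (i₀ * n + j)
  have hz : dualVec B z = y := by
    refine eq_dualVec hB y _ fun j => ?_
    rw [scaledEntry_apply, Finset.sum_eq_single i₀]
    · simp [y]; ring
    · intro i _ hi; simp [y, hi]
    · simp
  refine ⟨z, fun h0 => ?_, by rw [hz, hy]⟩
  have : ‖y‖ = 0 := by rw [← hz, h0, dualVec_zero, norm_zero]
  rw [hy] at this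
  exact (commonDen_pos B).ne' (by exact_mod_cast this)

/-! ## The smoothing parameter in coordinates -/

theorem exists_isDualCert (hB : B.det ≠ 0) : ∃ (E : ℕ → ℤ) (d : ℕ), IsDualCert B E d := by
  obtain ⟨E, d, h, -⟩ := exists_dualCert hB
    (b := 1 + (Finset.range (n * n)).sup fun e => (scaledEntry B e).natAbs)
    (fun e he => (Finset.le_sup (f := fun e => (scaledEntry B e).natAbs)
      (Finset.mem_range.2 he)).trans (Nat.le_add_left _ _)) (Nat.le_add_right _ _)
  exact ⟨E, d, h⟩

/-- The hypothesis yields the bound for every `s > 1`; a finite sum is continuous in `s`, so the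
bound passes to `s = 1`. -/
theorem sum_exp_le_of_smoothingParameter_le_one (hB : B.det ≠ 0) {ε : ℝ} (hε : 0 < ε)
    (h : smoothingParameter ε (latticeOf B) ≤ 1) (F : Finset (Fin n → ℤ)) (hF : 0 ∉ F) :
    ∑ z ∈ F, Real.exp (-(Real.pi * ‖dualVec B z‖ ^ 2)) ≤ ε := by
  obtain ⟨E, d, hc⟩ := exists_isDualCert hB
  have hd : (0 : ℝ) < d := by exact_mod_cast hc.1
  have hpi := Real.pi_pos
  have mono : ∀ {s s' : ℝ}, 0 < s → s ≤ s' → ∀ F : Finset (Fin n → ℤ),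
      ∑ z ∈ F, Real.exp (-(Real.pi * s' ^ 2 * ‖dualVec B z‖ ^ 2)) ≤
      ∑ z ∈ F, Real.exp (-(Real.pi * s ^ 2 * ‖dualVec B z‖ ^ 2)) := fun {s s'} hs hs' F => by
    refine Finset.sum_le_sum fun z _ => Real.exp_le_exp.2 (neg_le_neg ?_)
    have : s ^ 2 ≤ s' ^ 2 := pow_le_pow_left₀ hs.le hs' 2
    gcongr
  -- An infimum over the empty set would be `0` and say nothing. A large `s` does qualify: nonzero
  -- dual vectors satisfy `d² ‖w‖² ≥ 1`, so enlarging `s` damps all terms uniformly, while their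
  -- total at `s = 1` is at most `K`.
  have nonempty : {s : ℝ | 0 < s ∧ gaussianMass (1 / s)
      ((dualLattice (latticeOf B) : Set (EuclideanSpace ℝ (Fin n))) \ {0}) ≤
        ENNReal.ofReal ε}.Nonempty := by
    set K : ℝ := (2 * (1 + (d : ℝ) ^ 2 / Real.pi)) ^ n with hK
    have hK0 : 0 < K := by positivity
    have hbound : ∀ s : ℝ, 1 ≤ s → ∀ F : Finset (Fin n → ℤ), 0 ∉ F →
        ∑ z ∈ F, Real.exp (-(Real.pi * s ^ 2 * ‖dualVec B z‖ ^ 2)) ≤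
          Real.exp (-((s ^ 2 - 1) * (Real.pi / (d : ℝ) ^ 2))) * K := fun s hs F hF => by
      refine le_trans ?_ (mul_le_mul_of_nonneg_left (hc.sum_exp_le hB hpi F) (Real.exp_pos _).le)
      rw [Finset.mul_sum]
      refine Finset.sum_le_sum fun z hz => ?_
      rw [← Real.exp_add, Real.exp_le_exp]
      have h1 := hc.one_le hB (z := z) fun h0 => hF (h0 ▸ hz)
      have h2 : Real.pi / (d : ℝ) ^ 2 ≤ Real.pi * ‖dualVec B z‖ ^ 2 := by
        rw [div_le_iff₀ (by positivity)]
        nlinarith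
      have h3 : 0 ≤ s ^ 2 - 1 := by nlinarith
      nlinarith [mul_le_mul_of_nonneg_left h2 h3]
    let A : ℝ := |Real.log (K / ε)| * (d : ℝ) ^ 2 / Real.pi
    have hA : 0 ≤ A := by positivity
    refine ⟨Real.sqrt (1 + A), Real.sqrt_pos.2 (by positivity), ?_⟩
    rw [gaussianMass_dual_le hB _ hε.le]
    intro F hF
    refine (hbound _ (Real.one_le_sqrt.2 (by linarith)) F hF).trans ?_
    rw [Real.sq_sqrt (by positivity)]
    have : (1 + A - 1) * (Real.pi / (d : ℝ) ^ 2) = |Real.log (K / ε)| := by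
      simp only [A]; field_simp; ring
    rw [this]
    have h1 : Real.exp (-|Real.log (K / ε)|) ≤ ε / K := by
      rw [← Real.exp_log (show 0 < ε / K by positivity), Real.exp_le_exp, ← inv_div K ε,
        Real.log_inv]
      exact neg_le_neg (le_abs_self _)
    calc _ ≤ ε / K * K := mul_le_mul_of_nonneg_right h1 hK0.le
      _ = ε := by field_simp
  have key : ∀ s : ℝ, 1 < s →
      ∑ z ∈ F, Real.exp (-(Real.pi * s ^ 2 * ‖dualVec B z‖ ^ 2)) ≤ ε := fun s hs => by
    obtain ⟨s', ⟨hs0, hs'⟩, hlt⟩ := exists_lt_of_csInf_lt nonempty (lt_of_le_of_lt h hs)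
    exact (mono hs0 hlt.le F).trans ((gaussianMass_dual_le hB s' hε.le).1 hs' F hF)
  have lim : Filter.Tendsto
      (fun s : ℝ => ∑ z ∈ F, Real.exp (-(Real.pi * s ^ 2 * ‖dualVec B z‖ ^ 2)))
      (nhdsWithin 1 (Set.Ioi 1))
      (nhds (∑ z ∈ F, Real.exp (-(Real.pi * 1 ^ 2 * ‖dualVec B z‖ ^ 2)))) :=
    (Continuous.tendsto (by fun_prop) 1).mono_left nhdsWithin_le_nhds
  have := le_of_tendsto lim (Filter.eventually_of_mem self_mem_nhdsWithin key)
  simpa using this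

theorem exists_sum_gt_of_lt_smoothingParameter (hB : B.det ≠ 0) {ε γ : ℝ} (hε : 0 < ε)
    (hγ : 0 < γ) (h : γ < smoothingParameter ε (latticeOf B)) :
    ∃ F : Finset (Fin n → ℤ), 0 ∉ F ∧
      ε < ∑ z ∈ F, Real.exp (-(Real.pi * γ ^ 2 * ‖dualVec B z‖ ^ 2)) := by
  by_contra hcon
  push Not at hcon
  refine absurd h (not_lt.2 (csInf_le ⟨0, fun s hs => hs.1.le⟩ ⟨hγ, ?_⟩))
  exact (gaussianMass_dual_le hB γ hε.le).2 hcon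
end
end

/-! ## Approximating Gaussian weights by powers -/

noncomputable section

/-- The converse of `1 + x ≤ exp x` up to second order: `log (1 + x) ≥ x / (1 + x) ≥ x - 2 x²` when
`x ≥ -1/2`. -/
theorem exp_le_one_add_pow {x : ℝ} (hx : -1 / 2 ≤ x) (M : ℕ) :
    Real.exp (M * x - 2 * (M * x ^ 2)) ≤ (1 + x) ^ M := by
  have h0 : 0 < 1 + x := by linarith
  have h1 := Real.one_sub_inv_le_log_of_pos h0
  have h2 : x - 2 * x ^ 2 ≤ 1 - (1 + x)⁻¹ := by
    have h3 : 1 - (1 + x)⁻¹ = x / (1 + x) := by field_simp; ring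
    rw [h3, le_div_iff₀ h0]
    nlinarith [mul_nonneg (sq_nonneg x) (show (0 : ℝ) ≤ 1 + 2 * x by linarith)]
  calc Real.exp (M * x - 2 * (M * x ^ 2)) = Real.exp (x - 2 * x ^ 2) ^ M := by
        rw [← Real.exp_nat_mul]; ring_nf
    _ ≤ (1 + x) ^ M := by
        refine pow_le_pow_left₀ (Real.exp_pos _).le ?_ M
        rw [← Real.le_log_iff_exp_le h0]
        linarith

/-- The integer weight `(M D + τ - ⌊D y⌋ - 1)₊ ^ M`, about `(M D) ^ M * exp (τ / D - y)`. -/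
def powWeight (M D : ℕ) (τ : ℤ) (y : ℝ) : ℕ :=
  ((M * D : ℕ) + τ - (⌊D * y⌋₊ + 1 : ℕ)).toNat ^ M

/-- `⌊D y⌋ + 1` exceeds `D y`, and `1 + x ≤ exp x` errs in the same direction; the summand `1 / D`
covers the error of `τ`. There is no restriction on `y`, as soundness has to cope with arbitrary
vectors sent by Merlin. -/
theorem powWeight_le {M D : ℕ} (hM : 0 < M) (hD : 0 < D) {τ : ℤ} {T y : ℝ}
    (hτ : |(τ : ℝ) - D * T| ≤ 1) :
    (powWeight M D τ y : ℝ) ≤ ((M : ℝ) * D) ^ M * Real.exp (T + 1 / D - y) := by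
  have hM' : (0 : ℝ) < M := by exact_mod_cast hM
  have hD' : (0 : ℝ) < D := by exact_mod_cast hD
  set A : ℤ := (M * D : ℕ) + τ - (⌊D * y⌋₊ + 1 : ℕ) with hA
  have h1 : (A : ℝ) ≤ M * D * (1 + (T + 1 / D - y) / M) := by
    have h2 := Nat.lt_floor_add_one ((D : ℝ) * y)
    have h3 := (abs_le.1 hτ).2
    have h4 : (M : ℝ) * D * (1 + (T + 1 / D - y) / M) = M * D + D * T + 1 - D * y := by
      field_simp; ring
    rw [h4, hA]; push_cast
    linarith
  have h2 : ((A.toNat : ℕ) : ℝ) ≤ M * D * Real.exp ((T + 1 / D - y) / M) := by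
    have h3 : (A : ℝ) ≤ M * D * Real.exp ((T + 1 / D - y) / M) :=
      h1.trans (mul_le_mul_of_nonneg_left (by linarith [Real.add_one_le_exp ((T + 1 / D - y) / M)])
        (by positivity))
    have h4 : ((A.toNat : ℕ) : ℝ) = ((max A 0 : ℤ) : ℝ) := by
      rw [← Int.ofNat_toNat]; exact (Int.cast_natCast _).symm
    rw [h4]; push_cast
    exact max_le h3 (by positivity)
  rw [powWeight]; push_cast
  calc ((A.toNat : ℕ) : ℝ) ^ M ≤ (M * D * Real.exp ((T + 1 / D - y) / M)) ^ M :=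
        pow_le_pow_left₀ (Nat.cast_nonneg _) h2 M
    _ = _ := by
        rw [mul_pow, ← Real.exp_nat_mul, mul_div_cancel₀ _ hM'.ne']

/-- The loss `2 / D` consists of `1 / D` for the error of `τ` and `1 / D` for rounding `D y`. -/
theorem le_powWeight {M D : ℕ} (hM : 0 < M) (hD : 0 < D) {τ : ℤ} {T y : ℝ} (hy : 0 ≤ y)
    (hτ : |(τ : ℝ) - D * T| ≤ 1) (hx : -1 ≤ (T - 2 / D - y) / M) :
    ((M : ℝ) * D) ^ M * (1 + (T - 2 / D - y) / M) ^ M ≤ powWeight M D τ y := by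
  have hM' : (0 : ℝ) < M := by exact_mod_cast hM
  have hD' : (0 : ℝ) < D := by exact_mod_cast hD
  set A : ℤ := (M * D : ℕ) + τ - (⌊D * y⌋₊ + 1 : ℕ) with hA
  have h1 : M * D * (1 + (T - 2 / D - y) / M) ≤ (A : ℝ) := by
    have h2 := Nat.floor_le (show (0 : ℝ) ≤ D * y by positivity)
    have h3 := (abs_le.1 hτ).1
    have h4 : (M : ℝ) * D * (1 + (T - 2 / D - y) / M) = M * D + D * T - 2 - D * y := by
      field_simp; ring
    rw [h4, hA]; push_cast
    linarith
  have h2 : (A : ℝ) ≤ ((A.toNat : ℕ) : ℝ) := by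
    have := Int.self_le_toNat A
    exact_mod_cast this
  rw [powWeight]; push_cast
  rw [← mul_pow]
  exact pow_le_pow_left₀ (mul_nonneg (by positivity) (by linarith)) (h1.trans h2) M

/-- The square is at most `2 (P₀ + 1)² + 2 y²`. A large `M` makes the first part tiny, and `y ≤ M /
(8 a)` turns the second, divided by `M`, into a small multiple of `y / a`, the spare decay gained
from the factor `1 + 1 / a`. -/
theorem quadratic_error_le {a M T P₀ y : ℝ} (ha0 : 0 < a) (hM0 : 0 < M)
    (hM64 : 64 * a * (P₀ + 1) ^ 2 ≤ M) (hT : -P₀ ≤ T) (hT' : T ≤ P₀) (ha : 1 ≤ a)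
    (hy : 0 ≤ y) (hyM : y ≤ M / (8 * a)) :
    1 / (16 * a) + 2 * ((T - 1 / (16 * a) - y) ^ 2 / M) ≤ 1 / (8 * a) + 1 / a * y := by
  have hia : 0 < 1 / a := by positivity
  have hia1 : 1 / a ≤ 1 := by rw [div_le_one ha0]; exact ha
  have e16 : 1 / (16 * a) = 1 / a / 16 := by field_simp
  have e8 : 1 / (8 * a) = 1 / a / 8 := by field_simp
  have h2 : (T - 1 / (16 * a)) ^ 2 ≤ (P₀ + 1) ^ 2 := by
    apply sq_le_sq' <;> rw [e16] <;> linarith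
  have h1 : (T - 1 / (16 * a) - y) ^ 2 ≤ 2 * (P₀ + 1) ^ 2 + 2 * y ^ 2 := by
    have h3 := sq_nonneg (T - 1 / (16 * a) + y)
    have h4 : (T - 1 / (16 * a) - y) ^ 2 =
      2 * (T - 1 / (16 * a)) ^ 2 + 2 * y ^ 2 - (T - 1 / (16 * a) + y) ^ 2 := by ring
    linarith
  have h4 : 2 * ((T - 1 / (16 * a) - y) ^ 2 / M) ≤ (4 * (P₀ + 1) ^ 2 + 4 * y ^ 2) / M := by
    rw [mul_div_assoc']
    exact div_le_div_of_nonneg_right (by linarith) hM0.le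
  have h5 : 4 * (P₀ + 1) ^ 2 ≤ 1 / a / 16 * M := by
    rw [div_div, div_mul_eq_mul_div, one_mul, le_div_iff₀ (by positivity)]
    linarith
  have h6 : 4 * y ^ 2 ≤ 1 / a * y * M := by
    have h7 : 1 / a * y * M = y * M / a := by field_simp
    rw [h7, le_div_iff₀ ha0]
    rw [le_div_iff₀ (by positivity)] at hyM
    have h8 := mul_le_mul_of_nonneg_left hyM hy
    have h9 : y * (y * (8 * a)) = 8 * (a * y ^ 2) := by ring
    have h10 : 4 * y ^ 2 * a = 4 * (a * y ^ 2) := by ring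
    have h11 : 0 ≤ a * y ^ 2 := by positivity
    linarith
  have h12 : (4 * (P₀ + 1) ^ 2 + 4 * y ^ 2) / M ≤ 1 / a / 16 + 1 / a * y := by
    rw [div_le_iff₀ hM0]; linarith
  rw [e8]; linarith

/-- If a Gaussian sum is large, then either one of its terms is very large, or the sum of the
corresponding powers over the not too distant points is large. -/
theorem sum_exp_dichotomy {ι : Type*} [DecidableEq ι] (F : Finset ι) (y : ι → ℝ)
    (hy : ∀ z, 0 ≤ y z) {a M T P : ℝ} (ha : 1 ≤ a) (hP : 0 ≤ P)
    (hsum : ∀ G ⊆ F, ∑ z ∈ G, Real.exp (-(1 / (2 * a) * y z)) ≤ Real.exp P)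
    (hM : 64 * a * (a * (2 * P + 6) + 1) ^ 2 + 8 * a * (P + a * (2 * P + 6) + 16 * a) ≤ M)
    (hlarge : Real.exp (-T + 1 / (2 * a)) < ∑ z ∈ F, Real.exp (-((1 + 1 / a) * y z))) :
    (∃ z ∈ F, y z ≤ T - 2) ∨
      (Real.exp (1 / (4 * a)) ≤ ∑ z ∈ F.filter fun z => y z ≤ M / (8 * a),
        Real.exp ((T - 1 / (16 * a) - y z) - 2 * ((T - 1 / (16 * a) - y z) ^ 2 / M)) ∧
      ∀ z ∈ F.filter fun z => y z ≤ M / (8 * a), -1 / 2 ≤ (T - 1 / (16 * a) - y z) / M) := by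
  classical
  by_contra hcon
  push Not at hcon
  obtain ⟨hno, hcon⟩ := hcon
  have ha0 : 0 < a := by linarith
  set P₀ : ℝ := a * (2 * P + 6) with hP₀
  have hP₀6 : 6 ≤ P₀ := by nlinarith
  have hia : 0 < 1 / a := by positivity
  have hia1 : 1 / a ≤ 1 := by rw [div_le_one ha0]; exact ha
  have e2 : 1 / (2 * a) = 1 / a / 2 := by field_simp
  have e4 : 1 / (4 * a) = 1 / a / 4 := by field_simp
  have e16 : 1 / (16 * a) = 1 / a / 16 := by field_simp
  have hM64 : 64 * a * (P₀ + 1) ^ 2 ≤ M := by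
    have : 0 ≤ 8 * a * (P + P₀ + 16 * a) := by positivity
    linarith
  have hM8 : 8 * a * (P + P₀ + 16 * a) ≤ M := by
    have : 0 ≤ 64 * a * (P₀ + 1) ^ 2 := by positivity
    linarith
  have hM0 : 0 < M := lt_of_lt_of_le (by positivity) hM64
  -- Without a point at `y ≤ T - 2`, every term is at most `exp (-(1 + 1/(2a)) (T - 2))` times its
  -- slowly decaying part. So the sum is about `exp (P - (1 + 1/(2a)) T)` at most, too small once `T
  -- / (2a) ≥ P + 3`.
  have hTlt : T < P₀ := by
    by_contra hT
    push Not at hT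
    have h1 : ∑ z ∈ F, Real.exp (-((1 + 1 / a) * y z)) ≤
        Real.exp (-((1 + 1 / (2 * a)) * (T - 2))) * Real.exp P := by
      refine le_trans ?_ (mul_le_mul_of_nonneg_left (hsum F subset_rfl) (Real.exp_pos _).le)
      rw [Finset.mul_sum]
      refine Finset.sum_le_sum fun z hz => ?_
      rw [← Real.exp_add, Real.exp_le_exp, e2]
      have := hno z hz
      nlinarith [mul_pos hia (show 0 < y z - (T - 2) by linarith)]
    have h2 := hlarge.trans_le h1
    rw [← Real.exp_add, Real.exp_lt_exp, e2] at h2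
    have h3 : 2 * P + 6 ≤ 1 / a * T := by
      have := mul_le_mul_of_nonneg_left hT hia.le
      rw [hP₀] at this
      have h4 : 1 / a * (a * (2 * P + 6)) = 2 * P + 6 := by field_simp
      linarith
    nlinarith
  -- The total mass is at most `exp P`, so a very negative `T` is impossible.
  have hTgt : -P < T := by
    have h1 : ∑ z ∈ F, Real.exp (-((1 + 1 / a) * y z)) ≤ Real.exp P := by
      refine le_trans (Finset.sum_le_sum fun z _ => ?_) (hsum F subset_rfl)
      rw [Real.exp_le_exp, e2]
      nlinarith [hy z, mul_nonneg hia.le (hy z)]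
    have h2 := hlarge.trans_le h1
    rw [Real.exp_lt_exp, e2] at h2
    linarith
  have hPP₀ : P ≤ P₀ := by nlinarith
  set R : ℝ := M / (8 * a) with hR
  have hRP : P + P₀ + 16 * a ≤ R := by
    rw [hR, le_div_iff₀ (by positivity)]; linarith
  have hRM : R ≤ M / 8 := by
    rw [hR]; exact div_le_div_of_nonneg_left hM0.le (by norm_num) (by linarith)
  have hMbig : 8 * (P₀ + 1) ≤ M := by
    have h1 : 1 * (P₀ + 1) ≤ a * (P₀ + 1) ^ 2 :=
      mul_le_mul ha (by nlinarith) (by linarith) ha0.le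
    linarith
  have hge : ∀ z ∈ F.filter fun z => y z ≤ R, -1 / 2 ≤ (T - 1 / (16 * a) - y z) / M :=
    fun z hz => by
    have h1 := (Finset.mem_filter.1 hz).2
    rw [le_div_iff₀ hM0, e16]
    linarith
  -- The distant points contribute little.
  have htail : ∑ z ∈ F.filter fun z => ¬ y z ≤ R, Real.exp (-((1 + 1 / a) * y z)) ≤
      Real.exp (-T) * (1 / (16 * a)) := by
    have h1 : ∑ z ∈ F.filter fun z => ¬ y z ≤ R, Real.exp (-((1 + 1 / a) * y z)) ≤
        Real.exp (-R) * Real.exp P := by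
      refine le_trans ?_ (mul_le_mul_of_nonneg_left (hsum _
        (Finset.filter_subset (fun z => ¬ y z ≤ R) F))
        (Real.exp_pos _).le)
      rw [Finset.mul_sum]
      refine Finset.sum_le_sum fun z hz => ?_
      rw [← Real.exp_add, Real.exp_le_exp, e2]
      have := (Finset.mem_filter.1 hz).2
      push Not at this
      nlinarith [mul_nonneg hia.le (hy z)]
    refine h1.trans ?_
    have h2 : Real.exp (-(16 * a)) ≤ 1 / (16 * a) := by
      rw [Real.exp_neg, one_div]
      exact inv_anti₀ (by positivity) (by linarith [Real.add_one_le_exp (16 * a)])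
    refine le_trans ?_ (mul_le_mul_of_nonneg_left h2 (Real.exp_pos _).le)
    rw [← Real.exp_add, ← Real.exp_add, Real.exp_le_exp]
    linarith
  -- Discarding the tail costs `1/(8a)` in the exponent: with `t = 1/(8a)`, `exp (4t) - exp (3t) ≥ t
  -- ≥ t / 2`.
  have hnear : Real.exp (-T + 3 / (8 * a)) ≤
      ∑ z ∈ F.filter fun z => y z ≤ R, Real.exp (-((1 + 1 / a) * y z)) := by
    have h1 := Finset.sum_filter_add_sum_filter_not F (fun z => y z ≤ R)
      fun z => Real.exp (-((1 + 1 / a) * y z))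
    have h2 : Real.exp (-T + 3 / (8 * a)) + Real.exp (-T) * (1 / (16 * a)) ≤
        Real.exp (-T + 1 / (2 * a)) := by
      set t : ℝ := 1 / (8 * a) with ht
      have ht0 : 0 < t := by positivity
      have e₁ : 3 / (8 * a) = 3 * t := by rw [ht]; ring
      have e₂ : 1 / (2 * a) = 3 * t + t := by rw [ht]; field_simp; norm_num
      have e₃ : 1 / (16 * a) = t / 2 := by rw [ht]; field_simp; norm_num
      rw [e₁, e₂, e₃, Real.exp_add, Real.exp_add (-T), ← mul_add]
      refine mul_le_mul_of_nonneg_left ?_ (Real.exp_pos _).le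
      rw [Real.exp_add]
      nlinarith [Real.add_one_le_exp t, Real.one_le_exp (show 0 ≤ 3 * t by linarith),
        Real.exp_pos (3 * t)]
    linarith
  refine absurd (hcon ?_) (by
    push Not
    exact hge)
  -- Balance of exponents: `3/(8a)` is left of the gap, and `1/(8a)` is spent on rounding and on the
  -- quadratic error.
  calc Real.exp (1 / (4 * a)) = Real.exp (T - 1 / (8 * a)) * Real.exp (-T + 3 / (8 * a)) := by
        rw [← Real.exp_add]; congr 1; field_simp; ring
    _ ≤ Real.exp (T - 1 / (8 * a)) *
        ∑ z ∈ F.filter fun z => y z ≤ R, Real.exp (-((1 + 1 / a) * y z)) :=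
        mul_le_mul_of_nonneg_left hnear (Real.exp_pos _).le
    _ ≤ _ := by
        rw [Finset.mul_sum]
        refine Finset.sum_le_sum fun z hz => ?_
        rw [← Real.exp_add, Real.exp_le_exp]
        have hzR := (Finset.mem_filter.1 hz).2
        have := quadratic_error_le (T := T) ha0 hM0 hM64 (by linarith) (by linarith) ha (hy z) hzR
        linarith
end

/-! ## Digits -/

theorem digits_exists {b : ℕ} (L : ℕ) (g : ℕ → ℕ) (hg : ∀ i < L, g i < b) :
    ∃ f < b ^ L, ∀ i < L, f / b ^ i % b = g i := by
  let G : Fin L → Fin b := fun i => ⟨g i, hg i i.2⟩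
  refine ⟨finFunctionFinEquiv G, (finFunctionFinEquiv G).2, fun i hi => ?_⟩
  have := congrFun (finFunctionFinEquiv.symm_apply_apply G) ⟨i, hi⟩
  exact congrArg Fin.val this

theorem digits_ext {b L f f' : ℕ} (hf : f < b ^ L) (hf' : f' < b ^ L)
    (h : ∀ i < L, f / b ^ i % b = f' / b ^ i % b) : f = f' := by
  have : (⟨f, hf⟩ : Fin (b ^ L)) = ⟨f', hf'⟩ := by
    apply finFunctionFinEquiv.symm.injective
    funext i
    exact Fin.ext (h i i.2)
  exact congrArg Fin.val this

/-- The numbers whose `N` digits in base `b` all lie in `S`. -/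
theorem card_digits_mem {b N : ℕ} (S : Finset ℕ) (hS : ∀ f ∈ S, f < b) :
    ((Finset.range (b ^ N)).filter fun u => ∀ t < N, u / b ^ t % b ∈ S).card = S.card ^ N := by
  classical
  have hcard : (Fintype.piFinset fun _ : Fin N => S).card = S.card ^ N := by simp
  rw [← hcard]
  refine Finset.card_bij (fun u _ t => u / b ^ (t : ℕ) % b) ?_ ?_ ?_
  · intro u hu
    exact Fintype.mem_piFinset.2 fun t => (Finset.mem_filter.1 hu).2 t t.2
  · intro u hu u' hu' h
    exact digits_ext (Finset.mem_range.1 (Finset.mem_filter.1 hu).1)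
      (Finset.mem_range.1 (Finset.mem_filter.1 hu').1) fun i hi => congrFun h ⟨i, hi⟩
  · intro v hv
    have hv' := Fintype.mem_piFinset.1 hv
    obtain ⟨u, hu, hd⟩ := digits_exists (b := b) N (fun t => if h : t < N then v ⟨t, h⟩ else 0)
      fun t ht => by rw [dif_pos ht]; exact hS _ (hv' _)
    have hd' : ∀ t : Fin N, u / b ^ (t : ℕ) % b = v t := fun t => by
      rw [hd t t.2, dif_pos t.2]
    exact ⟨u, Finset.mem_filter.2 ⟨Finset.mem_range.2 hu, fun t ht => by
      rw [hd' ⟨t, ht⟩]; exact hv' _⟩, funext hd'⟩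

/-! ## Hashing -/

/-- The number of multiples of `g` in a window. -/
theorem card_filter_modEq_le (g I x : ℕ) :
    g * ((Finset.range I).filter fun y => y % g = x % g).card ≤ I + g := by
  have h : ((Finset.range I).filter fun y => y % g = x % g).card ≤ I / g + 1 := by
    have h1 : ((Finset.range I).filter fun y => y % g = x % g).card ≤
        (Finset.range (I / g + 1)).card := by
      refine Finset.card_le_card_of_injOn (fun y => y / g) ?_ ?_
      · intro y hy
        have hy := Finset.mem_range.1 (Finset.mem_filter.1 hy).1
        exact Finset.mem_coe.2 (Finset.mem_range.2 (Nat.lt_succ_of_le (Nat.div_le_div_right hy.le)))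
      · intro y hy y' hy' h
        have e := (Finset.mem_filter.1 hy).2
        have e' := (Finset.mem_filter.1 hy').2
        rw [← Nat.div_add_mod y g, ← Nat.div_add_mod y' g, e, e']
        simp only at h
        rw [h]
    simpa using h1
  calc _ ≤ g * (I / g + 1) := Nat.mul_le_mul_left g h
    _ ≤ I + g := by rw [mul_add, mul_one]; exact Nat.add_le_add_right (Nat.mul_div_le I g) g

/-- An arithmetic progression modulo `Q` hits an interval about as often as it should. -/
theorem card_progression_le {Q Δ : ℕ} (hQ : 0 < Q) (hΔ : 0 < Δ) (I x : ℕ) :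
    ((Finset.range Q).filter fun a => (x + a * Δ) % Q < I).card ≤ I + Δ := by
  classical
  set g := Nat.gcd Δ Q
  have hg0 : 0 < g := Nat.gcd_pos_of_pos_right _ hQ
  have hgQ : g ∣ Q := Nat.gcd_dvd_right _ _
  have hgΔ : g ∣ Δ := Nat.gcd_dvd_left _ _
  -- With `g = gcd Δ Q`, the progression visits only residues congruent to `x` modulo `g`, and each
  -- of them at most `g` times. The window contains at most `I / g + 1` such residues.
  have hmaps : ∀ a ∈ (Finset.range Q).filter fun a => (x + a * Δ) % Q < I,
      (x + a * Δ) % Q ∈ (Finset.range I).filter fun y => y % g = x % g := fun a ha => by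
    refine Finset.mem_filter.2 ⟨Finset.mem_range.2 (Finset.mem_filter.1 ha).2, ?_⟩
    rw [Nat.mod_mod_of_dvd _ hgQ, Nat.add_mod, Nat.mod_eq_zero_of_dvd (hgΔ.mul_left a)]
    simp
  refine (Finset.card_le_mul_card_image_of_maps_to hmaps g fun y _ => ?_).trans
    ((card_filter_modEq_le g I x).trans (Nat.add_le_add_left (Nat.le_of_dvd hΔ hgΔ) I))
  have hq0 : 0 < Q / g := Nat.div_pos (Nat.le_of_dvd hQ hgQ) hg0
  have hcard : g = (Finset.range g).card := by simp
  conv_rhs => rw [hcard]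
  refine Finset.card_le_card_of_injOn (fun a => a / (Q / g)) ?_ ?_
  · intro a ha
    have ha := Finset.mem_range.1 (Finset.mem_filter.1 (Finset.mem_filter.1 ha).1).1
    refine Finset.mem_coe.2 (Finset.mem_range.2 ?_)
    rw [Nat.div_lt_iff_lt_mul hq0, Nat.mul_div_cancel' hgQ]
    exact ha
  · intro a ha a' ha' h
    have e := (Finset.mem_filter.1 ha).2
    have e' := (Finset.mem_filter.1 ha').2
    have h1 : x + a * Δ ≡ x + a' * Δ [MOD Q] := e.trans e'.symm
    have h2 : a * Δ ≡ a' * Δ [MOD Q] := Nat.ModEq.add_left_cancel' x h1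
    have h3 : a ≡ a' [MOD Q / g] := by
      have := Nat.ModEq.cancel_right_div_gcd hQ h2
      rwa [Nat.gcd_comm] at this
    simp only at h
    rw [← Nat.div_add_mod a (Q / g), ← Nat.div_add_mod a' (Q / g), h, h3]

theorem card_shift (Q c I : ℕ) (hI : I ≤ Q) (hQ : 0 < Q) :
    ((Finset.range Q).filter fun b => (c + b) % Q < I).card = I := by
  have hcard : I = (Finset.range I).card := by simp
  conv_rhs => rw [hcard]
  refine Finset.card_bij (fun b _ => (c + b) % Q) ?_ ?_ ?_
  · intro b hb; exact Finset.mem_range.2 (Finset.mem_filter.1 hb).2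
  · intro b hb b' hb' h
    have h1 := Finset.mem_range.1 (Finset.mem_filter.1 hb).1
    have h2 := Finset.mem_range.1 (Finset.mem_filter.1 hb').1
    exact Nat.ModEq.eq_of_lt_of_lt (Nat.ModEq.add_left_cancel' c h) h1 h2
  · intro y hy
    have hyI := Finset.mem_range.1 hy
    have e : (c + (y + (Q - c % Q)) % Q) % Q = y := by
      have h1 := Nat.mod_lt c hQ
      rw [Nat.add_mod_mod, ← Nat.mod_add_mod, show c % Q + (y + (Q - c % Q)) = y + Q by omega,
        Nat.add_mod_right, Nat.mod_eq_of_lt (by omega)]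
    exact ⟨(y + (Q - c % Q)) % Q, Finset.mem_filter.2 ⟨Finset.mem_range.2 (Nat.mod_lt _ hQ),
      by rw [e]; exact hyI⟩, e⟩

/-- The hash of `u` under the coins `r = a + Q b` falls into the window `[0, I)`. -/
abbrev hashHit (Q I r u : ℕ) : Prop := (r % Q * u + r / Q) % Q < I

theorem card_filter_range_mul (Q : ℕ) (hQ : 0 < Q) (p : ℕ → ℕ → Prop)
    [∀ a b, Decidable (p a b)] :
    ((Finset.range (Q * Q)).filter fun r => p (r % Q) (r / Q)).card =
      ∑ a ∈ Finset.range Q, ((Finset.range Q).filter fun b => p a b).card := by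
  classical
  rw [← Finset.card_sigma]
  refine Finset.card_bij' (fun r _ => ⟨r % Q, r / Q⟩) (fun s _ => s.1 + Q * s.2) ?_ ?_ ?_ ?_
  · intro r hr
    obtain ⟨h1, h2⟩ := Finset.mem_filter.1 hr
    simp only [Finset.mem_sigma, Finset.mem_range, Finset.mem_filter]
    exact ⟨Nat.mod_lt _ hQ, Nat.div_lt_of_lt_mul (Finset.mem_range.1 h1), h2⟩
  · intro s hs
    simp only [Finset.mem_sigma, Finset.mem_range, Finset.mem_filter] at hs ⊢
    obtain ⟨h1, h2, h3⟩ := hs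
    rw [Nat.add_mul_mod_self_left, Nat.mod_eq_of_lt h1, Nat.add_mul_div_left _ _ hQ,
      Nat.div_eq_of_lt h1, zero_add]
    refine ⟨?_, h3⟩
    calc s.1 + Q * s.2 < Q + Q * s.2 := by omega
      _ = Q * (s.2 + 1) := by ring
      _ ≤ Q * Q := Nat.mul_le_mul_left Q h2
  · intro r _; exact Nat.mod_add_div r Q
  · intro s hs
    simp only [Finset.mem_sigma, Finset.mem_range, Finset.mem_filter] at hs
    obtain ⟨h1, h2, h3⟩ := hs
    simp [Nat.mod_eq_of_lt h1, Nat.add_mul_div_left _ _ hQ, Nat.div_eq_of_lt h1]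

theorem card_hashHit (Q I u : ℕ) (hI : I ≤ Q) (hQ : 0 < Q) :
    ((Finset.range (Q * Q)).filter fun r => hashHit Q I r u).card = Q * I := by
  have := card_filter_range_mul Q hQ (fun a b => (a * u + b) % Q < I)
  simp only [hashHit]
  rw [this]
  simp [card_shift Q _ I hI hQ]

/-- For fixed `a`, the value `y` at `u` determines `b`, and the value at `u'` is then `y + a (u' -
u)`. For each `y < I` this is an arithmetic progression in `a`, so `card_progression_le` applies.
`Q` need not be prime; the price is an excess of `I * u'` over the ideal count `I * I`. -/
theorem card_hashHit_pair_lt (Q I u u' : ℕ) (hQ : 0 < Q) (h : u < u') :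
    ((Finset.range (Q * Q)).filter fun r => hashHit Q I r u ∧ hashHit Q I r u').card ≤
      I * (I + u') := by
  classical
  have e := card_filter_range_mul Q hQ fun a b => (a * u + b) % Q < I ∧ (a * u' + b) % Q < I
  simp only [hashHit]
  rw [e]
  obtain ⟨Δ, rfl⟩ := Nat.exists_eq_add_of_lt h
  have h1 : ∀ a ∈ Finset.range Q, ((Finset.range Q).filter fun b =>
      (a * u + b) % Q < I ∧ (a * (u + Δ + 1) + b) % Q < I).card ≤
      ((Finset.range I).filter fun y => (y + a * (Δ + 1)) % Q < I).card := fun a _ => by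
    refine Finset.card_le_card_of_injOn (fun b => (a * u + b) % Q) ?_ ?_
    · intro b hb
      obtain ⟨-, h2, h3⟩ := Finset.mem_filter.1 hb
      refine Finset.mem_coe.2 (Finset.mem_filter.2 ⟨Finset.mem_range.2 h2, ?_⟩)
      rw [Nat.mod_add_mod, show a * u + b + a * (Δ + 1) = a * (u + Δ + 1) + b by ring]
      exact h3
    · intro b hb b' hb' hbb
      have g1 := Finset.mem_range.1 (Finset.mem_filter.1 hb).1
      have g2 := Finset.mem_range.1 (Finset.mem_filter.1 hb').1
      exact Nat.ModEq.eq_of_lt_of_lt (Nat.ModEq.add_left_cancel' _ hbb) g1 g2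
  refine (Finset.sum_le_sum h1).trans ?_
  simp only [Finset.card_filter]
  rw [Finset.sum_comm]
  simp only [← Finset.card_filter]
  refine (Finset.sum_le_card_nsmul _ _ (I + (u + Δ + 1)) fun y _ =>
    (card_progression_le hQ (Nat.succ_pos Δ) I y).trans (by omega)).trans ?_
  simp

theorem card_hashHit_pair (Q I u u' s : ℕ) (hQ : 0 < Q) (h : u ≠ u') (hu : u ≤ s)
    (hu' : u' ≤ s) :
    ((Finset.range (Q * Q)).filter fun r => hashHit Q I r u ∧ hashHit Q I r u').card ≤
      I * (I + s) := by
  rcases lt_or_gt_of_ne h with h | h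
  · exact (card_hashHit_pair_lt Q I u u' hQ h).trans (Nat.mul_le_mul_left _ (by omega))
  · simp only [and_comm (a := hashHit Q I _ u)]
    exact (card_hashHit_pair_lt Q I u' u hQ h).trans (Nat.mul_le_mul_left _ (by omega))

open Classical in
/-- Few elements are rarely hit. -/
theorem hash_upper (Q I : ℕ) (hQ : 0 < Q) (hI : I ≤ Q) (S : Finset ℕ) :
    ((Finset.range (Q * Q)).filter fun r => ∃ u ∈ S, hashHit Q I r u).card ≤ S.card * (Q * I) := by
  have : ((Finset.range (Q * Q)).filter fun r => ∃ u ∈ S, hashHit Q I r u) ⊆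
      S.biUnion fun u => (Finset.range (Q * Q)).filter fun r => hashHit Q I r u := fun r hr => by
    obtain ⟨h1, u, hu, h2⟩ := Finset.mem_filter.1 hr
    exact Finset.mem_biUnion.2 ⟨u, hu, Finset.mem_filter.2 ⟨h1, h2⟩⟩
  refine (Finset.card_le_card this).trans (Finset.card_biUnion_le.trans ?_)
  simp [card_hashHit Q I _ hI hQ]

open Classical in
/-- Many elements are hit with good probability, by the second moment method. -/
theorem hash_lower (Q I s : ℕ) (hQ : 0 < Q) (hI : I ≤ Q) (S : Finset ℕ) (hS : ∀ u ∈ S, u ≤ s) :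
    (S.card * (Q * I)) ^ 2 ≤
      ((Finset.range (Q * Q)).filter fun r => ∃ u ∈ S, hashHit Q I r u).card *
        (S.card * (Q * I) + S.card ^ 2 * (I * (I + s))) := by
  set R := Finset.range (Q * Q)
  set Z : ℕ → ℕ := fun r => ∑ u ∈ S, if hashHit Q I r u then 1 else 0 with hZ
  set A := R.filter fun r => ∃ u ∈ S, hashHit Q I r u with hA
  have hZ0 : ∀ r ∈ R, r ∉ A → Z r = 0 := fun r hr hrA => by
    refine Finset.sum_eq_zero fun u hu => if_neg fun h => hrA ?_
    exact Finset.mem_filter.2 ⟨hr, u, hu, h⟩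
  have hsum : ∑ r ∈ A, Z r = S.card * (Q * I) := by
    rw [Finset.sum_subset (Finset.filter_subset _ _) hZ0, hZ, Finset.sum_comm]
    simp only [← Finset.card_filter]
    rw [Finset.sum_congr rfl fun u _ => card_hashHit Q I u hI hQ]
    simp
  have hsq : ∑ r ∈ A, Z r ^ 2 ≤ S.card * (Q * I) + S.card ^ 2 * (I * (I + s)) := by
    refine (Finset.sum_le_sum_of_subset (Finset.filter_subset _ _)).trans ?_
    have e : ∀ r, Z r ^ 2 = ∑ u ∈ S, ∑ u' ∈ S,
        if hashHit Q I r u ∧ hashHit Q I r u' then 1 else 0 := fun r => by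
      rw [sq, hZ, Finset.sum_mul_sum]
      refine Finset.sum_congr rfl fun u _ => Finset.sum_congr rfl fun u' _ => ?_
      by_cases h : hashHit Q I r u <;> by_cases h' : hashHit Q I r u' <;> simp [h, h']
    rw [Finset.sum_congr rfl fun r _ => e r, Finset.sum_comm]
    -- The diagonal term counts the hits of `u` itself; all other terms are pair counts.
    have hu : ∀ u ∈ S, ∑ r ∈ R, ∑ u' ∈ S,
        (if hashHit Q I r u ∧ hashHit Q I r u' then 1 else 0) ≤
          Q * I + S.card * (I * (I + s)) := fun u hu => by
      rw [Finset.sum_comm, ← Finset.add_sum_erase S _ hu]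
      simp only [← Finset.card_filter]
      refine Nat.add_le_add ?_ ?_
      · simp only [and_self]
        exact (card_hashHit Q I u hI hQ).le
      · refine (Finset.sum_le_card_nsmul _ _ (I * (I + s)) fun u' hu' => ?_).trans ?_
        · exact card_hashHit_pair Q I u u' s hQ (Finset.ne_of_mem_erase hu').symm (hS u hu)
            (hS u' (Finset.mem_of_mem_erase hu'))
        · rw [smul_eq_mul]
          exact Nat.mul_le_mul_right _ (Finset.card_le_card (Finset.erase_subset _ _))
    refine (Finset.sum_le_card_nsmul _ _ _ hu).trans (le_of_eq ?_)
    rw [smul_eq_mul]; ring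
  -- Cauchy–Schwarz on `A`, the support of the number of hits `Z`.
  have h := sq_sum_le_card_mul_sum_sq (s := A) (f := Z)
  rw [hsum] at h
  exact h.trans (Nat.mul_le_mul_left _ hsq)

noncomputable section

/-! ## A rational upper approximation of `π` -/

/-- Numerator of an approximation of `π` by Wallis' product. -/
def piNum (k : ℕ) : ℕ := 2 * (2 * k + 2) * ∏ i ∈ Finset.range k, (2 * i + 2) * (2 * i + 2)

/-- Denominator of an approximation of `π` by Wallis' product. -/
def piDen (k : ℕ) : ℕ := (2 * k + 1) * ∏ i ∈ Finset.range k, (2 * i + 1) * (2 * i + 3)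

def piApprox (k : ℕ) : ℝ := piNum k / piDen k

/-- Twice Wallis' product lies between `π (2k + 1)/(2k + 2)` and `π`. The extra factor lifts it
above `π` and keeps the relative error of order `1 / k`. -/
theorem piApprox_eq (k : ℕ) : piApprox k = 2 * Real.Wallis.W k * ((2 * k + 2) / (2 * k + 1)) := by
  have h : Real.Wallis.W k = (∏ i ∈ Finset.range k, ((2 * (i : ℝ) + 2) * (2 * i + 2))) /
      ∏ i ∈ Finset.range k, ((2 * (i : ℝ) + 1) * (2 * i + 3)) := by
    rw [Real.Wallis.W, ← Finset.prod_div_distrib]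
    refine Finset.prod_congr rfl fun i _ => ?_
    rw [div_mul_div_comm]
  rw [h, piApprox, piNum, piDen]
  push_cast
  simp only [div_eq_mul_inv, mul_inv]
  ring

theorem pi_le_piApprox (k : ℕ) : Real.pi ≤ piApprox k := by
  have h := Real.Wallis.le_W k
  rw [piApprox_eq, ← mul_div_assoc, le_div_iff₀ (by positivity)]
  rw [div_mul_eq_mul_div, div_le_iff₀ (by positivity)] at h
  linarith

theorem piApprox_le (k : ℕ) : piApprox k ≤ Real.pi * ((2 * k + 2) / (2 * k + 1)) := by
  rw [piApprox_eq]
  refine mul_le_mul_of_nonneg_right ?_ (by positivity)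
  linarith [Real.Wallis.W_le k]

/-! ## Counting weighted lattice points -/

/-- The integer vector written in the first `n` digits of `f`. -/
def digitVec (n b f : ℕ) (k : Fin n) : ℤ := ((f / b ^ (k : ℕ) % b : ℕ) : ℤ) - (b / 2 : ℕ)

open Classical in
/-- The codes of pairs of a nonzero vector `z` and a number below the weight of `z`. -/
def weightedPoints (n b : ℕ) (wt : (Fin n → ℤ) → ℕ) : Finset ℕ :=
  (Finset.range (b ^ (n + 1))).filter fun f =>
    digitVec n b f ≠ 0 ∧ f / b ^ n % b < wt (digitVec n b f)

theorem digitVec_digit_inj {n b f f' : ℕ} (hf : f < b ^ (n + 1)) (hf' : f' < b ^ (n + 1))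
    (h : digitVec n b f = digitVec n b f') (h' : f / b ^ n % b = f' / b ^ n % b) : f = f' := by
  refine digits_ext hf hf' fun i hi => ?_
  rcases Nat.lt_succ_iff_lt_or_eq.1 hi with hi | rfl
  · have := congrFun h ⟨i, hi⟩
    simp only [digitVec, sub_left_inj] at this
    exact_mod_cast this
  · exact h'

/-- The codes of one vector differ only in the last digit, which lies below its weight. -/
theorem card_weightedPoints_le (n b : ℕ) (wt : (Fin n → ℤ) → ℕ) :
    ∃ F : Finset (Fin n → ℤ), 0 ∉ F ∧ (weightedPoints n b wt).card ≤ ∑ z ∈ F, wt z := by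
  classical
  refine ⟨(weightedPoints n b wt).image (digitVec n b), fun h => ?_, ?_⟩
  · obtain ⟨f, hf, h0⟩ := Finset.mem_image.1 h
    exact (Finset.mem_filter.1 hf).2.1 h0
  · rw [Finset.card_eq_sum_card_image (digitVec n b)]
    refine Finset.sum_le_sum fun z _ => ?_
    have : wt z = (Finset.range (wt z)).card := by simp
    rw [this]
    refine Finset.card_le_card_of_injOn (fun f => f / b ^ n % b) ?_ ?_
    · intro f hf
      obtain ⟨h1, h2⟩ := Finset.mem_filter.1 hf
      have := (Finset.mem_filter.1 h1).2.2
      rw [h2] at this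
      exact Finset.mem_coe.2 (Finset.mem_range.2 this)
    · intro f hf f' hf' h
      obtain ⟨h1, h2⟩ := Finset.mem_filter.1 hf
      obtain ⟨h1', h2'⟩ := Finset.mem_filter.1 hf'
      exact digitVec_digit_inj (Finset.mem_range.1 (Finset.mem_filter.1 h1).1)
        (Finset.mem_range.1 (Finset.mem_filter.1 h1').1) (h2.trans h2'.symm) h

/-- The last digit is also below `b`, hence the cap on the contribution of each vector. -/
theorem le_card_weightedPoints (n b : ℕ) (wt : (Fin n → ℤ) → ℕ) (G : Finset (Fin n → ℤ))
    (h0 : 0 ∉ G) (hG : ∀ z ∈ G, ∀ k, |z k| < (b / 2 : ℕ)) :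
    ∑ z ∈ G, min b (wt z) ≤ (weightedPoints n b wt).card := by
  classical
  have hex : ∀ (z : Fin n → ℤ) (j : ℕ), z ∈ G → j < b → ∃ f < b ^ (n + 1),
      digitVec n b f = z ∧ f / b ^ n % b = j := fun z j hz hj => by
    obtain ⟨f, hf, hd⟩ := digits_exists (b := b) (n + 1)
      (fun i => if h : i < n then (z ⟨i, h⟩ + (b / 2 : ℕ)).toNat else j) fun i _ => by
        split_ifs with h
        · have := abs_lt.1 (hG z hz ⟨i, h⟩)
          omega
        · exact hj
    refine ⟨f, hf, ?_, ?_⟩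
    · funext k
      rw [digitVec, hd k (by omega), dif_pos k.2]
      have := abs_lt.1 (hG z hz k)
      simp only [Fin.eta]
      omega
    · rw [hd n (by omega), dif_neg (by omega)]
  have hmem : ∀ s ∈ G.sigma fun z => Finset.range (min b (wt z)), s.1 ∈ G ∧ s.2 < b ∧
      s.2 < wt s.1 := fun s hs => by
    obtain ⟨h1, h2⟩ := Finset.mem_sigma.1 hs
    exact ⟨h1, lt_min_iff.1 (Finset.mem_range.1 h2)⟩
  choose! φ hφ using fun (s : (_ : Fin n → ℤ) × ℕ) (hs : s ∈ G.sigma fun z =>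
    Finset.range (min b (wt z))) => hex s.1 s.2 (hmem s hs).1 (hmem s hs).2.1
  have hc : ∑ z ∈ G, min b (wt z) = (G.sigma fun z => Finset.range (min b (wt z))).card := by simp
  rw [hc]
  refine Finset.card_le_card_of_injOn φ ?_ ?_
  · intro s hs
    obtain ⟨h1, h2, h3⟩ := hφ s hs
    refine Finset.mem_coe.2 (Finset.mem_filter.2 ⟨Finset.mem_range.2 h1, ?_, ?_⟩)
    · rw [h2]; exact fun h => h0 (h ▸ (hmem s hs).1)
    · rw [h2, h3]; exact (hmem s hs).2.2
  · intro s hs s' hs' h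
    obtain ⟨-, h2, h3⟩ := hφ s hs
    obtain ⟨-, h2', h3'⟩ := hφ s' hs'
    rw [h] at h2 h3
    exact Sigma.ext (h2.symm.trans h2') (heq_of_eq (h3.symm.trans h3'))

/-! ## Explicit bounds in terms of the length of the instance -/

section
variable {n : ℕ} {B : Matrix (Fin n) (Fin n) ℚ}

theorem commonDen_le_two_pow (B : Matrix (Fin n) (Fin n) ℚ) :
    commonDen B ≤ 2 ^ (((encodeMatrix B).length + 1) * (encodeMatrix B).length) := by
  refine (commonDen_le B fun e he => (den_lt B he).le).trans ?_
  rw [← pow_mul]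
  exact Nat.pow_le_pow_right two_pos (Nat.mul_le_mul_left _ (sq_dim_le_length B))

theorem scaledEntry_natAbs_le (B : Matrix (Fin n) (Fin n) ℚ) {e : ℕ} (he : e < n * n) :
    (scaledEntry B e).natAbs ≤ 2 ^ ((encodeMatrix B).length + 1) ^ 2 := by
  rw [scaledEntry, Int.natAbs_mul, Int.natAbs_natCast]
  refine (Nat.mul_le_mul (num_lt B he).le ((Nat.div_le_self _ _).trans
    (commonDen_le_two_pow B))).trans ?_
  rw [← pow_add]
  exact Nat.pow_le_pow_right two_pos (by ring_nf; omega)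

theorem exists_dualCert_le (hB : B.det ≠ 0) : ∃ (E : ℕ → ℤ) (d : ℕ), IsDualCert B E d ∧
    d ≤ 2 ^ ((encodeMatrix B).length + 1) ^ 3 ∧
    ∀ e, (E e).natAbs ≤ 2 ^ ((encodeMatrix B).length + 1) ^ 3 := by
  obtain ⟨E, d, h, h1, h2⟩ := exists_dualCert hB (fun e he => scaledEntry_natAbs_le B he)
    Nat.one_le_two_pow
  set l := (encodeMatrix B).length
  have key : n.factorial * (2 ^ (l + 1) ^ 2) ^ n ≤ 2 ^ (l + 1) ^ 3 := by
    have h3 : n.factorial ≤ 2 ^ l := by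
      refine (Nat.factorial_le_pow n).trans ?_
      refine (Nat.pow_le_pow_left (Nat.lt_two_pow_self (n := n)).le n).trans ?_
      rw [← pow_mul]
      exact Nat.pow_le_pow_right two_pos (sq_dim_le_length B)
    have h4 : (2 ^ (l + 1) ^ 2) ^ n ≤ 2 ^ ((l + 1) ^ 2 * l) := by
      rw [← pow_mul]
      exact Nat.pow_le_pow_right two_pos (Nat.mul_le_mul_left _ (dim_le_length B))
    refine (Nat.mul_le_mul h3 h4).trans ?_
    rw [← pow_add]
    exact Nat.pow_le_pow_right two_pos (by ring_nf; omega)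
  exact ⟨E, d, h, h1.trans key, fun e => (h2 e).trans key⟩

theorem abs_entry_le (B : Matrix (Fin n) (Fin n) ℚ) (i j : Fin n) :
    |(B i j : ℝ)| ≤ 2 ^ ((encodeMatrix B).length + 1) := by
  have h1 := num_lt B (index_lt i j)
  rw [rowMajor_apply] at h1
  have h2 : |B i j| ≤ ((B i j).num.natAbs : ℚ) := by
    have h3 : |B i j| = ((B i j).num.natAbs : ℚ) / (B i j).den := by
      conv_lhs => rw [← Rat.num_div_den (B i j)]
      rw [abs_div, Nat.abs_cast, Nat.cast_natAbs, Int.cast_abs]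
    rw [h3]
    exact div_le_self (Nat.cast_nonneg _) (by exact_mod_cast (B i j).den_pos)
  have h4 : |B i j| ≤ ((2 ^ ((encodeMatrix B).length + 1) : ℕ) : ℚ) :=
    h2.trans (by exact_mod_cast h1.le)
  exact_mod_cast h4

/-- Short dual vectors have small coordinates. -/
theorem abs_coord_lt (hB : B.det ≠ 0) {M h : ℕ} {z : Fin n → ℤ}
    (hz : ‖dualVec B z‖ ≤ commonDen B + M)
    (hh : M + 4 * ((encodeMatrix B).length + 1) ^ 3 + 4 ≤ h) (k : Fin n) :
    |z k| < ((2 ^ h / 2 : ℕ) : ℤ) := by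
  set l := (encodeMatrix B).length with hl
  have h1 := abs_coord_le hB (abs_entry_le B) z k
  rw [← hl] at h1
  have hn : (n : ℝ) ≤ 2 ^ l := by
    have : n ≤ 2 ^ l := (dim_le_length B).trans Nat.lt_two_pow_self.le
    exact_mod_cast this
  have hw : ‖dualVec B z‖ ≤ 2 ^ ((l + 1) * l + M + 1) := by
    refine hz.trans ?_
    have h2 : (commonDen B : ℝ) ≤ 2 ^ ((l + 1) * l) := by exact_mod_cast commonDen_le_two_pow B
    have h3 : (M : ℝ) ≤ 2 ^ M := by exact_mod_cast (Nat.lt_two_pow_self (n := M)).le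
    have h4 : (2 : ℝ) ^ ((l + 1) * l) ≤ 2 ^ ((l + 1) * l + M) :=
      pow_le_pow_right₀ one_le_two (by omega)
    have h5 : (2 : ℝ) ^ M ≤ 2 ^ ((l + 1) * l + M) := pow_le_pow_right₀ one_le_two (by omega)
    rw [pow_succ]; linarith
  have h2 : |(z k : ℝ)| ≤ 2 ^ l * (2 ^ (l + 1) * 2 ^ ((l + 1) * l + M + 1)) :=
    h1.trans (mul_le_mul hn (mul_le_mul_of_nonneg_left hw (by positivity)) (by positivity)
      (by positivity))
  rw [← pow_add, ← pow_add] at h2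
  have h3 : (2 : ℝ) ^ (l + (l + 1 + ((l + 1) * l + M + 1))) < 2 ^ (h - 1) :=
    pow_lt_pow_right₀ one_lt_two (by
      have : 4 * (l + 1) ^ 3 = 4 * l ^ 3 + 12 * l ^ 2 + 12 * l + 4 := by ring
      have h6 : (l + 1) * l = l ^ 2 + l := by ring
      omega)
  have h4 : 2 ^ h / 2 = 2 ^ (h - 1) := by
    obtain ⟨h', rfl⟩ : ∃ h', h = h' + 1 := ⟨h - 1, by omega⟩
    rw [pow_succ]; simp
  rw [h4]
  have h5 := h2.trans_lt h3
  exact_mod_cast h5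

/-! ## Completeness and soundness of the count -/

/-- The weight of a dual vector. -/
def latticeWeight (B : Matrix (Fin n) (Fin n) ℚ) (a M D : ℕ) (τ : ℤ) (z : Fin n → ℤ) : ℕ :=
  powWeight M D τ (piApprox a * ‖dualVec B z‖ ^ 2)

/-- The soundness bound: if the mass is at most `exp (-T)`, the normalisation `exp T` in the weights
cancels it, and only the rounding term `1 / D` remains. The overestimate of `π` only decreases
weights. -/
theorem card_points_le {a M D b : ℕ} (hM : 0 < M) (hD : 0 < D) {τ : ℤ} {T : ℝ}
    (hτ : |(τ : ℝ) - D * T| ≤ 1)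
    (hsmall : ∀ F : Finset (Fin n → ℤ), 0 ∉ F →
      ∑ z ∈ F, Real.exp (-(Real.pi * ‖dualVec B z‖ ^ 2)) ≤ Real.exp (-T)) :
    ((weightedPoints n b (latticeWeight B a M D τ)).card : ℝ) ≤
      ((M : ℝ) * D) ^ M * Real.exp (1 / D) := by
  obtain ⟨F, h0, hF⟩ := card_weightedPoints_le n b (latticeWeight B a M D τ)
  calc ((weightedPoints n b (latticeWeight B a M D τ)).card : ℝ)
      ≤ ∑ z ∈ F, (latticeWeight B a M D τ z : ℝ) := by exact_mod_cast hF
    _ ≤ ∑ z ∈ F, ((M : ℝ) * D) ^ M * Real.exp (T + 1 / D) *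
          Real.exp (-(Real.pi * ‖dualVec B z‖ ^ 2)) := by
        refine Finset.sum_le_sum fun z _ => (powWeight_le hM hD hτ).trans ?_
        rw [mul_assoc, ← Real.exp_add]
        refine mul_le_mul_of_nonneg_left (Real.exp_le_exp.2 ?_) (by positivity)
        have := mul_le_mul_of_nonneg_right (pi_le_piApprox a) (sq_nonneg ‖dualVec B z‖)
        linarith
    _ ≤ ((M : ℝ) * D) ^ M * Real.exp (T + 1 / D) * Real.exp (-T) := by
        rw [← Finset.mul_sum]
        exact mul_le_mul_of_nonneg_left (hsmall F h0) (by positivity)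
    _ = _ := by rw [mul_assoc, ← Real.exp_add]; ring_nf

/-- The a priori bound needed in `sum_exp_dichotomy`: even with the decay slowed down by `2 a`, the
mass is exponential in a polynomial of the length only. -/
theorem sum_exp_le_exp (hB : B.det ≠ 0) {a P : ℕ} (ha : 0 < a)
    (hP : (encodeMatrix B).length * (3 + a + 2 * ((encodeMatrix B).length + 1) ^ 3) ≤ P)
    (F : Finset (Fin n → ℤ)) :
    ∑ z ∈ F, Real.exp (-(1 / (2 * a) * (piApprox a * ‖dualVec B z‖ ^ 2))) ≤ Real.exp P := by
  obtain ⟨E, d, hc, hd, -⟩ := exists_dualCert_le hB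
  set l := (encodeMatrix B).length
  have ha' : (0 : ℝ) < a := by exact_mod_cast ha
  have hpi : 2 ≤ piApprox a := Real.two_le_pi.trans (pi_le_piApprox a)
  have hpi0 : 0 < piApprox a := by linarith
  have h1 := hc.sum_exp_le hB (κ := piApprox a / (2 * a)) (by positivity) F
  have e : ∀ z : Fin n → ℤ, 1 / (2 * (a : ℝ)) * (piApprox a * ‖dualVec B z‖ ^ 2) =
      piApprox a / (2 * a) * ‖dualVec B z‖ ^ 2 := fun z => by ring
  simp only [e]
  refine h1.trans ?_
  have h2 : 2 * (1 + (d : ℝ) ^ 2 / (piApprox a / (2 * a))) ≤ Real.exp (3 + a + 2 * (l + 1) ^ 3 : ℕ) := by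
    have h3 : (d : ℝ) ^ 2 / (piApprox a / (2 * a)) ≤ a * (d : ℝ) ^ 2 := by
      rw [div_div_eq_mul_div, div_le_iff₀ hpi0]
      have : 0 ≤ a * (d : ℝ) ^ 2 := by positivity
      nlinarith
    have hd1 : (1 : ℝ) ≤ d := by exact_mod_cast hc.1
    have ha1 : (1 : ℝ) ≤ a := by exact_mod_cast ha
    have h4 : (1 : ℝ) ≤ a * (d : ℝ) ^ 2 := by nlinarith
    have h5 : (a : ℝ) * (d : ℝ) ^ 2 ≤ 2 ^ a * (2 ^ (l + 1) ^ 3) ^ 2 := by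
      refine mul_le_mul (by exact_mod_cast (Nat.lt_two_pow_self (n := a)).le) ?_ (by positivity)
        (by positivity)
      exact pow_le_pow_left₀ (by positivity) (by exact_mod_cast hd) 2
    have h6 : (2 : ℝ) ^ (2 + a + 2 * (l + 1) ^ 3) = 4 * (2 ^ a * (2 ^ (l + 1) ^ 3) ^ 2) := by
      rw [pow_add, pow_add, ← pow_mul, mul_comm ((l + 1) ^ 3)]; norm_num; ring
    have h7 : (2 : ℝ) ^ (2 + a + 2 * (l + 1) ^ 3) ≤ Real.exp (3 + a + 2 * (l + 1) ^ 3 : ℕ) := by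
      refine (pow_le_pow_right₀ one_le_two (show 2 + a + 2 * (l + 1) ^ 3 ≤
        3 + a + 2 * (l + 1) ^ 3 by omega)).trans ?_
      rw [← Real.exp_one_pow]
      exact pow_le_pow_left₀ zero_le_two (by linarith [Real.add_one_le_exp 1]) _
    linarith
  calc (2 * (1 + (d : ℝ) ^ 2 / (piApprox a / (2 * a)))) ^ n
      ≤ Real.exp (3 + a + 2 * (l + 1) ^ 3 : ℕ) ^ n := pow_le_pow_left₀ (by positivity) h2 n
    _ ≤ Real.exp P := by
        rw [← Real.exp_nat_mul, Real.exp_le_exp]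
        have : n * (3 + a + 2 * (l + 1) ^ 3) ≤ P :=
          (Nat.mul_le_mul_right _ (dim_le_length B)).trans hP
        exact_mod_cast this

/-- The completeness bound. In one case of `sum_exp_dichotomy` a single heavy point is enough; in
the other the powers of the near points follow the Gaussian closely enough to be summed. -/
theorem le_card_points (hB : B.det ≠ 0) (hn : 0 < n) {a M P h : ℕ} (ha : 0 < a)
    (hP : (encodeMatrix B).length * (3 + a + 2 * ((encodeMatrix B).length + 1) ^ 3) ≤ P)
    (hM : 64 * a * (a * (2 * P + 6) + 1) ^ 2 + 8 * a * (P + a * (2 * P + 6) + 16 * a) ≤ M)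
    (hh : M * M * (32 * a) + M + 4 * ((encodeMatrix B).length + 1) ^ 3 + 4 ≤ h)
    {τ : ℤ} {T : ℝ} (hτ : |(τ : ℝ) - (32 * a : ℕ) * T| ≤ 1) (F : Finset (Fin n → ℤ)) (h0 : 0 ∉ F)
    (hlarge : Real.exp (-T + 1 / (2 * a)) <
      ∑ z ∈ F, Real.exp (-(Real.pi * (1 + 1 / (a : ℝ)) ^ 2 * ‖dualVec B z‖ ^ 2))) :
    ((M : ℝ) * (32 * a : ℕ)) ^ M * Real.exp (1 / (4 * a)) ≤
      (weightedPoints n (2 ^ h) (latticeWeight B a M (32 * a) τ)).card := by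
  classical
  have ha1 : (1 : ℝ) ≤ a := by exact_mod_cast ha
  have ha0 : (0 : ℝ) < a := by linarith
  have hpi : 2 ≤ piApprox a := Real.two_le_pi.trans (pi_le_piApprox a)
  have hM1 : 1 ≤ M := by
    refine le_trans ?_ hM
    have : 0 < 64 * a * (a * (2 * P + 6) + 1) ^ 2 := by positivity
    omega
  have hM0 : (0 : ℝ) < M := by exact_mod_cast hM1
  set D : ℕ := 32 * a with hD
  have hD0 : 0 < D := by omega
  have hDr : (2 : ℝ) / D = 1 / (16 * a) := by rw [hD]; push_cast; field_simp; norm_num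
  have e16 : 1 / (16 * (a : ℝ)) ≤ 1 := by rw [div_le_one (by positivity)]; linarith
  set y : (Fin n → ℤ) → ℝ := fun z => piApprox a * ‖dualVec B z‖ ^ 2 with hy
  have hy0 : ∀ z, 0 ≤ y z := fun z => by positivity
  -- The digits are wide enough that capping at `2 ^ h` never loses a weight up to `2 (M D) ^ M`.
  have hcap : 2 * ((M : ℝ) * D) ^ M ≤ ((2 ^ h : ℕ) : ℝ) := by
    have h1 : 2 * (M * D) ^ M ≤ 2 ^ h := by
      have h2 : (M * D) ^ M ≤ (2 ^ (M * D)) ^ M :=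
        Nat.pow_le_pow_left Nat.lt_two_pow_self.le M
      rw [← pow_mul] at h2
      calc 2 * (M * D) ^ M ≤ 2 ^ (M * D * M + 1) := by rw [pow_succ]; omega
        _ ≤ 2 ^ h := Nat.pow_le_pow_right two_pos (by
            have : M * D * M = M * M * D := by ring
            omega)
    exact_mod_cast h1
  have hexp : Real.exp (1 / (4 * (a : ℝ))) ≤ 2 := by
    have h1 : 1 / (4 * (a : ℝ)) ≤ 1 / 2 := one_div_le_one_div_of_le (by norm_num) (by linarith)
    refine (Real.exp_le_exp.2 h1).trans ?_
    have h2 : Real.exp (1 / 2) ^ 2 = Real.exp 1 := by rw [← Real.exp_nat_mul]; norm_num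
    nlinarith [Real.exp_one_lt_d9, Real.exp_pos (1 / 2)]
  have hMD : 0 < ((M : ℝ) * D) ^ M := by positivity
  -- One heavy point suffices.
  have heavy : ∀ z : Fin n → ℤ, z ≠ 0 → ‖dualVec B z‖ ≤ commonDen B + M →
      2 * ((M : ℝ) * D) ^ M ≤ latticeWeight B a M D τ z →
      ((M : ℝ) * D) ^ M * Real.exp (1 / (4 * a)) ≤
        (weightedPoints n (2 ^ h) (latticeWeight B a M D τ)).card := fun z hz hzn hw => by
    have h1 := le_card_weightedPoints n (2 ^ h) (latticeWeight B a M D τ) {z}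
      (fun h => hz (Finset.mem_singleton.1 h).symm)
      (fun z' hz' => by rw [Finset.mem_singleton.1 hz']; exact abs_coord_lt hB hzn (by omega))
    rw [Finset.sum_singleton] at h1
    have h2 : 2 * ((M : ℝ) * D) ^ M ≤ ((min (2 ^ h) (latticeWeight B a M D τ z) : ℕ) : ℝ) := by
      rw [Nat.cast_min]; exact le_min hcap hw
    have h3 : ((min (2 ^ h) (latticeWeight B a M D τ z) : ℕ) : ℝ) ≤
      (weightedPoints n (2 ^ h) (latticeWeight B a M D τ)).card := by exact_mod_cast h1
    nlinarith
  -- One of the two factors `1 + 1/a` is spent on replacing `π` by its upper approximation.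
  have hlarge' : Real.exp (-T + 1 / (2 * a)) <
      ∑ z ∈ F, Real.exp (-((1 + 1 / (a : ℝ)) * y z)) := by
    refine hlarge.trans_le (Finset.sum_le_sum fun z _ => Real.exp_le_exp.2 (neg_le_neg ?_))
    have h1 : piApprox a ≤ Real.pi * (1 + 1 / a) := by
      refine (piApprox_le a).trans (mul_le_mul_of_nonneg_left ?_ Real.pi_pos.le)
      rw [div_le_iff₀ (by positivity)]
      have : (1 + 1 / (a : ℝ)) * (2 * a + 1) = 2 * a + 1 + (2 + 1 / a) := by field_simp
      rw [this]
      have : 0 < 1 / (a : ℝ) := by positivity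
      linarith
    have h2 := mul_le_mul_of_nonneg_right h1 (show 0 ≤ (1 + 1 / (a : ℝ)) * ‖dualVec B z‖ ^ 2 by
      positivity)
    simp only [hy]
    nlinarith
  have hsum : ∀ G ⊆ F, ∑ z ∈ G, Real.exp (-(1 / (2 * (a : ℝ)) * y z)) ≤ Real.exp (P : ℝ) :=
    fun G _ => sum_exp_le_exp hB ha hP G
  have hM' : 64 * (a : ℝ) * (a * (2 * P + 6) + 1) ^ 2 +
      8 * a * (P + a * (2 * P + 6) + 16 * a) ≤ M := by exact_mod_cast hM
  have hnorm : ∀ z, y z ≤ M → ‖dualVec B z‖ ≤ commonDen B + M := fun z hz => by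
    have h1 : ‖dualVec B z‖ ^ 2 ≤ M := by
      simp only [hy] at hz
      nlinarith [sq_nonneg ‖dualVec B z‖]
    have h2 : ‖dualVec B z‖ ≤ M := by
      by_contra hlt
      push Not at hlt
      have : (1 : ℝ) ≤ M := by exact_mod_cast hM1
      nlinarith
    have h3 : (0 : ℝ) ≤ commonDen B := Nat.cast_nonneg _
    linarith
  rcases sum_exp_dichotomy F y hy0 ha1 (Nat.cast_nonneg P) hsum hM' hlarge' with
    ⟨z₀, hz₀, hyz₀⟩ | ⟨hbig, hge⟩
  -- The point found may be given instead by a shorter one: the known dual vector of norm `commonDen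
  -- B` takes its place if `z₀` is longer, so that the coordinates fit into digits.
  · obtain ⟨z, hz, hzn, hyz⟩ : ∃ z : Fin n → ℤ, z ≠ 0 ∧ ‖dualVec B z‖ ≤ commonDen B + M ∧
        y z ≤ T - 2 := by
      obtain ⟨z₁, hz₁, hn₁⟩ := exists_dualVec_norm_le hB hn
      rcases le_total ‖dualVec B z₀‖ ‖dualVec B z₁‖ with hle | hle
      · exact ⟨z₀, fun h => h0 (h ▸ hz₀), by rw [hn₁] at hle; linarith, hyz₀⟩
      · refine ⟨z₁, hz₁, by rw [hn₁]; linarith, le_trans ?_ hyz₀⟩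
        exact mul_le_mul_of_nonneg_left (pow_le_pow_left₀ (norm_nonneg _) hle 2) (by linarith)
    refine heavy z hz hzn ?_
    have h1 : 1 / (M : ℝ) ≤ (T - 2 / D - y z) / M := by
      refine div_le_div_of_nonneg_right ?_ hM0.le
      rw [hDr]; linarith
    have h2 : 0 < 1 / (M : ℝ) := by positivity
    refine le_trans ?_ (le_powWeight hM1 hD0 (hy0 z) hτ (by linarith))
    -- Bernoulli's inequality; `y z ≤ T - 2` leaves a margin of at least `1` after rounding.
    have h3 : (2 : ℝ) ≤ (1 + (T - 2 / D - y z) / M) ^ M := by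
      have h4 := one_add_mul_le_pow (a := (T - 2 / D - y z) / M) (by linarith) M
      have h5 : 1 ≤ (M : ℝ) * ((T - 2 / D - y z) / M) := by
        have := mul_le_mul_of_nonneg_left h1 hM0.le
        rwa [mul_one_div_cancel hM0.ne'] at this
      linarith
    nlinarith
  · set G := F.filter fun z => y z ≤ M / (8 * a) with hG
    have hGM : ∀ z ∈ G, y z ≤ M := fun z hz => (Finset.mem_filter.1 hz).2.trans
      (div_le_self hM0.le (by linarith))
    have hGF : ∀ z ∈ G, z ≠ 0 := fun z hz h => h0 (h ▸ (Finset.mem_filter.1 hz).1)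
    -- Either one capped weight is already enough, or no weight reaches the cap and the sum is
    -- unaffected by it.
    by_cases hex : ∃ z ∈ G, 2 * ((M : ℝ) * D) ^ M ≤ latticeWeight B a M D τ z
    · obtain ⟨z, hz, hw⟩ := hex
      exact heavy z (hGF z hz) (hnorm z (hGM z hz)) hw
    · push Not at hex
      have h1 := le_card_weightedPoints n (2 ^ h) (latticeWeight B a M D τ) G
        (fun h => hGF 0 h rfl)
        (fun z hz => abs_coord_lt hB (hnorm z (hGM z hz)) (by omega))
      have h2 : ∑ z ∈ G, (latticeWeight B a M D τ z : ℝ) ≤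
          (weightedPoints n (2 ^ h) (latticeWeight B a M D τ)).card := by
        refine le_trans (le_of_eq ?_) (show
          ((∑ z ∈ G, min (2 ^ h) (latticeWeight B a M D τ z) : ℕ) : ℝ) ≤ _ by exact_mod_cast h1)
        push_cast
        refine Finset.sum_congr rfl fun z hz => (min_eq_right ?_).symm
        have := (hex z hz).le.trans hcap
        exact_mod_cast this
      refine le_trans ?_ h2
      refine (mul_le_mul_of_nonneg_left hbig hMD.le).trans ?_
      rw [Finset.mul_sum]
      refine Finset.sum_le_sum fun z hz => ?_
      have h3 := hge z hz
      rw [← hDr] at h3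
      refine le_trans ?_ (le_powWeight hM1 hD0 (hy0 z) hτ (by linarith))
      refine mul_le_mul_of_nonneg_left (le_trans (Real.exp_le_exp.2 (le_of_eq ?_))
        (exp_le_one_add_pow h3 M)) hMD.le
      rw [hDr]
      field_simp
end
end

/-! ## The verifier -/

/-- Digit `i` of `m` in base `b`. -/
abbrev digit (b m i : ℕ) : ℕ := m / b ^ i % b

/-- The digits of `m` spell out the instance `X`: for every entry its numerator, denominator and
sign, and the code of the rest of the instance. -/
def ParseOK (X n b m : ℕ) : Prop :=
  X = natCode n (digit b m 4) ∧ ∀ e < n * n, digit b m (5 * e + 4) =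
    digit b m (5 * e + 3) % 2 + 2 * natCode (digit b m (5 * e + 1))
      (natCode (digit b m (5 * e + 2)) (digit b m (5 * (e + 1) + 4)))

def hintDen (n b m : ℕ) : ℕ := ∏ e ∈ Finset.range (n * n), digit b m (5 * e + 2)

def hintEntry (n b m e : ℕ) : ℤ :=
  (1 - 2 * ((digit b m (5 * e + 3) % 2 : ℕ) : ℤ)) * (digit b m (5 * e + 1) : ℕ) *
    (hintDen n b m / digit b m (5 * e + 2) : ℕ)

/-- Digits are natural numbers; the offset `b / 2` lets them represent signed integers. -/
def hintCoef (b m e : ℕ) : ℤ := (digit b m (5 * e + 5) : ℕ) - (b / 2 : ℕ)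

def hintScale (n b m : ℕ) : ℕ := digit b m (5 * (n * n) + 1)

/-- The digits of `m` spell out an inverse of the matrix. -/
def CertOK (n b m : ℕ) : Prop :=
  0 < hintScale n b m ∧ ∀ j < n, ∀ k < n,
    ∑ i ∈ Finset.range n, hintEntry n b m (i * n + j) * hintCoef b m (i * n + k) =
      if j = k then (hintScale n b m : ℤ) else 0

def hintNorm (n b m f : ℕ) : ℤ :=
  certNorm n (hintCoef b m) fun k => (digit b f k : ℕ) - (b / 2 : ℕ)

def hintWeight (a M D : ℕ) (τ : ℤ) (n b m f : ℕ) : ℕ :=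
  ((M * D : ℕ) + τ - (D * (piNum a * hintDen n b m ^ 2 * (hintNorm n b m f).toNat) /
    (piDen a * hintScale n b m ^ 2) + 1 : ℕ)).toNat ^ M

def PointOK (a M D : ℕ) (τ : ℤ) (n b m f : ℕ) : Prop :=
  (¬ ∀ k < n, digit b f k = b / 2) ∧ digit b f n < hintWeight a M D τ n b m f

/-! ### The checks take polynomial time -/

section
variable {Ω : Type} [Enc Ω]

theorem PT.polyEval {f : Ω → ℕ} (hf : PT f) (P : Polynomial ℕ) : PT fun ω => P.eval (f ω) := by
  induction P using Polynomial.induction_on' with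
  | add P R hP hR => exact (hP.add hR).congr fun ω => by simp
  | monomial k a =>
    exact ((PT.const a).mul (hf.pow (.const k) (.const k))).congr fun ω => by simp

/-- Polynomial time functions with polynomially bounded values. -/
def PTU (f : Ω → ℕ) : Prop := PT f ∧ PolyBdd f

namespace PTU

theorem const (k : ℕ) : PTU fun _ : Ω => k := ⟨.const k, .const k⟩

theorem index : PTU fun p : ℕ × Ω => p.1 := ⟨.index, .index⟩

theorem weaken {f : Ω → ℕ} (hf : PTU f) : PTU fun p : ℕ × Ω => f p.2 :=
  ⟨hf.1.weaken, hf.2.weaken⟩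

theorem add {f g : Ω → ℕ} (hf : PTU f) (hg : PTU g) : PTU fun ω => f ω + g ω :=
  ⟨hf.1.add hg.1, hf.2.add hg.2⟩

theorem mul {f g : Ω → ℕ} (hf : PTU f) (hg : PTU g) : PTU fun ω => f ω * g ω :=
  ⟨hf.1.mul hg.1, hf.2.mul hg.2⟩

theorem size {f : Ω → ℕ} (hf : PT f) : PTU fun ω => Nat.size (f ω) := ⟨hf.size, hf.1⟩

theorem polyEval {f : Ω → ℕ} (hf : PTU f) (P : Polynomial ℕ) : PTU fun ω => P.eval (f ω) :=
  ⟨hf.1.polyEval P, hf.2.polyEval P⟩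

end PTU

theorem PT.digit {b m i : Ω → ℕ} (hb : PT b) (hm : PT m) (hi : PTU i) :
    PT fun ω => LatticeAM.digit (b ω) (m ω) (i ω) :=
  (hm.div (hb.pow hi.1 hi.2)).mod hb

theorem PTZ.weaken {f : Ω → ℤ} : PTZ f → PTZ fun p : ℕ × Ω => f p.2 := by
  rintro ⟨p, q, hp, hq, h⟩
  exact ⟨_, _, hp.weaken, hq.weaken, fun ω => h ω.2⟩

theorem PT.natCode {k Y : Ω → ℕ} (hk : PT k) (hY : PT Y) : PT fun ω => natCode (k ω) (Y ω) := by
  have hs := PTU.size hk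
  have h1 : PT fun p : ℕ × Ω => (1 + 2 * (k p.2 / 2 ^ p.1 % 2)) * 4 ^ p.1 :=
    ((PT.const 1).add ((PT.const 2).mul ((hk.weaken.div
      ((PT.const 2).pow .index .index)).mod (.const 2)))).mul ((PT.const 4).pow .index .index)
  have h2 := ((PTU.const 2).mul hs).add (PTU.const 1)
  exact ((h1.sum hs.1 hs.2).add (((PT.const 2).pow h2.1 h2.2).mul hY)).congr fun _ => rfl

section
variable {X n b m f a M D : Ω → ℕ} {τ : Ω → ℤ}

theorem PTU.affine {i : Ω → ℕ} (hi : PTU i) (k : ℕ) : PTU fun ω => 5 * i ω + k :=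
  ((PTU.const 5).mul hi).add (.const k)

theorem PTP.parseOK (hX : PT X) (hn : PTU n) (hb : PT b) (hm : PT m) :
    PTP fun ω => ParseOK (X ω) (n ω) (b ω) (m ω) := by
  have hd : ∀ k, PT fun p : ℕ × Ω => digit (b p.2) (m p.2) (5 * p.1 + k) := fun k =>
    hb.weaken.digit hm.weaken (PTU.index.affine k)
  have hd' : PT fun p : ℕ × Ω => digit (b p.2) (m p.2) (5 * (p.1 + 1) + 4) :=
    hb.weaken.digit hm.weaken ((PTU.index.add (.const 1)).affine 4)
  refine (PTP.eq hX (PT.natCode hn.1 (hb.digit hm (.const 4)))).and ?_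
  exact PTP.forall_lt (P := fun p : ℕ × Ω => digit (b p.2) (m p.2) (5 * p.1 + 4) = _)
    (hn.mul hn).1 (hn.mul hn).2 (PTP.eq (hd 4) (((hd 3).mod (.const 2)).add
      ((PT.const 2).mul ((hd 1).natCode ((hd 2).natCode hd')))))

theorem PT.hintDen (hn : PTU n) (hb : PT b) (hm : PT m) :
    PT fun ω => hintDen (n ω) (b ω) (m ω) :=
  PT.prod (f := fun p : ℕ × Ω => LatticeAM.digit (b p.2) (m p.2) (5 * p.1 + 2))
    (hb.weaken.digit hm.weaken (PTU.index.affine 2)) (hn.mul hn).1 (hn.mul hn).2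

theorem PTZ.hintEntry {e : Ω → ℕ} (hn : PTU n) (hb : PT b) (hm : PT m) (he : PTU e) :
    PTZ fun ω => hintEntry (n ω) (b ω) (m ω) (e ω) := by
  have hd : ∀ k, PT fun ω => digit (b ω) (m ω) (5 * e ω + k) := fun k =>
    hb.digit hm (he.affine k)
  exact (((PTZ.ofNat (.const 1)).sub ((PTZ.ofNat (.const 2)).mul
    (.ofNat ((hd 3).mod (.const 2))))).mul (.ofNat (hd 1))).mul
      (.ofNat ((PT.hintDen hn hb hm).div (hd 2)))

theorem PTZ.hintCoef {e : Ω → ℕ} (hb : PT b) (hm : PT m) (he : PTU e) :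
    PTZ fun ω => hintCoef (b ω) (m ω) (e ω) :=
  (PTZ.ofNat (hb.digit hm (he.affine 5))).sub (.ofNat (hb.div (.const 2)))

theorem PT.hintScale (hn : PTU n) (hb : PT b) (hm : PT m) :
    PT fun ω => hintScale (n ω) (b ω) (m ω) := hb.digit hm ((hn.mul hn).affine 1)

theorem PTP.certOK (hn : PTU n) (hb : PT b) (hm : PT m) :
    PTP fun ω => CertOK (n ω) (b ω) (m ω) := by
  have hs := PT.hintScale hn hb hm
  have hn3 := hn.weaken.weaken.weaken
  have hb3 := hb.weaken.weaken.weaken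
  have hm3 := hm.weaken.weaken.weaken
  have h1 : PTZ fun p : ℕ × ℕ × ℕ × Ω =>
      LatticeAM.hintEntry (n p.2.2.2) (b p.2.2.2) (m p.2.2.2) (p.1 * n p.2.2.2 + p.2.2.1) *
        LatticeAM.hintCoef (b p.2.2.2) (m p.2.2.2) (p.1 * n p.2.2.2 + p.2.1) :=
    (PTZ.hintEntry hn3 hb3 hm3 ((PTU.index.mul hn3).add PTU.index.weaken.weaken)).mul
      (PTZ.hintCoef hb3 hm3 ((PTU.index.mul hn3).add PTU.index.weaken))
  have h2 := h1.sum hn.weaken.weaken.1 hn.weaken.weaken.2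
  have h3 := PTZ.ofNat (PT.ite (PTP.eq (PT.index (Ω := Ω)).weaken .index) hs.weaken.weaken (.const 0))
  have h4 := ((PTP.eqZ h2 h3).forall_lt hn.weaken.1 hn.weaken.2).forall_lt hn.1 hn.2
  refine ((PTP.lt (.const 0) hs).and h4).congr fun ω => ?_
  simp only [CertOK, Nat.cast_ite, Nat.cast_zero]

theorem PTZ.hintNorm (hn : PTU n) (hb : PT b) (hm : PT m) (hf : PT f) :
    PTZ fun ω => hintNorm (n ω) (b ω) (m ω) (f ω) := by
  have h1 : PTZ fun p : ℕ × ℕ × Ω => LatticeAM.hintCoef (b p.2.2) (m p.2.2) (p.2.1 * n p.2.2 + p.1) *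
      ((digit (b p.2.2) (f p.2.2) p.1 : ℕ) - (b p.2.2 / 2 : ℕ) : ℤ) :=
    (PTZ.hintCoef hb.weaken.weaken hm.weaken.weaken
      ((PTU.index.weaken.mul hn.weaken.weaken).add PTU.index)).mul
      ((PTZ.ofNat (hb.weaken.weaken.digit hf.weaken.weaken .index)).sub
        (.ofNat (hb.weaken.weaken.div (.const 2))))
  have h2 := h1.sum hn.weaken.1 hn.weaken.2
  have h3 := (h2.mul h2).sum hn.1 hn.2
  obtain ⟨p, q, hp, hq, h⟩ := h3
  exact ⟨p, q, hp, hq, fun ω => by rw [← h]; simp [LatticeAM.hintNorm, certNorm, sq]⟩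

theorem PT.piNum (ha : PTU a) : PT fun ω => piNum (a ω) := by
  have h : PT fun p : ℕ × Ω => 2 * p.1 + 2 := ((PT.const 2).mul .index).add (.const 2)
  exact ((PT.const 2).mul (((PT.const 2).mul ha.1).add (.const 2))).mul ((h.mul h).prod ha.1 ha.2)

theorem PT.piDen (ha : PTU a) : PT fun ω => piDen (a ω) := by
  have h : ∀ k, PT fun p : ℕ × Ω => 2 * p.1 + k := fun k => ((PT.const 2).mul .index).add (.const k)
  exact (((PT.const 2).mul ha.1).add (.const 1)).mul (((h 1).mul (h 3)).prod ha.1 ha.2)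

theorem PT.hintWeight (ha : PTU a) (hM : PTU M) (hD : PT D) (hτ : PTZ τ) (hn : PTU n) (hb : PT b)
    (hm : PT m) (hf : PT f) :
    PT fun ω => hintWeight (a ω) (M ω) (D ω) (τ ω) (n ω) (b ω) (m ω) (f ω) := by
  have hQ := PT.hintDen hn hb hm
  have hd := PT.hintScale hn hb hm
  have h1 := ((hD.mul (((PT.piNum ha).mul (hQ.pow (.const 2) (.const 2))).mul
    (PTZ.hintNorm hn hb hm hf).toNat)).div ((PT.piDen ha).mul
      (hd.pow (.const 2) (.const 2)))).add (.const 1)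
  exact (((PTZ.ofNat (hM.1.mul hD)).add hτ).sub (.ofNat h1)).toNat.pow hM.1 hM.2

theorem PTP.pointOK (ha : PTU a) (hM : PTU M) (hD : PT D) (hτ : PTZ τ) (hn : PTU n) (hb : PT b)
    (hm : PT m) (hf : PT f) :
    PTP fun ω => PointOK (a ω) (M ω) (D ω) (τ ω) (n ω) (b ω) (m ω) (f ω) := by
  refine (PTP.not (PTP.forall_lt (P := fun p : ℕ × Ω => digit (b p.2) (f p.2) p.1 = b p.2 / 2)
    hn.1 hn.2 (PTP.eq (hb.weaken.digit hf.weaken .index) (hb.weaken.div (.const 2))))).and ?_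
  exact PTP.lt (hb.digit hf hn) (PT.hintWeight ha hM hD hτ hn hb hm hf)

end
end

/-! ## Parameters -/

section
open Polynomial

/-- The parameters, as polynomials in the length of the instance. -/
noncomputable def accP (c : ℕ) : ℕ[X] := (X + 1) ^ c
noncomputable def boundP (c : ℕ) : ℕ[X] := X * (3 + accP c + 2 * (X + 1) ^ 3)
noncomputable def expoP (c : ℕ) : ℕ[X] :=
  64 * accP c * (accP c * (2 * boundP c + 6) + 1) ^ 2 +
    8 * accP c * (boundP c + accP c * (2 * boundP c + 6) + 16 * accP c)
-- With `D = 32 a`, the rounding losses `1 / D` and `2 / D` are small compared with the gap `1 / (2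
-- a)`.
noncomputable def precP (c : ℕ) : ℕ[X] := 32 * accP c
-- With `16 a` repetitions, `exp (1/(4a))` grows to `exp 4 ≥ 36`, while `exp (1/(32a))` stays at
-- `exp (1/2) ≤ 3`.
noncomputable def repP (c : ℕ) : ℕ[X] := 16 * accP c
noncomputable def widthP (c : ℕ) : ℕ[X] :=
  expoP c * expoP c * precP c + expoP c + 4 * (X + 1) ^ 3 + 4
noncomputable def hintP : ℕ[X] := 5 * X + 6
-- The modulus has to exceed the threshold times five times the range of tuple codes. The summand
-- with `hintP` makes room for the hints, since message and coins have the same length.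
noncomputable def hashP (c : ℕ) : ℕ[X] :=
  widthP c * (X + 1) * repP c + widthP c * hintP + widthP c * repP c + 20

end

/-- A lower bound for the size of the set that Merlin samples from, on positive instances, up to a
constant factor. -/
noncomputable def threshold (c l : ℕ) : ℕ :=
  9 * ((expoP c).eval l * (precP c).eval l) ^ ((expoP c).eval l * (repP c).eval l)

/-- The number Merlin claims to be hashed to a small value. -/
noncomputable def claimed (c l n m : ℕ) : ℕ :=
  m / (2 ^ (widthP c).eval l) ^ hintP.eval l %
    ((2 ^ (widthP c).eval l) ^ (n + 1)) ^ (repP c).eval l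

/-- The decision of the verifier, for dimension `n` and length `l`. -/
def Checks (c l : ℕ) (τ : ℤ) (n X r m : ℕ) : Prop :=
  0 < n ∧ ParseOK X n (2 ^ (widthP c).eval l) m ∧ CertOK n (2 ^ (widthP c).eval l) m ∧
  (∀ t < (repP c).eval l, PointOK ((accP c).eval l) ((expoP c).eval l) ((precP c).eval l) τ n
    (2 ^ (widthP c).eval l) m
    (digit ((2 ^ (widthP c).eval l) ^ (n + 1)) (claimed c l n m) t)) ∧
  hashHit (2 ^ (hashP c).eval l) (2 ^ (hashP c).eval l / threshold c l) r (claimed c l n m)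

/-- The decision of the verifier. The dimension is the first digit of the message. -/
noncomputable def Good (c : ℕ) (τ : ℕ → ℕ → ℤ) (X r m : ℕ) : Prop :=
  Checks c (Nat.size X - 1)
    (τ (min (m % 2 ^ (widthP c).eval (Nat.size X - 1)) (Nat.size X - 1))
      ((precP c).eval (Nat.size X - 1)))
    (min (m % 2 ^ (widthP c).eval (Nat.size X - 1)) (Nat.size X - 1)) X r m

section
variable {Ω : Type} [Enc Ω] {X r m n l : Ω → ℕ} {τ : Ω → ℤ}

theorem PT.claimed (c : ℕ) (hl : PTU l) (hn : PTU n) (hm : PT m) :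
    PT fun ω => claimed c (l ω) (n ω) (m ω) := by
  have hw := hl.polyEval (widthP c)
  have hL := hl.polyEval hintP
  have hN := hl.polyEval (repP c)
  have hn1 := hn.add (.const 1)
  have hb : PT fun ω => 2 ^ (widthP c).eval (l ω) := (PT.const 2).pow hw.1 hw.2
  exact (hm.div (hb.pow hL.1 hL.2)).mod ((hb.pow hn1.1 hn1.2).pow hN.1 hN.2)

theorem PTP.checks (c : ℕ) (hl : PTU l) (hτ : PTZ τ) (hn : PTU n) (hX : PT X) (hr : PT r)
    (hm : PT m) : PTP fun ω => Checks c (l ω) (τ ω) (n ω) (X ω) (r ω) (m ω) := by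
  have hw := hl.polyEval (widthP c)
  have hN := hl.polyEval (repP c)
  have hM := hl.polyEval (expoP c)
  have hD := hl.polyEval (precP c)
  have hW := hl.polyEval (hashP c)
  have hn1 := hn.add (.const 1)
  have hb : PT fun ω => 2 ^ (widthP c).eval (l ω) := (PT.const 2).pow hw.1 hw.2
  have hu := PT.claimed c hl hn hm
  have hQ : PT fun ω => 2 ^ (hashP c).eval (l ω) := (PT.const 2).pow hW.1 hW.2
  have hK : PT fun ω => threshold c (l ω) :=
    (PT.const 9).mul ((hM.1.mul hD.1).pow (hM.mul hN).1 (hM.mul hN).2)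
  refine (PTP.lt (.const 0) hn.1).and ((PTP.parseOK hX hn hb hm).and
    ((PTP.certOK hn hb hm).and (.and ?_ ?_)))
  · exact PTP.forall_lt hN.1 hN.2
      (PTP.pointOK (hl.polyEval (accP c)).weaken hM.weaken hD.1.weaken hτ.weaken hn.weaken
        hb.weaken hm.weaken ((hb.pow hn1.1 hn1.2).weaken.digit hu.weaken .index))
  · exact PTP.lt ((((hr.mod hQ).mul hu).add (hr.div hQ)).mod hQ) (hQ.div hK)

theorem PTP.good (c : ℕ) {τ : ℕ → ℕ → ℤ}
    (hτ : ∀ {f g : VInput → ℕ}, PTU f → PTU g → PTZ fun ω => τ (f ω) (g ω)) :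
    PTP fun ω : VInput => Good c τ ω.X ω.r ω.m := by
  have hs := PTU.size PT.X
  have hl : PTU fun ω : VInput => Nat.size ω.X - 1 :=
    ⟨hs.1.sub (.const 1), hs.2.mono fun ω => Nat.sub_le _ _⟩
  have hw := hl.polyEval (widthP c)
  -- Cutting the claimed dimension off at the length keeps it polynomially bounded for every
  -- message; the true dimension is not affected.
  have hn : PTU fun ω : VInput =>
      min (ω.m % 2 ^ (widthP c).eval (Nat.size ω.X - 1)) (Nat.size ω.X - 1) :=
    ⟨(PT.m.mod ((PT.const 2).pow hw.1 hw.2)).min hl.1, hl.2.mono fun ω => min_le_right _ _⟩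
  exact PTP.checks c hl (hτ hn (hl.polyEval (precP c))) hn PT.X PT.r PT.m

end

/-! ## Correctness of the verifier -/

section
variable {n : ℕ} {B : Matrix (Fin n) (Fin n) ℚ}

/-- The verifier needs no decoder: the code is prefix-free, so any digits that pass the arithmetic
check are the true entries. -/
theorem ParseOK.eq {n' b m : ℕ} (h : ParseOK (codeBits (encodeMatrix B)) n' b m) :
    n' = n ∧ hintDen n b m = commonDen B ∧ ∀ e < n * n, hintEntry n b m e = scaledEntry B e := by
  obtain ⟨h1, h2⟩ := parse_unique B (A := fun e => digit b m (5 * e + 1))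
    (D := fun e => digit b m (5 * e + 2)) (S := fun e => digit b m (5 * e + 3) % 2)
    (Y := fun e => digit b m (5 * e + 4)) (fun e => Nat.mod_lt _ two_pos) h.1 h.2
  have h3 : hintDen n b m = commonDen B :=
    Finset.prod_congr rfl fun e he => (h2 e (Finset.mem_range.1 he)).2.2
  refine ⟨h1, h3, fun e he => ?_⟩
  obtain ⟨hs, ha, hd⟩ := h2 e he
  rw [hintEntry, h3, hs, ha, hd, scaledEntry]
  congr 1
  by_cases hneg : (rowMajor B e).num < 0
  · simp only [hneg, decide_true, Bool.toNat_true]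
    omega
  · simp only [hneg, decide_false, Bool.toNat_false]
    omega

theorem certOK_iff {b m : ℕ} (h : ∀ e < n * n, hintEntry n b m e = scaledEntry B e) :
    CertOK n b m ↔ IsDualCert B (hintCoef b m) (hintScale n b m) := by
  refine and_congr_right fun _ => forall₄_congr fun j hj k hk => ?_
  rw [Finset.sum_congr rfl fun i hi => ?_]
  rw [h _ (index_lt ⟨i, Finset.mem_range.1 hi⟩ ⟨j, hj⟩)]

/-- The squared norm is a rational number with known numerator and denominator, so the floor in
`powWeight` is an integer division. -/
theorem hintWeight_eq {a M D b m : ℕ} {τ : ℤ} (h : IsDualCert B (hintCoef b m) (hintScale n b m))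
    (hQ : hintDen n b m = commonDen B) (f : ℕ) :
    hintWeight a M D τ n b m f = latticeWeight B a M D τ (digitVec n b f) := by
  have hnn : 0 ≤ hintNorm n b m f := by
    rw [hintNorm, certNorm]
    exact Finset.sum_nonneg fun i _ => sq_nonneg _
  have key : (D : ℝ) * (piApprox a * ‖dualVec B (digitVec n b f)‖ ^ 2) =
      (D * (piNum a * hintDen n b m ^ 2 * (hintNorm n b m f).toNat) : ℕ) /
        (piDen a * hintScale n b m ^ 2 : ℕ) := by
    have h1 := h.norm_sq fun k => ((digit b f k : ℕ) : ℤ) - (b / 2 : ℕ)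
    change ‖dualVec B (digitVec n b f)‖ ^ 2 = _ * ((hintNorm n b m f : ℤ) : ℝ) / _ at h1
    have h2 : ((hintNorm n b m f : ℤ) : ℝ) = ((hintNorm n b m f).toNat : ℝ) := by
      conv_lhs => rw [← Int.toNat_of_nonneg hnn]
      rfl
    rw [h1, h2, piApprox, hQ]
    push_cast
    rw [div_mul_div_comm, mul_div_assoc', mul_assoc]
  rw [hintWeight, latticeWeight, powWeight, key, Nat.floor_div_eq_div]

theorem pointOK_iff {a M D b m : ℕ} {τ : ℤ} (h : IsDualCert B (hintCoef b m) (hintScale n b m))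
    (hQ : hintDen n b m = commonDen B) {f : ℕ} (hf : f < b ^ (n + 1)) :
    PointOK a M D τ n b m f ↔ f ∈ weightedPoints n b (latticeWeight B a M D τ) := by
  rw [weightedPoints, Finset.mem_filter, Finset.mem_range, PointOK, hintWeight_eq h hQ]
  have : (∀ k < n, digit b f k = b / 2) ↔ digitVec n b f = 0 := by
    rw [funext_iff]
    constructor
    · intro h0 k
      simp only [digitVec, Pi.zero_apply, sub_eq_zero]
      exact_mod_cast h0 k k.2
    · intro h0 k hk
      have := h0 ⟨k, hk⟩
      simp only [digitVec, Pi.zero_apply, sub_eq_zero] at this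
      exact_mod_cast this
  rw [this]
  exact ⟨fun h => ⟨hf, h⟩, fun h => h.2⟩

theorem digit_add_mul {b L f i : ℕ} (hi : i < L) (hb : 0 < b) (u : ℕ) :
    digit b (f + b ^ L * u) i = digit b f i := by
  obtain ⟨k, rfl⟩ : ∃ k, L = i + 1 + k := ⟨L - (i + 1), by omega⟩
  have : b ^ (i + 1 + k) * u = b ^ i * (b * (b ^ k * u)) := by ring
  rw [digit, this, Nat.add_mul_div_left _ _ (Nat.pow_pos hb), Nat.add_mul_mod_self_left]

/-- An honest prover can supply the hints. -/
theorem exists_hints (hB : B.det ≠ 0) {h : ℕ}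
    (hh : 4 * ((encodeMatrix B).length + 1) ^ 3 + 4 ≤ h) :
    ∃ f < (2 ^ h) ^ (5 * (encodeMatrix B).length + 6), ∀ u,
      let m := f + (2 ^ h) ^ (5 * (encodeMatrix B).length + 6) * u
      m % 2 ^ h = n ∧ ParseOK (codeBits (encodeMatrix B)) n (2 ^ h) m ∧ CertOK n (2 ^ h) m := by
  obtain ⟨E, d, hc, hd, hE⟩ := exists_dualCert_le hB
  set l := (encodeMatrix B).length with hl
  have hsq : n * n ≤ l := sq_dim_le_length B
  set b := 2 ^ h with hb
  have hb0 : 0 < b := Nat.two_pow_pos _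
  have big1 : 2 ^ (l + 1) < b := Nat.pow_lt_pow_right one_lt_two (by
    have : l + 1 ≤ (l + 1) ^ 3 := Nat.le_self_pow three_ne_zero _
    omega)
  have big3 : 2 ^ (l + 1) ^ 3 < 2 ^ (h - 1) := Nat.pow_lt_pow_right one_lt_two (by omega)
  have hb2 : b = 2 * 2 ^ (h - 1) := by
    rw [← pow_succ', Nat.sub_add_cancel (by omega)]
  have hbh : b / 2 = 2 ^ (h - 1) := by omega
  -- Digit `0` is the dimension. Digits `5 e + 1` to `5 e + 5` hold numerator, denominator, sign,
  -- code of the suffix, and certificate coefficient of position `e`. The free slot `5 n² + 1` holds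
  -- `d`.
  let v : ℕ → ℕ → ℕ := fun e k =>
    if k = 0 then if e = n * n then d else (rowMajor B e).num.natAbs
    else if k = 1 then (rowMajor B e).den
    else if k = 2 then (decide ((rowMajor B e).num < 0)).toNat
    else if k = 3 then suffixCode B e
    else (E e + (b / 2 : ℕ)).toNat
  let g : ℕ → ℕ := fun i => if i = 0 then n else v ((i - 1) / 5) ((i - 1) % 5)
  -- Values too large for a digit are replaced by `0`; this never happens at the positions that are
  -- read.
  obtain ⟨f, hf, hfd⟩ := digits_exists (b := b) (5 * l + 6) (fun i => if g i < b then g i else 0)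
    fun i _ => by split_ifs <;> assumption
  refine ⟨f, hf, fun u => ?_⟩
  set m := f + b ^ (5 * l + 6) * u with hm
  have dig : ∀ i < 5 * l + 6, g i < b → digit b m i = g i := fun i hi hg => by
    have : digit b f i = g i := by
      have := hfd i hi
      simpa only [if_pos hg] using this
    rw [hm, digit_add_mul hi hb0, this]
  have gv : ∀ e k, k < 5 → g (5 * e + (k + 1)) = v e k := fun e k hk => by
    have h1 : (5 * e + (k + 1) - 1) / 5 = e := by omega
    have h2 : (5 * e + (k + 1) - 1) % 5 = k := by omega
    simp only [g, h1, h2]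
    rw [if_neg (by omega)]
  have d0 : digit b m 0 = n := dig 0 (by omega)
    (lt_of_le_of_lt (dim_le_length B) ((Nat.lt_two_pow_self.trans
      (Nat.pow_lt_pow_right one_lt_two (Nat.lt_succ_self _))).trans big1))
  have d1 : ∀ e < n * n, digit b m (5 * e + 1) = (rowMajor B e).num.natAbs := fun e he => by
    have := gv e 0 (by omega)
    simp only [v, if_pos rfl, if_neg he.ne] at this
    rw [dig _ (by omega) (by rw [this]; exact (num_lt B he).trans big1), this]
  have dd : digit b m (5 * (n * n) + 1) = d := by
    have := gv (n * n) 0 (by omega)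
    simp only [v, if_true] at this
    rw [dig _ (by omega) (by rw [this]; omega), this]
  have d2 : ∀ e < n * n, digit b m (5 * e + 2) = (rowMajor B e).den := fun e he => by
    have : g (5 * e + 2) = _ := gv e 1 (by omega)
    simp only [v, one_ne_zero, if_false, if_true] at this
    rw [dig _ (by omega) (by rw [this]; exact (den_lt B he).trans big1), this]
  have d3 : ∀ e < n * n, digit b m (5 * e + 3) = (decide ((rowMajor B e).num < 0)).toNat :=
    fun e he => by
      have : g (5 * e + 3) = _ := gv e 2 (by omega)
      simp only [v, two_ne_zero, if_false, if_true, show (2 : ℕ) ≠ 1 by omega] at this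
      have h1 : 1 < b := lt_of_le_of_lt Nat.one_le_two_pow big1
      rw [dig _ (by omega) (by rw [this]; exact lt_of_le_of_lt (Bool.toNat_le _) h1), this]
  have d4 : ∀ e ≤ n * n, digit b m (5 * e + 4) = suffixCode B e := fun e he => by
    have : g (5 * e + 4) = _ := gv e 3 (by omega)
    simp only [v, three_ne_zero, if_false, if_true, show (3 : ℕ) ≠ 1 by omega,
      show (3 : ℕ) ≠ 2 by omega] at this
    rw [dig _ (by omega) (by rw [this]; exact (suffixCode_lt B he).trans big1), this]
  have d5 : ∀ e < n * n, digit b m (5 * e + 5) = (E e + (b / 2 : ℕ)).toNat := fun e he => by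
    have : g (5 * e + 5) = _ := gv e 4 (by omega)
    simp only [v, four_ne_zero, if_false, show (4 : ℕ) ≠ 1 by omega,
      show (4 : ℕ) ≠ 2 by omega, show (4 : ℕ) ≠ 3 by omega] at this
    have hEe := hE e
    rw [dig _ (by omega) (by rw [this]; omega), this]
  have hp : ParseOK (codeBits (encodeMatrix B)) n b m := by
    refine ⟨?_, fun e he => ?_⟩
    · have := d4 0 (Nat.zero_le _)
      rw [codeBits_encodeMatrix, this]
    · rw [d4 e he.le, d4 (e + 1) he, d1 e he, d2 e he, d3 e he, suffixCode_step B he]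
      congr 1
      exact (Nat.mod_eq_of_lt (lt_of_le_of_lt (Bool.toNat_le _) one_lt_two)).symm
  refine ⟨by simpa [digit] using d0, hp, ?_⟩
  rw [certOK_iff hp.eq.2.2, hintScale, dd]
  refine ⟨hc.1, fun j hj k hk => ?_⟩
  rw [← hc.2 j hj k hk]
  refine Finset.sum_congr rfl fun i hi => ?_
  have hidx := index_lt ⟨i, Finset.mem_range.1 hi⟩ ⟨k, hk⟩
  simp only at hidx
  have hEe := hE (i * n + k)
  rw [hintCoef, d5 _ hidx, Int.toNat_of_nonneg (by omega), add_sub_cancel_right]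

open Classical in
/-- The codes of tuples of weighted dual vectors. -/
noncomputable def tuples (c : ℕ) (τ : ℤ) (B : Matrix (Fin n) (Fin n) ℚ) : Finset ℕ :=
  (Finset.range (((2 ^ (widthP c).eval (encodeMatrix B).length) ^ (n + 1)) ^
    (repP c).eval (encodeMatrix B).length)).filter fun u =>
      ∀ t < (repP c).eval (encodeMatrix B).length,
        u / ((2 ^ (widthP c).eval (encodeMatrix B).length) ^ (n + 1)) ^ t %
          ((2 ^ (widthP c).eval (encodeMatrix B).length) ^ (n + 1)) ∈
        weightedPoints n (2 ^ (widthP c).eval (encodeMatrix B).length)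
          (latticeWeight B ((accP c).eval (encodeMatrix B).length)
            ((expoP c).eval (encodeMatrix B).length) ((precP c).eval (encodeMatrix B).length) τ)

/-- This removes the prover's hints from the analysis. Accepted hints are the true data, so the
claimed number codes a tuple of weighted points; conversely, the honest hints can be combined with
any tuple. -/
theorem exists_good_iff (hB : B.det ≠ 0) (hn : 0 < n) (c : ℕ) (τ : ℕ → ℕ → ℤ) (r : ℕ) :
    (∃ m < 2 ^ (2 * hashP c).eval (encodeMatrix B).length,
      Good c τ (codeBits (encodeMatrix B)) r m) ↔
    ∃ u ∈ tuples c (τ n ((precP c).eval (encodeMatrix B).length)) B,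
      hashHit (2 ^ (hashP c).eval (encodeMatrix B).length)
        (2 ^ (hashP c).eval (encodeMatrix B).length / threshold c (encodeMatrix B).length) r u := by
  set l := (encodeMatrix B).length with hl
  have hsize : Nat.size (codeBits (encodeMatrix B)) - 1 = l := by rw [size_codeBits]; rfl
  have hb : 0 < 2 ^ (widthP c).eval l := Nat.two_pow_pos _
  constructor
  · rintro ⟨m, -, hm⟩
    rw [Good, hsize] at hm
    obtain ⟨-, hp, hm⟩ := hm
    obtain ⟨h1, h2, h3⟩ := hp.eq
    rw [h1] at hm
    obtain ⟨hc, ht, hh⟩ := hm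
    have hc' := (certOK_iff h3).1 hc
    refine ⟨claimed c l n m, ?_, hh⟩
    rw [tuples, ← hl, Finset.mem_filter, Finset.mem_range]
    refine ⟨Nat.mod_lt _ (Nat.pow_pos (Nat.pow_pos hb)), fun t ht' => ?_⟩
    exact (pointOK_iff hc' h2 (Nat.mod_lt _ (Nat.pow_pos hb))).1 (ht t ht')
  · rintro ⟨u, hu, hh⟩
    rw [tuples, ← hl, Finset.mem_filter, Finset.mem_range] at hu
    obtain ⟨hu, ht⟩ := hu
    obtain ⟨f, hf, hfu⟩ := exists_hints hB (h := (widthP c).eval l) (by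
      rw [← hl]
      simp only [widthP, Polynomial.eval_add, Polynomial.eval_mul, Polynomial.eval_pow,
        Polynomial.eval_X, Polynomial.eval_one, Polynomial.eval_ofNat]
      omega)
    obtain ⟨h0, hp, hc⟩ := hfu u
    rw [← hl] at h0 hp hc hf
    have hP : hintP.eval l = 5 * l + 6 := by simp [hintP]
    rw [← hP] at h0 hp hc hf
    set m := f + (2 ^ (widthP c).eval l) ^ hintP.eval l * u with hm
    have hclaim : claimed c l n m = u := by
      rw [claimed, hm, Nat.add_mul_div_left _ _ (Nat.pow_pos hb), Nat.div_eq_of_lt hf, zero_add,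
        Nat.mod_eq_of_lt hu]
    have hnl : n ≤ l := dim_le_length B
    refine ⟨m, ?_, ?_⟩
    -- Hints in the low digits and the tuple above them fit into the length of a message.
    · have h1 : m < (2 ^ (widthP c).eval l) ^ hintP.eval l *
          ((2 ^ (widthP c).eval l) ^ (n + 1)) ^ (repP c).eval l := by
        calc m < (2 ^ (widthP c).eval l) ^ hintP.eval l +
              (2 ^ (widthP c).eval l) ^ hintP.eval l * u := by omega
          _ = (2 ^ (widthP c).eval l) ^ hintP.eval l * (u + 1) := by ring
          _ ≤ _ := Nat.mul_le_mul_left _ hu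
      refine h1.trans_le ?_
      rw [← pow_mul, ← pow_mul, ← pow_mul, ← pow_add]
      refine Nat.pow_le_pow_right two_pos ?_
      simp only [hashP, Polynomial.eval_add, Polynomial.eval_mul,
        Polynomial.eval_X, Polynomial.eval_one, Polynomial.eval_ofNat]
      have h2 : (widthP c).eval l * ((n + 1) * (repP c).eval l) ≤
          (widthP c).eval l * (l + 1) * (repP c).eval l := by rw [mul_assoc]; gcongr
      omega
    · rw [Good, hsize, h0, min_eq_left hnl]
      obtain ⟨-, h2, h3⟩ := hp.eq
      refine ⟨hn, hp, hc, fun t ht' => ?_, by rwa [hclaim]⟩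
      rw [hclaim]
      exact (pointOK_iff ((certOK_iff h3).1 hc) h2 (Nat.mod_lt _ (Nat.pow_pos hb))).2 (ht t ht')

end

/-! ## Acceptance probabilities -/

-- The union bound: each of at most `K / 3` elements is hit with probability `I / Q ≤ 1 / K`.
open Classical in
theorem three_mul_card_hashHit_le {Q K I : ℕ} (hQ : 0 < Q) (hI : I ≤ Q) (hK : K * I ≤ Q)
    (S : Finset ℕ) (hS : 3 * S.card ≤ K) :
    3 * ((Finset.range (Q * Q)).filter fun r => ∃ u ∈ S, hashHit Q I r u).card ≤ Q * Q := by
  have h := hash_upper Q I hQ hI S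
  calc 3 * ((Finset.range (Q * Q)).filter fun r => ∃ u ∈ S, hashHit Q I r u).card
      ≤ 3 * (S.card * (Q * I)) := by
        refine Nat.mul_le_mul_left 3 (le_trans (le_of_eq ?_) h)
        congr
    _ = (3 * S.card) * I * Q := by ring
    _ ≤ K * I * Q := by gcongr
    _ ≤ Q * Q := by gcongr

-- The second moment bound of `hash_lower`, divided by `k I`, leaves the factor `Q + k (I + s)`. It
-- is at most `3/2 * k I`, because `4 Q ≤ k (I + 1)` and `1 + 4 s ≤ I`.
open Classical in
theorem le_three_mul_card_hashHit {Q K I s : ℕ} (hQ : 0 < Q) (hI : I ≤ Q) (hK : Q ≤ K * (I + 1))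
    (hs : 1 + 4 * s ≤ I) (S : Finset ℕ) (hS : ∀ u ∈ S, u ≤ s) (hcard : 4 * K ≤ S.card) :
    2 * (Q * Q) ≤ 3 * ((Finset.range (Q * Q)).filter fun r => ∃ u ∈ S, hashHit Q I r u).card := by
  have h := hash_lower Q I s hQ hI S hS
  set R := ((Finset.range (Q * Q)).filter fun r => ∃ u ∈ S, hashHit Q I r u).card with hR
  set k := S.card
  have hk : 0 < k := by
    rcases Nat.eq_zero_or_pos K with rfl | h
    · omega
    · omega
  have hI0 : 0 < I := by omega
  have h1 : k * I * Q ^ 2 ≤ R * (Q + k * (I + s)) := by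
    refine Nat.le_of_mul_le_mul_left ?_ (Nat.mul_pos hk hI0)
    calc k * I * (k * I * Q ^ 2) = (k * (Q * I)) ^ 2 := by ring
      _ ≤ _ := h
      _ = k * I * (R * (Q + k * (I + s))) := by ring
  have h2 : 2 * (Q + k * (I + s)) ≤ 3 * (k * I) := by
    have h3 : 4 * Q ≤ k * (I + 1) := by
      calc 4 * Q ≤ 4 * (K * (I + 1)) := by omega
        _ = 4 * K * (I + 1) := by ring
        _ ≤ k * (I + 1) := by gcongr
    have h4 : k * (1 + 4 * s) ≤ k * I := Nat.mul_le_mul_left k hs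
    have e1 : k * (I + s) = k * I + k * s := by ring
    have e2 : k * (I + 1) = k * I + k := by ring
    have e3 : k * (1 + 4 * s) = k + 4 * (k * s) := by ring
    omega
  refine Nat.le_of_mul_le_mul_left ?_ (Nat.mul_pos hk hI0)
  calc k * I * (2 * (Q * Q)) = 2 * (k * I * Q ^ 2) := by ring
    _ ≤ 2 * (R * (Q + k * (I + s))) := by omega
    _ = R * (2 * (Q + k * (I + s))) := by ring
    _ ≤ R * (3 * (k * I)) := Nat.mul_le_mul_left _ h2
    _ = k * I * (3 * R) := by ring

/-! ### Numerical relations between the parameters -/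

section
variable (c l : ℕ)

theorem accP_eval : (accP c).eval l = (l + 1) ^ c := by simp [accP]

theorem precP_eval : (precP c).eval l = 32 * (accP c).eval l := by simp [precP]

theorem repP_eval : (repP c).eval l = 16 * (accP c).eval l := by simp [repP]

theorem accP_pos : 0 < (accP c).eval l := by rw [accP_eval]; positivity

theorem expoP_eval : (expoP c).eval l = 64 * (accP c).eval l *
    ((accP c).eval l * (2 * (boundP c).eval l + 6) + 1) ^ 2 + 8 * (accP c).eval l *
      ((boundP c).eval l + (accP c).eval l * (2 * (boundP c).eval l + 6) +
        16 * (accP c).eval l) := by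
  simp [expoP]

theorem expoP_pos : 0 < (expoP c).eval l := by
  have := accP_pos c l
  rw [expoP_eval]
  positivity

theorem widthP_eval : (widthP c).eval l = (expoP c).eval l * (expoP c).eval l *
    (32 * (accP c).eval l) + (expoP c).eval l + 4 * (l + 1) ^ 3 + 4 := by
  simp [widthP, precP]

theorem threshold_pos : 0 < threshold c l := by
  have h1 := expoP_pos c l
  have h2 := accP_pos c l
  rw [threshold, precP_eval]
  positivity

theorem threshold_le : threshold c l ≤ 2 ^ ((widthP c).eval l * (repP c).eval l + 4) := by
  rw [threshold, pow_add, mul_comm]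
  refine Nat.mul_le_mul ?_ (by norm_num)
  refine (Nat.pow_le_pow_left (Nat.lt_two_pow_self (n := _)).le _).trans ?_
  rw [← pow_mul]
  refine Nat.pow_le_pow_right two_pos ?_
  rw [← mul_assoc]
  refine Nat.mul_le_mul_right _ ?_
  rw [widthP_eval, precP_eval]
  have : (expoP c).eval l * (32 * (accP c).eval l) * (expoP c).eval l =
    (expoP c).eval l * (expoP c).eval l * (32 * (accP c).eval l) := by ring
  omega

/-- The window then has length at least five times the range of tuple codes, so the imperfect
pairwise independence of the hash is harmless. -/
theorem threshold_mul_le {n : ℕ} (hn : n ≤ l) :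
    threshold c l * (5 * ((2 ^ (widthP c).eval l) ^ (n + 1)) ^ (repP c).eval l) ≤
      2 ^ (hashP c).eval l := by
  refine (Nat.mul_le_mul (threshold_le c l) (Nat.mul_le_mul_right _ (show 5 ≤ 2 ^ 3 by norm_num))).trans ?_
  rw [← pow_mul, ← pow_mul, ← pow_add, ← pow_add]
  refine Nat.pow_le_pow_right two_pos ?_
  have h : (widthP c).eval l * ((n + 1) * (repP c).eval l) ≤
      (widthP c).eval l * (l + 1) * (repP c).eval l := by rw [mul_assoc]; gcongr
  have h2 : (hashP c).eval l = (widthP c).eval l * (l + 1) * (repP c).eval l +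
      (widthP c).eval l * hintP.eval l + (widthP c).eval l * (repP c).eval l + 20 := by
    simp [hashP]
  rw [h2]
  omega

end

/-! ### Soundness and completeness of the protocol -/

section
variable {n : ℕ} {B : Matrix (Fin n) (Fin n) ℚ} {c : ℕ} {τ : ℕ → ℕ → ℤ} {T : ℝ}

theorem lt_of_mem_weightedPoints {b f : ℕ} {wt : (Fin n → ℤ) → ℕ}
    (hf : f ∈ weightedPoints n b wt) : f < b ^ (n + 1) :=
  Finset.mem_range.1 (Finset.mem_filter.1 hf).1

theorem lt_of_mem_tuples {τ : ℤ} {u : ℕ} (hu : u ∈ tuples c τ B) :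
    u < ((2 ^ (widthP c).eval (encodeMatrix B).length) ^ (n + 1)) ^
      (repP c).eval (encodeMatrix B).length :=
  Finset.mem_range.1 (Finset.mem_filter.1 hu).1

theorem card_tuples (c : ℕ) (τ : ℤ) (B : Matrix (Fin n) (Fin n) ℚ) :
    (tuples c τ B).card = (weightedPoints n (2 ^ (widthP c).eval (encodeMatrix B).length)
      (latticeWeight B ((accP c).eval (encodeMatrix B).length)
        ((expoP c).eval (encodeMatrix B).length) ((precP c).eval (encodeMatrix B).length) τ)).card ^
      (repP c).eval (encodeMatrix B).length := by
  rw [← card_digits_mem _ fun f hf => lt_of_mem_weightedPoints hf, tuples]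

open Classical in
theorem card_good (hB : B.det ≠ 0) (hn : 0 < n) :
    ((Finset.range (2 ^ (2 * hashP c).eval (encodeMatrix B).length)).filter fun r =>
      ∃ m < 2 ^ (2 * hashP c).eval (encodeMatrix B).length,
        Good c τ (codeBits (encodeMatrix B)) r m).card =
    ((Finset.range (2 ^ (hashP c).eval (encodeMatrix B).length *
      2 ^ (hashP c).eval (encodeMatrix B).length)).filter fun r =>
        ∃ u ∈ tuples c (τ n ((precP c).eval (encodeMatrix B).length)) B,
          hashHit (2 ^ (hashP c).eval (encodeMatrix B).length)
            (2 ^ (hashP c).eval (encodeMatrix B).length / threshold c (encodeMatrix B).length)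
              r u).card := by
  have h : 2 ^ (2 * hashP c).eval (encodeMatrix B).length =
      2 ^ (hashP c).eval (encodeMatrix B).length * 2 ^ (hashP c).eval (encodeMatrix B).length := by
    rw [← pow_add]; congr 1; simp; ring
  simp only [exists_good_iff hB hn]
  rw [h]

-- At most `3 (M D) ^ (M N)` tuples exist, where `N` is the number of repetitions. This is a third
-- of the threshold, and the union bound applies.
open Classical in
theorem accept_le (hB : B.det ≠ 0) (hn : 0 < n)
    (hτ : |(τ n ((precP c).eval (encodeMatrix B).length) : ℝ) -
      ((precP c).eval (encodeMatrix B).length : ℕ) * T| ≤ 1)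
    (hsmall : ∀ F : Finset (Fin n → ℤ), 0 ∉ F →
      ∑ z ∈ F, Real.exp (-(Real.pi * ‖dualVec B z‖ ^ 2)) ≤ Real.exp (-T)) :
    (((Finset.range (2 ^ (2 * hashP c).eval (encodeMatrix B).length)).filter fun r =>
      ∃ m < 2 ^ (2 * hashP c).eval (encodeMatrix B).length,
        Good c τ (codeBits (encodeMatrix B)) r m).card : ℝ) /
      2 ^ (2 * hashP c).eval (encodeMatrix B).length ≤ 1 / 3 := by
  rw [card_good hB hn]
  have hM := expoP_pos c (encodeMatrix B).length
  have ha := accP_pos c (encodeMatrix B).length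
  have hcard := card_points_le (a := (accP c).eval (encodeMatrix B).length)
    (b := 2 ^ (widthP c).eval (encodeMatrix B).length) hM
    (show 0 < (precP c).eval (encodeMatrix B).length by rw [precP_eval]; omega) hτ hsmall
  have hct := card_tuples c (τ n ((precP c).eval (encodeMatrix B).length)) B
  set l := (encodeMatrix B).length
  have h3 : 3 * (tuples c (τ n ((precP c).eval l)) B).card ≤ threshold c l := by
    rw [hct, threshold]
    have h4 := pow_le_pow_left₀ (Nat.cast_nonneg _) hcard ((repP c).eval l)
    rw [mul_pow, ← pow_mul, ← Real.exp_nat_mul] at h4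
    have h5 : Real.exp (((repP c).eval l : ℕ) * (1 / ((precP c).eval l : ℕ))) ≤ 3 := by
      have ha' : (0 : ℝ) < ((accP c).eval l : ℕ) := by exact_mod_cast ha
      have : (((repP c).eval l : ℕ) : ℝ) * (1 / ((precP c).eval l : ℕ)) ≤ 1 := by
        rw [precP_eval, repP_eval, mul_one_div, div_le_one (by positivity)]
        push_cast
        linarith
      exact (Real.exp_le_exp.2 this).trans (by linarith [Real.exp_one_lt_d9])
    have h6 := h4.trans (mul_le_mul_of_nonneg_left h5 (by positivity))
    norm_cast at h6
    omega
  have hQ : 0 < 2 ^ (hashP c).eval l := Nat.two_pow_pos _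
  have h8 := three_mul_card_hashHit_le hQ (Nat.div_le_self _ (threshold c l))
    (Nat.mul_div_le _ (threshold c l)) _ h3
  have h9 : (2 : ℝ) ^ (2 * hashP c).eval l = (2 ^ (hashP c).eval l * 2 ^ (hashP c).eval l : ℕ) := by
    push_cast; rw [← pow_add]; congr 1; simp; ring
  rw [h9, div_le_iff₀ (by positivity)]
  have h10 := (Nat.cast_le (α := ℝ)).2 h8
  push_cast at h10 ⊢
  linarith

-- At least `36 (M D) ^ (M N)` tuples exist, where `N` is the number of repetitions. This is four
-- times the threshold, and the second moment bound applies.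
open Classical in
theorem le_accept (hB : B.det ≠ 0) (hn : 0 < n)
    (hτ : |(τ n ((precP c).eval (encodeMatrix B).length) : ℝ) -
      ((precP c).eval (encodeMatrix B).length : ℕ) * T| ≤ 1)
    (F : Finset (Fin n → ℤ)) (h0 : 0 ∉ F)
    (hlarge : Real.exp (-T + 1 / (2 * ((accP c).eval (encodeMatrix B).length : ℕ))) <
      ∑ z ∈ F, Real.exp (-(Real.pi * (1 + 1 / (((accP c).eval (encodeMatrix B).length : ℕ) : ℝ)) ^ 2 *
        ‖dualVec B z‖ ^ 2))) :
    2 / 3 ≤ (((Finset.range (2 ^ (2 * hashP c).eval (encodeMatrix B).length)).filter fun r =>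
      ∃ m < 2 ^ (2 * hashP c).eval (encodeMatrix B).length,
        Good c τ (codeBits (encodeMatrix B)) r m).card : ℝ) /
      2 ^ (2 * hashP c).eval (encodeMatrix B).length := by
  rw [card_good hB hn]
  have hM := expoP_pos c (encodeMatrix B).length
  have ha := accP_pos c (encodeMatrix B).length
  have hct := card_tuples c (τ n ((precP c).eval (encodeMatrix B).length)) B
  rw [precP_eval] at hct
  have hnl := dim_le_length B
  have hcard := le_card_points hB hn ha (P := (boundP c).eval (encodeMatrix B).length)
    (by simp [boundP, accP]) (expoP_eval c _).ge (widthP_eval c _).ge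
    (by rw [precP_eval] at hτ; exact hτ) F h0 hlarge
  rw [precP_eval]
  set l := (encodeMatrix B).length with hl
  have h3 : 4 * threshold c l ≤ (tuples c (τ n (32 * (accP c).eval l)) B).card := by
    rw [hct, threshold, precP_eval]
    have h4 := pow_le_pow_left₀ (by positivity) hcard ((repP c).eval l)
    rw [mul_pow, ← pow_mul, ← Real.exp_nat_mul] at h4
    have h5 : 36 ≤ Real.exp (((repP c).eval l : ℕ) * (1 / (4 * ((accP c).eval l : ℕ)))) := by
      have ha' : (0 : ℝ) < ((accP c).eval l : ℕ) := by exact_mod_cast ha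
      have : (((repP c).eval l : ℕ) : ℝ) * (1 / (4 * ((accP c).eval l : ℕ))) = (4 : ℕ) * 1 := by
        rw [repP_eval]
        push_cast
        field_simp
        norm_num
      rw [this, Real.exp_nat_mul]
      refine le_trans ?_ (pow_le_pow_left₀ (by norm_num)
        (show (2.7 : ℝ) ≤ Real.exp 1 by linarith [Real.exp_one_gt_d9]) 4)
      norm_num
    have h6 := (mul_le_mul_of_nonneg_left h5 (by positivity)).trans h4
    norm_cast at h6
    omega
  have hQ : 0 < 2 ^ (hashP c).eval l := Nat.two_pow_pos _
  have hK := threshold_pos c l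
  have h8 := le_three_mul_card_hashHit hQ (Nat.div_le_self _ (threshold c l))
    (s := ((2 ^ (widthP c).eval l) ^ (n + 1)) ^ (repP c).eval l)
    (Nat.lt_mul_div_succ _ hK).le (by
      have h := (Nat.le_div_iff_mul_le hK).2 ((mul_comm _ _).trans_le (threshold_mul_le c l hnl))
      have : 0 < ((2 ^ (widthP c).eval l) ^ (n + 1)) ^ (repP c).eval l := by positivity
      omega) _ (fun u hu => (lt_of_mem_tuples hu).le) h3
  have h9 : (2 : ℝ) ^ (2 * hashP c).eval l = (2 ^ (hashP c).eval l * 2 ^ (hashP c).eval l : ℕ) := by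
    push_cast; rw [← pow_add]; congr 1; simp; ring
  rw [h9, le_div_iff₀ (by positivity)]
  have h10 := (Nat.cast_le (α := ℝ)).2 h8
  push_cast at h10 ⊢
  linarith

end

/-! ## The main theorem -/

/-- All that the protocol needs of `εY` and `εN` is one computable level `exp (-T)` separating them.
`T` may depend on the length as well as on the dimension. -/
theorem inCoAM_of_approx {α εY εN : ℕ → ℝ} {c : ℕ} {τ : ℕ → ℕ → ℤ} {T : ℕ → ℕ → ℝ}
    (hτ : ∀ {f g : VInput → ℕ}, PTU f → PTU g → PTZ fun ω => τ (f ω) (g ω))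
    (hT : ∀ n l : ℕ, 0 < n →
      |(τ n ((precP c).eval l) : ℝ) - ((precP c).eval l : ℕ) * T n l| ≤ 1)
    (hα : ∀ n l : ℕ, 0 < n → n ≤ l → 1 / (((accP c).eval l : ℕ) : ℝ) ≤ α n)
    (hεY : ∀ n : ℕ, 0 < n → 0 < εY n)
    (hY : ∀ n l : ℕ, 0 < n → n ≤ l → εY n ≤ Real.exp (-T n l))
    (hN : ∀ n l : ℕ, 0 < n → n ≤ l →
      Real.exp (-T n l + 1 / (2 * ((accP c).eval l : ℕ))) ≤ εN n) :
    InCoAM (gapSPP (fun n => 1 + α n) εY εN) := by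
  refine inAM_of_verifier _ (Good c τ) (PTP.good c hτ) (2 * hashP c) ?_ ?_
  · rintro x ⟨n, B, hn, hB, rfl, h⟩
    have hnl := dim_le_length B
    have hN' := hN n _ hn hnl
    have hpos : (0 : ℝ) < 1 + 1 / (((accP c).eval (encodeMatrix B).length : ℕ) : ℝ) := by positivity
    obtain ⟨F, h0, hF⟩ := exists_sum_gt_of_lt_smoothingParameter hB
      ((Real.exp_pos _).trans_le hN') hpos
      (lt_of_le_of_lt (add_le_add_right (hα n _ hn hnl) 1) h)
    exact le_accept hB hn (hT n _ hn) F h0 (hN'.trans_lt hF)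
  · rintro x ⟨n, B, hn, hB, rfl, h⟩
    exact accept_le hB hn (hT n _ hn) fun F h0 =>
      (sum_exp_le_of_smoothingParameter_le_one hB (hεY n hn) h F h0).trans
        (hY n _ hn (dim_le_length B))

/-- A polynomial time integer approximation of multiples of `-log ε`. -/
theorem EfficientlyApproximable.exists_approx {ε : ℕ → ℝ} (h : EfficientlyApproximable ε) :
    ∃ τ : ℕ → ℕ → ℤ,
      (∀ {f g : VInput → ℕ}, PTU f → PTU g → PTZ fun ω => τ (f ω) (g ω)) ∧
      ∀ n k : ℕ, 0 < n → |(τ n k : ℝ) - k * -Real.log (ε n)| ≤ 1 := by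
  obtain ⟨p, q, h⟩ := h
  -- The program is specified for positive dimension only; `n + (1 - n)` replaces `0` by `1` and
  -- fixes every other `n`.
  choose t σ h1 h2 h3 using fun n k => h (n + (1 - n)) k (by omega)
  have pos : ∀ n, 0 < n → n + (1 - n) = n := fun n hn => by omega
  have hcall : ∀ (j : ℕ) {f g : VInput → ℕ}, PTU f → PTU g →
      PT fun ω => σ (f ω + (1 - f ω)) (g ω) j := fun j f g hf hg =>
    PT.call (O := fun n k => σ n k j) j
      (fun n k hn => ⟨t n k, σ n k, by simpa only [pos n hn] using h1 n k,
        by simpa only [pos n hn] using h2 n k, rfl⟩)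
      (hf.1.add ((PT.const 1).sub hf.1)) hg.1
      (hf.2.add ((PolyBdd.const 1).mono fun ω => Nat.sub_le _ _)) hg.2 fun ω => by omega
  refine ⟨fun n k => (σ (n + (1 - n)) k 1 : ℤ) - σ (n + (1 - n)) k 0,
    fun hf hg => (PTZ.ofNat (hcall 1 hf hg)).sub (.ofNat (hcall 0 hf hg)), fun n k hn => ?_⟩
  have := h3 n k
  dsimp only
  rw [pos n hn] at this ⊢
  rw [abs_sub_comm] at this
  push_cast
  convert this using 2
  ring

theorem exp_half_le_one_add {x : ℝ} (h0 : 0 ≤ x) (h1 : x ≤ 1) : Real.exp (x / 2) ≤ 1 + x := by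
  have h2 := Real.one_sub_inv_le_log_of_pos (show 0 < 1 + x by linarith)
  rw [← Real.le_log_iff_exp_le (by linarith)]
  refine le_trans ?_ h2
  have : 1 - (1 + x)⁻¹ = x / (1 + x) := by field_simp; ring
  rw [this]
  exact div_le_div_of_nonneg_left h0 (by linarith) (by linarith)

theorem one_div_accP_le {c c' n l : ℕ} (hc : c' ≤ c) (hn : n ≤ l) :
    1 / (((accP c).eval l : ℕ) : ℝ) ≤ 1 / ((n : ℝ) + 1) ^ c' := by
  rw [accP_eval]
  refine one_div_le_one_div_of_le (by positivity) ?_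
  have h1 : (n + 1) ^ c' ≤ (l + 1) ^ c :=
    (Nat.pow_le_pow_left (by omega) _).trans (Nat.pow_le_pow_right (by omega) hc)
  exact_mod_cast h1

end LatticeAM

theorem mainTheorem5 (α εY εN : ℕ → ℝ)
    (hα : ∃ c : ℕ, ∀ n : ℕ, 0 < n → 1 / ((n : ℝ) + 1) ^ c ≤ α n)
    (hεY : ∀ n : ℕ, 0 < n → 0 < εY n)
    (hε : ∃ c : ℕ, ∀ n : ℕ, 0 < n → (1 + 1 / ((n : ℝ) + 1) ^ c) * εY n ≤ εN n)
    (hcomp : LatticeAM.EfficientlyApproximable εY ∨ LatticeAM.EfficientlyApproximable εN) :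
    LatticeAM.InCoAM (LatticeAM.gapSPP (fun n => 1 + α n) εY εN) := by
  obtain ⟨c₁, hα⟩ := hα
  obtain ⟨c₂, hε⟩ := hε
  set c := max c₁ c₂ with hc
  have hα' : ∀ n l : ℕ, 0 < n → n ≤ l → 1 / (((LatticeAM.accP c).eval l : ℕ) : ℝ) ≤ α n :=
    fun n l hn hl => (LatticeAM.one_div_accP_le (le_max_left _ _) hl).trans (hα n hn)
  have gap : ∀ n l : ℕ, 0 < n → n ≤ l →
      Real.exp (1 / (2 * ((LatticeAM.accP c).eval l : ℕ))) * εY n ≤ εN n := fun n l hn hl => by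
    have h1 : (1 : ℝ) ≤ ((LatticeAM.accP c).eval l : ℕ) := by exact_mod_cast LatticeAM.accP_pos c l
    have h2 := LatticeAM.exp_half_le_one_add
      (x := 1 / (((LatticeAM.accP c).eval l : ℕ) : ℝ)) (by positivity)
      ((div_le_one (by linarith)).2 h1)
    rw [div_div, mul_comm] at h2
    refine le_trans (mul_le_mul_of_nonneg_right (h2.trans ?_) (hεY n hn).le) (hε n hn)
    linarith [LatticeAM.one_div_accP_le (le_max_right c₁ c₂) hl]
  rcases hcomp with h | h
  · obtain ⟨τ, h1, h2⟩ := h.exists_approx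
    refine LatticeAM.inCoAM_of_approx (c := c) (τ := τ) (T := fun n _ => -Real.log (εY n)) h1
      (fun n l hn => h2 n _ hn) hα' hεY (fun n l hn _ => ?_) fun n l hn hl => ?_
    · rw [neg_neg, Real.exp_log (hεY n hn)]
    · rw [neg_neg, add_comm, Real.exp_add, Real.exp_log (hεY n hn)]
      exact gap n l hn hl
  · obtain ⟨τ, h1, h2⟩ := h.exists_approx
    have hεN : ∀ n, 0 < n → 0 < εN n := fun n hn =>
      (mul_pos (by positivity) (hεY n hn)).trans_le (hε n hn)
    -- If only `εN` is approximable, the level is placed just below it, at `εN * exp (-1/(2a))`.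
    -- Since `D / (2a) = 16` is an integer, shifting `τ` by it introduces no further error.
    refine LatticeAM.inCoAM_of_approx (c := c) (τ := fun n k => τ n k + 16)
      (T := fun n l => -Real.log (εN n) + 1 / (2 * ((LatticeAM.accP c).eval l : ℕ)))
      (fun hf hg => (h1 hf hg).add ⟨_, _, .const 16, .const 0, fun _ => by norm_num⟩)
      (fun n l hn => ?_) hα' hεY (fun n l hn hl => ?_) fun n l hn hl => ?_
    · have h3 := h2 n ((LatticeAM.precP c).eval l) hn
      have h4 : (0 : ℝ) < ((LatticeAM.accP c).eval l : ℕ) := by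
        exact_mod_cast LatticeAM.accP_pos c l
      have h5 : (((LatticeAM.precP c).eval l : ℕ) : ℝ) *
          (1 / (2 * ((LatticeAM.accP c).eval l : ℕ))) = 16 := by
        rw [LatticeAM.precP_eval]
        push_cast
        field_simp
        norm_num
      rw [mul_add, h5]
      push_cast
      convert h3 using 2
      ring
    · rw [neg_add, neg_neg, Real.exp_add, Real.exp_log (hεN n hn), Real.exp_neg,
        ← div_eq_mul_inv, le_div_iff₀ (Real.exp_pos _), mul_comm]
      exact gap n l hn hl
    · rw [neg_add, neg_neg, neg_add_cancel_right, Real.exp_log (hεN n hn)]
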